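/- Let $A$ be a separable C*-algebra (not necessarily unital), let $G$ be a second countable, compact (Hausdorff) group, and let $\alpha\colon G\curvearrowright A$ be a point-norm continuous action by $*$-automorphisms. Let $A_\infty=\ell^\infty(\mathbb N,A)/c_0(\mathbb N,A)$, into which $A$ embeds as constant sequences, and let $F_\infty(A)=(A_\infty\cap A')/\{x\in A_\infty : xa=ax=0 \text{ for all } a\in A\}$, which is a unital C*-algebra. The automorphisms $\alpha_g$, applied componentwise, induce automorphisms $\tilde\alpha_{\infty,g}$ of $F_\infty(A)$; let $F_{\infty,\alpha}(A)$ be the subalgebra of those $y$ for which $g\mapsto\tilde\alpha_{\infty,g}(y)$ is norm continuous. Let $\sigma_g(f)=f(g^{-1}\,\cdot\,)$ for $f\in C(G)$. Assume that $\alpha$ has the Rokhlin property, that is, there is a unital equivariant $*$-homomorphism $(C(G),\sigma)\to(F_{\infty,\alpha}(A),\tilde\alpha_\infty)$. Let $A^\alpha$ be the fixed point algebra, let $\alpha_{\mathrm{co}}\colon A\to C(G)\otimes A=C(G,A)$ be given by $\alpha_{\mathrm{co}}(a)(g)=\alpha_g(a)$, and let $1\otimes\mathrm{id}_A\colon A\to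 C(G,A)$ send $a$ to the constant function $a$. Then for $i=0,1$ the inclusion $A^\alpha\subseteq A$ induces an injective homomorphism $K_i(A^\alpha)\to K_i(A)$, and $$\mathrm{im}\big(K_i(A^\alpha)\hookrightarrow K_i(A)\big)=\{x\in K_i(A) : K_i(\alpha_{\mathrm{co}})(x)=K_i(1\otimes\mathrm{id}_A)(x)\in K_i(C(G)\otimes A)\}.$$ For every $n\ge 2$ the same holds for K-theory with coefficients in $\mathbb Z_n=\mathbb Z/n\mathbb Z$, where $K_i(B;\mathbb Z_n)=K_i(B\otimes\mathcal O_{n+1})$ and $\mathcal O_{n+1}$ is the Cuntz algebra: for $i=0,1$ the homomorphism $K_i(A^\alpha;\mathbb Z_n)\to K_i(A;\mathbb Z_n)$ is injective with image $$\{x\in K_i(A;\mathbb Z_n) : K_i(\alpha_{\mathrm{co}};\mathbb Z_n)(x)=K_i(1\otimes\mathrm{id}_A;\mathbb Z_n)(x)\in K_i(C(G)\otimes A;\mathbb Z_n)\}.$$ -/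

import Mathlib

open scoped ENNReal Topology Matrix
open Filter

noncomputable section

namespace KTheory

theorem continuous_starHom {A B : Type*} [NonUnitalCStarAlgebra A] [NonUnitalCStarAlgebra B]
    (φ : A →⋆ₙₐ[ℂ] B) : Continuous φ :=
  AddMonoidHomClass.continuous_of_bound φ 1 fun x => by
    simpa using NonUnitalStarAlgHom.norm_apply_le φ x

section VMonoid

variable {B : Type*} [Ring B] [StarRing B]

/-- Murray--von Neumann equivalence of square matrices over `B`, possibly of different sizes,
implemented by a rectangular matrix. -/
def MvN {ι κ : Type*} [Fintype ι] [Fintype κ] (p : Matrix ι ι B) (q : Matrix κ κ B) : Prop :=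
  ∃ v : Matrix κ ι B, vᴴ * v = p ∧ v * vᴴ = q

theorem MvN.symm {ι κ : Type*} [Fintype ι] [Fintype κ] {p : Matrix ι ι B} {q : Matrix κ κ B}
    (h : MvN p q) : MvN q p := by
  obtain ⟨v, h1, h2⟩ := h
  exact ⟨vᴴ, by simpa using h2, by simpa using h1⟩

theorem MvN.trans {ι κ μ : Type*} [Fintype ι] [Fintype κ] [Fintype μ]
    {p : Matrix ι ι B} {q : Matrix κ κ B} {r : Matrix μ μ B}
    (hp : p * p = p) (hr : r * r = r) (h : MvN p q) (h' : MvN q r) : MvN p r := by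
  obtain ⟨v, h1, h2⟩ := h
  obtain ⟨w, h3, h4⟩ := h'
  refine ⟨w * v, ?_, ?_⟩
  · calc (w * v)ᴴ * (w * v) = vᴴ * (wᴴ * w) * v := by
          simp only [Matrix.conjTranspose_mul, Matrix.mul_assoc]
      _ = (vᴴ * v) * (vᴴ * v) := by rw [h3, ← h2]; simp only [Matrix.mul_assoc]
      _ = p := by rw [h1, hp]
  · calc (w * v) * (w * v)ᴴ = w * (v * vᴴ) * wᴴ := by
          simp only [Matrix.conjTranspose_mul, Matrix.mul_assoc]
      _ = (w * wᴴ) * (w * wᴴ) := by rw [h2, ← h3]; simp only [Matrix.mul_assoc]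
      _ = r := by rw [h4, hr]

theorem MvN.of_projection {ι : Type*} [Fintype ι] {p : Matrix ι ι B} (hp : IsStarProjection p) :
    MvN p p := by
  have h1 : pᴴ = p := hp.isSelfAdjoint
  have h2 : p * p = p := hp.isIdempotentElem
  exact ⟨p, by rw [h1, h2], by rw [h1, h2]⟩

theorem MvN.of_submatrix {ι κ : Type*} [Fintype ι] [Fintype κ] [DecidableEq ι]
    {p : Matrix ι ι B} (hp : IsStarProjection p) (e : κ ≃ ι) : MvN p (p.submatrix e e) := by
  have h1 : pᴴ = p := hp.isSelfAdjoint
  have h2 : p * p = p := hp.isIdempotentElem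
  refine ⟨p.submatrix e id, ?_, ?_⟩
  · rw [Matrix.conjTranspose_submatrix, h1, Matrix.submatrix_mul_equiv, h2, Matrix.submatrix_id_id]
  · rw [Matrix.conjTranspose_submatrix, h1, Matrix.submatrix_mul _ _ _ _ _ Function.bijective_id |>.symm, h2]

theorem MvN.fromBlocks {ι κ ι' κ' : Type*} [Fintype ι] [Fintype κ] [Fintype ι'] [Fintype κ']
    {p : Matrix ι ι B} {q : Matrix κ κ B} {p' : Matrix ι' ι' B} {q' : Matrix κ' κ' B}
    (h : MvN p q) (h' : MvN p' q') :
    MvN (Matrix.fromBlocks p 0 0 p') (Matrix.fromBlocks q 0 0 q') := by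
  obtain ⟨v, h1, h2⟩ := h
  obtain ⟨w, h3, h4⟩ := h'
  refine ⟨Matrix.fromBlocks v 0 0 w, ?_, ?_⟩ <;>
    simp [Matrix.fromBlocks_conjTranspose, Matrix.fromBlocks_multiply, h1, h2, h3, h4]

theorem isStarProjection_fromBlocks {ι κ : Type*} [Fintype ι] [Fintype κ]
    {p : Matrix ι ι B} {q : Matrix κ κ B} (hp : IsStarProjection p) (hq : IsStarProjection q) :
    IsStarProjection (Matrix.fromBlocks p 0 0 q) := by
  have h1 : pᴴ = p := hp.isSelfAdjoint
  have h2 : p * p = p := hp.isIdempotentElem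
  have h3 : qᴴ = q := hq.isSelfAdjoint
  have h4 : q * q = q := hq.isIdempotentElem
  constructor
  · show _ * _ = _
    simp [Matrix.fromBlocks_multiply, h2, h4]
  · show (_)ᴴ = _
    simp [Matrix.fromBlocks_conjTranspose, h1, h3]

theorem isStarProjection_submatrix {ι κ : Type*} [Fintype ι] [Fintype κ]
    {p : Matrix ι ι B} (hp : IsStarProjection p) (e : κ ≃ ι) :
    IsStarProjection (p.submatrix e e) := by
  have h1 : pᴴ = p := hp.isSelfAdjoint
  have h2 : p * p = p := hp.isIdempotentElem
  constructor
  · show _ * _ = _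
    rw [Matrix.submatrix_mul_equiv, h2]
  · show (_)ᴴ = _
    rw [Matrix.conjTranspose_submatrix, h1]

variable (B) in
/-- Projections in `⋃ₙ Mₙ(B)`. -/
abbrev MatProj : Type _ := Σ n : ℕ, {p : Matrix (Fin n) (Fin n) B // IsStarProjection p}

/-- The direct sum `p ⊕ q` of two matrix projections. -/
def MatProj.dsum (p q : MatProj B) : MatProj B :=
  ⟨p.1 + q.1, (Matrix.fromBlocks p.2.1 0 0 q.2.1).submatrix finSumFinEquiv.symm finSumFinEquiv.symm,
    isStarProjection_submatrix (isStarProjection_fromBlocks p.2.2 q.2.2) _⟩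

variable (B) in
instance matProjSetoid : Setoid (MatProj B) where
  r p q := MvN p.2.1 q.2.1
  iseqv :=
    { refl := fun p => MvN.of_projection p.2.2
      symm := fun h => h.symm
      trans := fun {p _ r} h h' => MvN.trans p.2.2.isIdempotentElem r.2.2.isIdempotentElem h h' }

variable (B) in
/-- The monoid `V(B)` of Murray--von Neumann classes of projections in matrices over `B`. -/
def VMonoid : Type _ := Quotient (matProjSetoid B)

/-- The class `[p] ∈ V(B)` of a matrix projection. -/
def VMonoid.mk (p : MatProj B) : VMonoid B := Quotient.mk _ p

theorem MatProj.dsum_equiv (p q : MatProj B) :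
    MvN (Matrix.fromBlocks p.2.1 0 0 q.2.1) (MatProj.dsum p q).2.1 :=
  MvN.of_submatrix (isStarProjection_fromBlocks p.2.2 q.2.2) _

instance : Add (VMonoid B) where
  add := Quotient.map₂ MatProj.dsum fun p p' hp q q' hq => by
    have h1 := (MatProj.dsum_equiv p q).symm
    have h2 := MatProj.dsum_equiv p' q'
    have h3 := MvN.fromBlocks hp hq
    exact MvN.trans (MatProj.dsum p q).2.2.isIdempotentElem
      (MatProj.dsum p' q').2.2.isIdempotentElem h1
      (MvN.trans (isStarProjection_fromBlocks p.2.2 q.2.2).isIdempotentElem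
        (MatProj.dsum p' q').2.2.isIdempotentElem h3 h2)

instance : Zero (VMonoid B) where
  zero := Quotient.mk _ ⟨0, 0, .zero _⟩

theorem MatProj.dsum_comm (p q : MatProj B) : MvN (p.dsum q).2.1 (q.dsum p).2.1 := by
  refine MvN.trans (p.dsum q).2.2.isIdempotentElem (q.dsum p).2.2.isIdempotentElem
    (p.dsum_equiv q).symm ?_
  refine MvN.trans (isStarProjection_fromBlocks p.2.2 q.2.2).isIdempotentElem
    (q.dsum p).2.2.isIdempotentElem ?_ (q.dsum_equiv p)
  have := MvN.of_submatrix (isStarProjection_fromBlocks p.2.2 q.2.2) (Equiv.sumComm _ _)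
  convert this using 1
  ext (i | i) (j | j) <;> simp

theorem MatProj.dsum_assoc (p q r : MatProj B) :
    MvN ((p.dsum q).dsum r).2.1 (p.dsum (q.dsum r)).2.1 := by
  have hL := MvN.trans (isStarProjection_fromBlocks (isStarProjection_fromBlocks p.2.2 q.2.2)
      r.2.2).isIdempotentElem ((p.dsum q).dsum r).2.2.isIdempotentElem
    (MvN.fromBlocks (p.dsum_equiv q) (MvN.of_projection r.2.2)) ((p.dsum q).dsum_equiv r)
  have hR := MvN.trans (isStarProjection_fromBlocks p.2.2 (isStarProjection_fromBlocks q.2.2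
      r.2.2)).isIdempotentElem (p.dsum (q.dsum r)).2.2.isIdempotentElem
    (MvN.fromBlocks (MvN.of_projection p.2.2) (q.dsum_equiv r)) (p.dsum_equiv (q.dsum r))
  refine MvN.trans ((p.dsum q).dsum r).2.2.isIdempotentElem
    (p.dsum (q.dsum r)).2.2.isIdempotentElem hL.symm ?_
  refine MvN.trans (isStarProjection_fromBlocks (isStarProjection_fromBlocks p.2.2 q.2.2)
    r.2.2).isIdempotentElem (p.dsum (q.dsum r)).2.2.isIdempotentElem ?_ hR
  have := MvN.of_submatrix (isStarProjection_fromBlocks (isStarProjection_fromBlocks p.2.2 q.2.2)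
    r.2.2) (Equiv.sumAssoc _ _ _).symm
  convert this using 1
  ext (i | i | i) (j | j | j) <;> simp

theorem MatProj.zero_dsum (p : MatProj B) :
    MvN (MatProj.dsum ⟨0, 0, .zero _⟩ p).2.1 p.2.1 := by
  refine MvN.trans (MatProj.dsum ⟨0, 0, .zero _⟩ p).2.2.isIdempotentElem
    p.2.2.isIdempotentElem (MatProj.dsum_equiv _ p).symm ?_
  have := MvN.of_submatrix (isStarProjection_fromBlocks
    (.zero (Matrix (Fin 0) (Fin 0) B)) p.2.2) (Equiv.emptySum (Fin 0) _).symm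
  convert this using 1
  ext i j
  simp

instance : AddCommMonoid (VMonoid B) where
  add_assoc := by
    rintro ⟨p⟩ ⟨q⟩ ⟨r⟩
    exact Quotient.sound (MatProj.dsum_assoc p q r)
  add_comm := by
    rintro ⟨p⟩ ⟨q⟩
    exact Quotient.sound (MatProj.dsum_comm p q)
  zero_add := by
    rintro ⟨p⟩
    exact Quotient.sound (MatProj.zero_dsum p)
  add_zero := by
    rintro ⟨p⟩
    refine Quotient.sound (?_ : MvN _ _)
    exact MvN.trans (MatProj.dsum _ _).2.2.isIdempotentElem p.2.2.isIdempotentElem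
      (MatProj.dsum_comm p ⟨0, 0, .zero _⟩) (MatProj.zero_dsum p)
  nsmul := nsmulRec

theorem MvN.map {C : Type*} [Ring C] [StarRing C] [Algebra ℂ B] [Algebra ℂ C]
    (φ : B →⋆ₐ[ℂ] C) {ι κ : Type*} [Fintype ι] [Fintype κ] {p : Matrix ι ι B} {q : Matrix κ κ B}
    (h : MvN p q) : MvN (p.map φ) (q.map φ) := by
  obtain ⟨v, h1, h2⟩ := h
  refine ⟨v.map φ, ?_, ?_⟩
  · rw [← Matrix.conjTranspose_map (f := φ) (fun x => map_star φ x), ← Matrix.map_mul, h1]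
  · rw [← Matrix.conjTranspose_map (f := φ) (fun x => map_star φ x), ← Matrix.map_mul, h2]

/-- Entrywise application of a unital `*`-homomorphism to a matrix projection. -/
def MatProj.map {C : Type*} [Ring C] [StarRing C] [Algebra ℂ B] [Algebra ℂ C]
    (φ : B →⋆ₐ[ℂ] C) (p : MatProj B) : MatProj C :=
  ⟨p.1, p.2.1.map φ, by
    have h1 : p.2.1ᴴ = p.2.1 := p.2.2.isSelfAdjoint
    have h2 : p.2.1 * p.2.1 = p.2.1 := p.2.2.isIdempotentElem
    constructor
    · show _ * _ = _
      rw [← Matrix.map_mul, h2]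
    · show (_)ᴴ = _
      rw [← Matrix.conjTranspose_map (f := φ) (fun x => map_star φ x), h1]⟩

/-- Functoriality of `V`. -/
def VMonoid.map {C : Type*} [Ring C] [StarRing C] [Algebra ℂ B] [Algebra ℂ C]
    (φ : B →⋆ₐ[ℂ] C) : VMonoid B →+ VMonoid C where
  toFun := Quotient.map (MatProj.map φ) fun _ _ h => MvN.map φ h
  map_zero' := by
    refine Quotient.sound (?_ : MvN _ _)
    exact ⟨(0 : Matrix (Fin 0) (Fin 0) C), Matrix.ext fun i => i.elim0, Matrix.ext fun i => i.elim0⟩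
  map_add' := by
    rintro ⟨p⟩ ⟨q⟩
    refine congrArg (Quotient.mk _) ?_
    refine Sigma.ext rfl (heq_of_eq (Subtype.ext ?_))
    have h : ((Matrix.fromBlocks p.2.1 0 0 q.2.1).submatrix finSumFinEquiv.symm
        finSumFinEquiv.symm).map φ = (Matrix.fromBlocks (p.2.1.map φ) 0 0 (q.2.1.map φ)).submatrix
        finSumFinEquiv.symm finSumFinEquiv.symm := by
      rw [← Matrix.submatrix_map, Matrix.fromBlocks_map, Matrix.map_zero _ (map_zero φ),
        Matrix.map_zero _ (map_zero φ)]
    exact h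

variable (B) in
/-- The Grothendieck group of `V(B)`; this is `K₀(B)` when `B` is a unital C*-algebra. -/
abbrev K00 : Type _ := Algebra.GrothendieckAddGroup (VMonoid B)

/-- Functoriality of `K00`. -/
def K00.map {C : Type*} [Ring C] [StarRing C] [Algebra ℂ B] [Algebra ℂ C]
    (φ : B →⋆ₐ[ℂ] C) : K00 B →+ K00 C :=
  Algebra.GrothendieckAddGroup.lift (Algebra.GrothendieckAddGroup.of.comp (VMonoid.map φ))

theorem K00.map_of {C : Type*} [Ring C] [StarRing C] [Algebra ℂ B] [Algebra ℂ C]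
    (φ : B →⋆ₐ[ℂ] C) (x : VMonoid B) :
    K00.map φ (Algebra.GrothendieckAddGroup.of x)
      = Algebra.GrothendieckAddGroup.of (VMonoid.map φ x) :=
  DFunLike.congr_fun (Algebra.GrothendieckAddGroup.lift.symm_apply_apply
    (Algebra.GrothendieckAddGroup.of.comp (VMonoid.map φ))) x

end VMonoid

section K0

variable (A : Type*) [NonUnitalCStarAlgebra A]

/-- The canonical character `ε : Ã → ℂ` of the (minimal, forced) unitization. -/
def unitizationChar : Unitization ℂ A →⋆ₐ[ℂ] ℂ :=
  { Unitization.fstHom ℂ A with map_star' := fun _ => rfl }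

/-- `K₀(A) = ker (K₀(Ã) → K₀(ℂ))`. -/
def K0 : Type _ := (K00.map (unitizationChar A)).ker

instance : AddCommGroup (K0 A) := inferInstanceAs (AddCommGroup (K00.map (unitizationChar A)).ker)

variable {A} {B : Type*} [NonUnitalCStarAlgebra B]

theorem K00_char_map (φ : A →⋆ₙₐ[ℂ] B) (x : K00 (Unitization ℂ A)) :
    K00.map (unitizationChar B) (K00.map (Unitization.starMap φ) x)
      = K00.map (unitizationChar A) x := by
  suffices h : (K00.map (unitizationChar B)).comp (K00.map (Unitization.starMap φ))
      = K00.map (unitizationChar A) from DFunLike.congr_fun h x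
  apply Algebra.GrothendieckAddGroup.lift.symm.injective
  ext x
  obtain ⟨p⟩ := x
  have key : VMonoid.map (unitizationChar B) (VMonoid.map (Unitization.starMap φ)
      (VMonoid.mk p)) = VMonoid.map (unitizationChar A) (VMonoid.mk p) := by
    refine congrArg (Quotient.mk _) (Sigma.ext rfl (heq_of_eq (Subtype.ext ?_)))
    ext i j
    show (Unitization.starMap φ (p.2.1 i j)).fst = (p.2.1 i j).fst
    induction p.2.1 i j with
    | inl_add_inr r a => simp [Unitization.algebraMap_eq_inl]
  show K00.map (unitizationChar B) (K00.map (Unitization.starMap φ)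
    (Algebra.GrothendieckAddGroup.of (VMonoid.mk p)))
      = K00.map (unitizationChar A) (Algebra.GrothendieckAddGroup.of (VMonoid.mk p))
  rw [K00.map_of, K00.map_of, K00.map_of, key]

/-- The homomorphism `K₀(φ) : K₀(A) → K₀(B)`. -/
def K0.map (φ : A →⋆ₙₐ[ℂ] B) : K0 A →+ K0 B :=
  ((K00.map (Unitization.starMap φ)).comp (K00.map (unitizationChar A)).ker.subtype).codRestrict
    (K00.map (unitizationChar B)).ker fun x => by
      have hx : K00.map (unitizationChar A) x = 0 := x.2
      show K00.map (unitizationChar B) (K00.map (Unitization.starMap φ) x) = 0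
      rw [K00_char_map, hx]

end K0

section K1

variable {B : Type*} [Ring B]

/-- The embedding `Mₙ(B) → Mₘ(B)`, `u ↦ u ⊕ 1`, for `n ≤ m`. -/
def padOne {n m : ℕ} (h : n ≤ m) (u : Matrix (Fin n) (Fin n) B) : Matrix (Fin m) (Fin m) B :=
  (Matrix.fromBlocks u 0 0 (1 : Matrix (Fin (m - n)) (Fin (m - n)) B)).submatrix
    (finSumFinEquiv.trans (finCongr (Nat.add_sub_of_le h))).symm
    (finSumFinEquiv.trans (finCongr (Nat.add_sub_of_le h))).symm

theorem padOne_apply {n m : ℕ} (h : n ≤ m) (u : Matrix (Fin n) (Fin n) B) (i j : Fin m) :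
    padOne h u i j = if hij : i.1 < n ∧ j.1 < n then u ⟨i, hij.1⟩ ⟨j, hij.2⟩
      else if i = j then 1 else 0 := by
  obtain ⟨i, rfl⟩ := (finSumFinEquiv.trans (finCongr (Nat.add_sub_of_le h))).surjective i
  obtain ⟨j, rfl⟩ := (finSumFinEquiv.trans (finCongr (Nat.add_sub_of_le h))).surjective j
  unfold padOne
  rw [Matrix.submatrix_apply, Equiv.symm_apply_apply, Equiv.symm_apply_apply]
  rcases i with i | i <;> rcases j with j | j <;>
    simp [Matrix.one_apply, Fin.ext_iff] <;> omega

variable [StarRing B]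

/-- The embedding `u ↦ u ⊕ 1` as a homomorphism of unitary groups. -/
def unitaryPad {n m : ℕ} (h : n ≤ m) :
    unitary (Matrix (Fin n) (Fin n) B) →* unitary (Matrix (Fin m) (Fin m) B) :=
  (Unitary.map
    { toFun := padOne h
      map_one' := by rw [padOne, Matrix.fromBlocks_one, Matrix.submatrix_one_equiv]
      map_mul' := fun u v => by
        rw [padOne, padOne, padOne, Matrix.submatrix_mul_equiv, Matrix.fromBlocks_multiply]
        simp only [Matrix.mul_zero, Matrix.zero_mul, add_zero, zero_add, Matrix.mul_one]
      map_star' := fun u => by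
        simp [padOne, Matrix.star_eq_conjTranspose, Matrix.conjTranspose_submatrix,
          Matrix.fromBlocks_conjTranspose] } :
    unitary (Matrix (Fin n) (Fin n) B) →⋆* unitary (Matrix (Fin m) (Fin m) B)).toMonoidHom

variable [TopologicalSpace B]

theorem continuous_unitaryPad {n m : ℕ} (h : n ≤ m) :
    Continuous (unitaryPad (B := B) h) := by
  refine continuous_induced_rng.2 (continuous_matrix fun i j => ?_)
  show Continuous fun u : unitary (Matrix (Fin n) (Fin n) B) => padOne h u.1 i j
  simp only [padOne_apply]
  split_ifs with h1
  · exact continuous_subtype_val.matrix_elem _ _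
  all_goals exact continuous_const

variable [IsTopologicalRing B] [ContinuousStar B]

theorem pathComponentOne_le_comap {G H : Type*} [Group G] [TopologicalSpace G]
    [IsTopologicalGroup G] [Group H] [TopologicalSpace H] [IsTopologicalGroup H]
    (f : G →* H) (hf : Continuous f) :
    Subgroup.pathComponentOne G ≤ (Subgroup.pathComponentOne H).comap f := by
  intro x hx
  have : Joined (1 : G) x := hx
  have h2 : Joined (f 1) (f x) := this.map hf
  rw [map_one] at h2
  exact h2

variable (B) in
/-- The group `Uₙ(B) / Uₙ(B)₀` of homotopy classes of unitaries in `Mₙ(B)`. -/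
abbrev UPi0 (n : ℕ) : Type _ :=
  unitary (Matrix (Fin n) (Fin n) B) ⧸
    Subgroup.pathComponentOne (unitary (Matrix (Fin n) (Fin n) B))

variable (B) in
/-- The connecting maps `Uₙ(B) / Uₙ(B)₀ → Uₘ(B) / Uₘ(B)₀`, `[u] ↦ [u ⊕ 1]`. -/
def UPi0.pad (n m : ℕ) (h : n ≤ m) : UPi0 B n →* UPi0 B m :=
  QuotientGroup.map _ _ (unitaryPad h) (pathComponentOne_le_comap _ (continuous_unitaryPad h))

instance : DirectedSystem (UPi0 B) (UPi0.pad B · · ·) where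
  map_self := by
    rintro n ⟨u⟩
    refine congrArg (QuotientGroup.mk) (Subtype.ext ?_)
    show padOne le_rfl u.1 = u.1
    ext i j
    simp [padOne_apply]
  map_map := by
    rintro n m k hij hjk ⟨u⟩
    refine congrArg (QuotientGroup.mk) (Subtype.ext ?_)
    show padOne hjk (padOne hij u.1) = padOne (hij.trans hjk) u.1
    ext i j
    simp only [padOne_apply, Fin.ext_iff]
    split_ifs <;> first | rfl | omega

variable (B) in
/-- The direct limit of the groups `Uₙ(B) / Uₙ(B)₀` along `u ↦ u ⊕ 1`. -/
abbrev UStable : Type _ := DirectLimit (UPi0 B) (UPi0.pad B)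

variable {C : Type*} [Ring C] [StarRing C] [TopologicalSpace C] [IsTopologicalRing C]
  [ContinuousStar C] [Algebra ℂ B] [Algebra ℂ C]

/-- The homomorphism `Uₙ(B) / Uₙ(B)₀ → Uₙ(C) / Uₙ(C)₀` induced by a continuous unital
`*`-homomorphism, applied entrywise. -/
def UPi0.map (φ : B →⋆ₐ[ℂ] C) (hφ : Continuous φ) (n : ℕ) : UPi0 B n →* UPi0 C n :=
  QuotientGroup.map _ _
    (Unitary.map
      { toFun := fun u => u.map φ
        map_one' := Matrix.map_one _ (map_zero φ) (map_one φ)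
        map_mul' := fun _ _ => Matrix.map_mul
        map_star' := fun _ => Matrix.conjTranspose_map (f := φ) (fun x => map_star φ x) } :
      unitary (Matrix (Fin n) (Fin n) B) →⋆* unitary (Matrix (Fin n) (Fin n) C)).toMonoidHom
    (pathComponentOne_le_comap _
      (Continuous.subtype_mk (continuous_subtype_val.matrix_map hφ) _))

/-- Functoriality of `UStable`. -/
def UStable.map (φ : B →⋆ₐ[ℂ] C) (hφ : Continuous φ) : UStable B →* UStable C :=
  MonoidHom.mk'
    (DirectLimit.map (UPi0.pad B) (UPi0.pad C) (fun n => UPi0.map φ hφ n) (by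
      rintro n m h ⟨u⟩
      refine congrArg (QuotientGroup.mk) (Subtype.ext ?_)
      show padOne h (u.1.map φ) = (padOne h u.1).map φ
      ext i j
      simp only [padOne_apply, Matrix.map_apply]
      split_ifs <;> simp))
    (by
      intro x y
      obtain ⟨n, u, v, rfl, rfl⟩ := DirectLimit.exists_eq_mk₂ _ x y
      rw [DirectLimit.mul_def]
      simp only [DirectLimit.map_def, DirectLimit.mul_def, map_mul])

/-- `K₁(A)`: the direct limit of the groups of homotopy classes of unitaries in `Mₙ(Ã)`.
The group operation is written multiplicatively. -/
def K1 (A : Type*) [NonUnitalCStarAlgebra A] : Type _ := UStable (Unitization ℂ A)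

instance (A : Type*) [NonUnitalCStarAlgebra A] : Group (K1 A) :=
  inferInstanceAs (Group (UStable (Unitization ℂ A)))

/-- The homomorphism `K₁(φ) : K₁(A) → K₁(B)`. -/
def K1.map {A B : Type*} [NonUnitalCStarAlgebra A] [NonUnitalCStarAlgebra B]
    (φ : A →⋆ₙₐ[ℂ] B) : K1 A →* K1 B :=
  UStable.map (Unitization.starMap φ) (continuous_starHom (Unitization.starMap φ).toNonUnitalStarAlgHom)

end K1

end KTheory

namespace Rokhlin

/-- A closed two-sided `*`-ideal. -/
structure ClosedStarIdeal (E : Type*) [NonUnitalNormedRing E] [StarRing E] [NormedSpace ℂ E]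
    extends Submodule ℂ E where
  mul_left_mem' : ∀ x {y : E}, y ∈ carrier → x * y ∈ carrier
  mul_right_mem' : ∀ {x : E} y, x ∈ carrier → x * y ∈ carrier
  star_mem' : ∀ {x : E}, x ∈ carrier → star x ∈ carrier
  isClosed' : IsClosed carrier

namespace ClosedStarIdeal

variable {E : Type*} [NonUnitalNormedRing E] [StarRing E] [NormedSpace ℂ E]

/-- The quotient of `E` by a closed two-sided `*`-ideal, with the quotient norm. -/
def Quo (I : ClosedStarIdeal E) : Type _ := E ⧸ I.toSubmodule

variable (I : ClosedStarIdeal E)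

instance : IsClosed (I.toSubmodule : Set E) := I.isClosed'

instance : NormedAddCommGroup I.Quo :=
  inferInstanceAs (NormedAddCommGroup (E ⧸ I.toSubmodule))

instance : NormedSpace ℂ I.Quo := inferInstanceAs (NormedSpace ℂ (E ⧸ I.toSubmodule))

/-- The quotient map as a linear map. -/
def mkₗ : E →ₗ[ℂ] I.Quo := I.toSubmodule.mkQ

theorem mkₗ_surjective : Function.Surjective I.mkₗ := I.toSubmodule.mkQ_surjective

theorem mkₗ_eq_iff {x y : E} : I.mkₗ x = I.mkₗ y ↔ x - y ∈ I.toSubmodule :=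
  Submodule.Quotient.eq _

instance : Mul I.Quo where
  mul := Quotient.map₂ (· * ·) fun x x' hx y y' hy => by
    have hx' : x - x' ∈ I.toSubmodule := (Submodule.quotientRel_def _).1 hx
    have hy' : y - y' ∈ I.toSubmodule := (Submodule.quotientRel_def _).1 hy
    refine (Submodule.quotientRel_def _).2 ?_
    have : x * y - x' * y' = (x - x') * y + x' * (y - y') := by noncomm_ring
    rw [this]
    exact add_mem (I.mul_right_mem' _ hx') (I.mul_left_mem' _ hy')

instance : Star I.Quo where
  star := Quotient.map star fun x x' hx => by
    have hx' : x - x' ∈ I.toSubmodule := (Submodule.quotientRel_def _).1 hx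
    refine (Submodule.quotientRel_def _).2 ?_
    rw [← star_sub]
    exact I.star_mem' hx'

theorem mkₗ_mul (x y : E) : I.mkₗ (x * y) = I.mkₗ x * I.mkₗ y := rfl

theorem mkₗ_star (x : E) : I.mkₗ (star x) = star (I.mkₗ x) := rfl

instance : NonUnitalRing I.Quo where
  __ : NormedAddCommGroup I.Quo := inferInstance
  left_distrib x y z := by
    obtain ⟨x, rfl⟩ := I.mkₗ_surjective x
    obtain ⟨y, rfl⟩ := I.mkₗ_surjective y
    obtain ⟨z, rfl⟩ := I.mkₗ_surjective z
    rw [← map_add, ← mkₗ_mul, mul_add, map_add, mkₗ_mul, mkₗ_mul]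
  right_distrib x y z := by
    obtain ⟨x, rfl⟩ := I.mkₗ_surjective x
    obtain ⟨y, rfl⟩ := I.mkₗ_surjective y
    obtain ⟨z, rfl⟩ := I.mkₗ_surjective z
    rw [← map_add, ← mkₗ_mul, add_mul, map_add, mkₗ_mul, mkₗ_mul]
  zero_mul x := by
    obtain ⟨x, rfl⟩ := I.mkₗ_surjective x
    rw [← map_zero I.mkₗ, ← mkₗ_mul, zero_mul]
  mul_zero x := by
    obtain ⟨x, rfl⟩ := I.mkₗ_surjective x
    rw [← map_zero I.mkₗ, ← mkₗ_mul, mul_zero]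
  mul_assoc x y z := by
    obtain ⟨x, rfl⟩ := I.mkₗ_surjective x
    obtain ⟨y, rfl⟩ := I.mkₗ_surjective y
    obtain ⟨z, rfl⟩ := I.mkₗ_surjective z
    rw [← mkₗ_mul, ← mkₗ_mul, ← mkₗ_mul, ← mkₗ_mul, mul_assoc]

instance : NonUnitalNormedRing I.Quo where
  __ : NormedAddCommGroup I.Quo := inferInstance
  __ : NonUnitalRing I.Quo := inferInstance
  norm_mul_le x y := by
    refine le_of_forall_pos_le_add fun ε hε => ?_
    have hcont : Tendsto (fun δ : ℝ => (‖x‖ + δ) * (‖y‖ + δ)) (𝓝[>] 0) (𝓝 (‖x‖ * ‖y‖)) := by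
      have : Continuous fun δ : ℝ => (‖x‖ + δ) * (‖y‖ + δ) := by fun_prop
      simpa using (this.tendsto 0).mono_left nhdsWithin_le_nhds
    obtain ⟨δ, hδ, hδ0⟩ := ((hcont.eventually (gt_mem_nhds (lt_add_of_pos_right _ hε))).and
      self_mem_nhdsWithin).exists
    obtain ⟨a, rfl, ha⟩ := Submodule.Quotient.norm_mk_lt (S := I.toSubmodule) x hδ0
    obtain ⟨b, rfl, hb⟩ := Submodule.Quotient.norm_mk_lt (S := I.toSubmodule) y hδ0
    refine le_trans ?_ hδ.le
    refine (Submodule.Quotient.norm_mk_le I.toSubmodule (a * b)).trans ((norm_mul_le a b).trans ?_)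
    exact mul_le_mul ha.le hb.le (norm_nonneg _) ((norm_nonneg _).trans ha.le)

instance : StarRing I.Quo where
  star_involutive x := by
    obtain ⟨x, rfl⟩ := I.mkₗ_surjective x
    rw [← mkₗ_star, ← mkₗ_star, star_star]
  star_mul x y := by
    obtain ⟨x, rfl⟩ := I.mkₗ_surjective x
    obtain ⟨y, rfl⟩ := I.mkₗ_surjective y
    rw [← mkₗ_mul, ← mkₗ_star, star_mul, mkₗ_mul, mkₗ_star, mkₗ_star]
  star_add x y := by
    obtain ⟨x, rfl⟩ := I.mkₗ_surjective x
    obtain ⟨y, rfl⟩ := I.mkₗ_surjective y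
    rw [← map_add, ← mkₗ_star, star_add, map_add, mkₗ_star, mkₗ_star]

instance [StarModule ℂ E] : StarModule ℂ I.Quo where
  star_smul c x := by
    obtain ⟨x, rfl⟩ := I.mkₗ_surjective x
    rw [← map_smul, ← mkₗ_star, star_smul, map_smul, mkₗ_star]

instance [IsScalarTower ℂ E E] : IsScalarTower ℂ I.Quo I.Quo where
  smul_assoc c x y := by
    obtain ⟨x, rfl⟩ := I.mkₗ_surjective x
    obtain ⟨y, rfl⟩ := I.mkₗ_surjective y
    rw [smul_eq_mul, smul_eq_mul, ← map_smul, ← mkₗ_mul, smul_mul_assoc, map_smul, mkₗ_mul]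

instance [SMulCommClass ℂ E E] : SMulCommClass ℂ I.Quo I.Quo where
  smul_comm c x y := by
    obtain ⟨x, rfl⟩ := I.mkₗ_surjective x
    obtain ⟨y, rfl⟩ := I.mkₗ_surjective y
    rw [smul_eq_mul, smul_eq_mul, ← mkₗ_mul, ← map_smul, ← map_smul, ← mkₗ_mul, mul_smul_comm]

/-- The quotient `*`-homomorphism. -/
def proj : E →⋆ₙₐ[ℂ] I.Quo where
  toFun := I.mkₗ
  map_smul' := map_smul I.mkₗ
  map_zero' := map_zero I.mkₗ
  map_add' := map_add I.mkₗ
  map_mul' := I.mkₗ_mul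
  map_star' := I.mkₗ_star

/-- The `*`-homomorphism between quotients induced by a `*`-homomorphism mapping one ideal into
the other. -/
def mapQuo {E' : Type*} [NonUnitalNormedRing E'] [StarRing E'] [NormedSpace ℂ E']
    (I : ClosedStarIdeal E) (J : ClosedStarIdeal E') (φ : E →⋆ₙₐ[ℂ] E')
    (h : ∀ x ∈ I.toSubmodule, φ x ∈ J.toSubmodule) : I.Quo →⋆ₙₐ[ℂ] J.Quo where
  __ := (Submodule.mapQ I.toSubmodule J.toSubmodule (φ : E →ₗ[ℂ] E') h : I.Quo →ₗ[ℂ] J.Quo)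
  map_zero' := map_zero (Submodule.mapQ I.toSubmodule J.toSubmodule (φ : E →ₗ[ℂ] E') h)
  map_mul' x y := by
    obtain ⟨x, rfl⟩ := I.mkₗ_surjective x
    obtain ⟨y, rfl⟩ := I.mkₗ_surjective y
    exact congrArg J.mkₗ (map_mul φ x y)
  map_star' x := by
    obtain ⟨x, rfl⟩ := I.mkₗ_surjective x
    exact congrArg J.mkₗ (map_star φ x)

theorem mapQuo_proj {E' : Type*} [NonUnitalNormedRing E'] [StarRing E'] [NormedSpace ℂ E']
    (I : ClosedStarIdeal E) (J : ClosedStarIdeal E') (φ : E →⋆ₙₐ[ℂ] E')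
    (h : ∀ x ∈ I.toSubmodule, φ x ∈ J.toSubmodule) (x : E) :
    mapQuo I J φ h (I.proj x) = J.proj (φ x) := rfl

end ClosedStarIdeal

section SequenceAlgebra

variable (A : Type*) [NonUnitalCStarAlgebra A]

/-- `ℓ^∞(ℕ, A)`. -/
abbrev BddSeq : Type _ := lp (fun _ : ℕ => A) ∞

/-- The ideal `c₀(ℕ, A)` of null sequences in `ℓ^∞(ℕ, A)`. -/
def nullSeq : ClosedStarIdeal (BddSeq A) where
  carrier := {x | Tendsto (fun n => ‖x n‖) atTop (𝓝 0)}
  add_mem' {x y} hx hy := by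
    refine squeeze_zero (fun n => norm_nonneg _) (fun n => norm_add_le (x n) (y n)) ?_
    simpa using Tendsto.add hx hy
  zero_mem' := by simp
  smul_mem' c x hx := by
    have : Tendsto (fun n => ‖c‖ * ‖x n‖) atTop (𝓝 0) := by
      simpa using Tendsto.const_mul ‖c‖ hx
    simpa [norm_smul] using this
  mul_left_mem' x y hy := by
    refine squeeze_zero (g := fun n => ‖x‖ * ‖y n‖) (fun n => norm_nonneg _) (fun n => ?_) ?_
    · refine (norm_mul_le (x n) (y n)).trans ?_
      gcongr
      exact lp.norm_apply_le_norm ENNReal.top_ne_zero x n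
    · simpa using Tendsto.const_mul ‖x‖ hy
  mul_right_mem' {x} y hx := by
    refine squeeze_zero (g := fun n => ‖x n‖ * ‖y‖) (fun n => norm_nonneg _) (fun n => ?_) ?_
    · refine (norm_mul_le (x n) (y n)).trans ?_
      gcongr
      exact lp.norm_apply_le_norm ENNReal.top_ne_zero y n
    · simpa using Tendsto.mul_const ‖y‖ hx
  star_mem' {x} hx := by
    simpa using hx
  isClosed' := by
    refine isClosed_of_closure_subset fun x hx => ?_
    rw [Metric.mem_closure_iff] at hx
    show Tendsto _ _ _
    rw [Metric.tendsto_atTop]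
    intro ε hε
    obtain ⟨y, hy, hxy⟩ := hx (ε / 2) (half_pos hε)
    obtain ⟨N, hN⟩ := (Metric.tendsto_atTop.1 hy) (ε / 2) (half_pos hε)
    refine ⟨N, fun n hn => ?_⟩
    have h1 := hN n hn
    simp only [dist_zero_right, norm_norm] at h1 ⊢
    have h2 : ‖x n - y n‖ ≤ ‖x - y‖ := lp.norm_apply_le_norm ENNReal.top_ne_zero (x - y) n
    rw [dist_eq_norm] at hxy
    calc ‖x n‖ = ‖(x n - y n) + y n‖ := by rw [sub_add_cancel]
      _ ≤ ‖x n - y n‖ + ‖y n‖ := norm_add_le _ _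
      _ < ε := by linarith

/-- The sequence algebra `A_∞ = ℓ^∞(ℕ, A) / c₀(ℕ, A)`. -/
abbrev SeqAlg : Type _ := (nullSeq A).Quo

variable {A}

/-- Componentwise application of a `*`-homomorphism to bounded sequences. -/
def bddSeqMap {B : Type*} [NonUnitalCStarAlgebra B] (φ : A →⋆ₙₐ[ℂ] B) :
    BddSeq A →⋆ₙₐ[ℂ] BddSeq B where
  toFun x := ⟨fun n => φ (x n), memℓp_infty ⟨‖x‖, by
    rintro _ ⟨n, rfl⟩
    exact (NonUnitalStarAlgHom.norm_apply_le φ (x n)).trans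
      (lp.norm_apply_le_norm ENNReal.top_ne_zero x n)⟩⟩
  map_smul' c x := by ext n; exact map_smul φ c (x n)
  map_zero' := by ext n; exact map_zero φ
  map_add' x y := by ext n; exact map_add φ (x n) (y n)
  map_mul' x y := by ext n; exact map_mul φ (x n) (y n)
  map_star' x := by ext n; exact map_star φ (x n)

/-- The `*`-homomorphism `φ_∞ : A_∞ → B_∞` induced by componentwise application of `φ`. -/
def seqAlgMap {B : Type*} [NonUnitalCStarAlgebra B] (φ : A →⋆ₙₐ[ℂ] B) :
    SeqAlg A →⋆ₙₐ[ℂ] SeqAlg B :=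
  ClosedStarIdeal.mapQuo (nullSeq A) (nullSeq B) (bddSeqMap φ) fun _ hx =>
    squeeze_zero (fun _ => norm_nonneg _) (fun _ => NonUnitalStarAlgHom.norm_apply_le φ _) hx

variable (A) in
/-- The constant sequences `A → ℓ^∞(ℕ, A)`. -/
def constSeq : A →⋆ₙₐ[ℂ] BddSeq A where
  toFun a := ⟨fun _ => a, memℓp_infty ⟨‖a‖, by rintro _ ⟨n, rfl⟩; exact le_rfl⟩⟩
  map_smul' _ _ := rfl
  map_zero' := rfl
  map_add' _ _ := rfl
  map_mul' _ _ := rfl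
  map_star' _ := rfl

variable (A) in
/-- The canonical embedding `A → A_∞`. -/
def toSeqAlg : A →⋆ₙₐ[ℂ] SeqAlg A := (nullSeq A).proj.comp (constSeq A)

theorem seqAlgMap_toSeqAlg {B : Type*} [NonUnitalCStarAlgebra B] (φ : A →⋆ₙₐ[ℂ] B) (a : A) :
    seqAlgMap φ (toSeqAlg A a) = toSeqAlg B (φ a) := rfl

variable (A) in
/-- The relative commutant `A_∞ ∩ A'`. -/
def relCommutant : NonUnitalStarSubalgebra ℂ (SeqAlg A) where
  carrier := {x | ∀ a, x * toSeqAlg A a = toSeqAlg A a * x}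
  add_mem' hx hy a := by rw [add_mul, mul_add, hx a, hy a]
  zero_mem' a := by rw [zero_mul, mul_zero]
  mul_mem' {x y} hx hy a := by rw [mul_assoc, hy a, ← mul_assoc, hx a, mul_assoc]
  smul_mem' c x hx a := by rw [smul_mul_assoc, mul_smul_comm, hx a]
  star_mem' {x} hx a := by
    have := congrArg star (hx (star a))
    rw [star_mul, star_mul, map_star, star_star] at this
    exact this.symm

variable (A) in
/-- The annihilator `ann(A, A_∞)`, as an ideal in `A_∞ ∩ A'`. -/
def annIdeal : ClosedStarIdeal (relCommutant A) where
  carrier := {x | ∀ a, x.1 * toSeqAlg A a = 0 ∧ toSeqAlg A a * x.1 = 0}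
  add_mem' {x y} hx hy a := by
    constructor
    · show (x.1 + y.1) * _ = 0
      rw [add_mul, (hx a).1, (hy a).1, add_zero]
    · show _ * (x.1 + y.1) = 0
      rw [mul_add, (hx a).2, (hy a).2, add_zero]
  zero_mem' a := ⟨zero_mul _, mul_zero _⟩
  smul_mem' c x hx a := by
    constructor
    · show (c • x.1) * _ = 0
      rw [smul_mul_assoc, (hx a).1, smul_zero]
    · show _ * (c • x.1) = 0
      rw [mul_smul_comm, (hx a).2, smul_zero]
  mul_left_mem' x y hy a := by
    constructor
    · show (x.1 * y.1) * _ = 0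
      rw [mul_assoc, (hy a).1, mul_zero]
    · show _ * (x.1 * y.1) = 0
      rw [← mul_assoc, ← x.2 a, mul_assoc, (hy a).2, mul_zero]
  mul_right_mem' {x} y hx a := by
    constructor
    · show (x.1 * y.1) * _ = 0
      rw [mul_assoc, y.2 a, ← mul_assoc, (hx a).1, zero_mul]
    · show _ * (x.1 * y.1) = 0
      rw [← mul_assoc, (hx a).2, zero_mul]
  star_mem' {x} hx a := by
    constructor
    · show star x.1 * _ = 0
      have := congrArg star (hx (star a)).2
      rwa [star_mul, map_star, star_star, star_zero] at this
    · show _ * star x.1 = 0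
      have := congrArg star (hx (star a)).1
      rwa [star_mul, map_star, star_star, star_zero] at this
  isClosed' := by
    have : {x : relCommutant A | ∀ a, x.1 * toSeqAlg A a = 0 ∧ toSeqAlg A a * x.1 = 0}
        = ⋂ a, ({x | x.1 * toSeqAlg A a = 0} ∩ {x | toSeqAlg A a * x.1 = 0}) := by
      ext x; simp
    show IsClosed {x : relCommutant A | _}
    rw [this]
    refine isClosed_iInter fun a => IsClosed.inter ?_ ?_
    · exact isClosed_eq (continuous_subtype_val.mul continuous_const) continuous_const
    · exact isClosed_eq ((continuous_const (y := toSeqAlg A a)).mul continuous_subtype_val)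
        continuous_const

variable (A) in
/-- The central sequence algebra `F_∞(A) = (A_∞ ∩ A') / ann(A, A_∞)`. -/
abbrev CentralSeqAlg : Type _ := (annIdeal A).Quo

/-- The restriction of `θ_∞` to `A_∞ ∩ A'`, for an automorphism `θ` of `A`. -/
def relCommutantMap (θ : A ≃⋆ₐ[ℂ] A) : relCommutant A →⋆ₙₐ[ℂ] relCommutant A :=
  NonUnitalStarAlgHom.codRestrict
    ((seqAlgMap (θ : A →⋆ₙₐ[ℂ] A)).comp (NonUnitalStarSubalgebraClass.subtype (relCommutant A)))
    (relCommutant A) fun x a => by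
      have h := congrArg (seqAlgMap (θ : A →⋆ₙₐ[ℂ] A)) (x.2 (θ.symm a))
      rw [map_mul, map_mul, seqAlgMap_toSeqAlg] at h
      simpa using h

/-- The induced `*`-endomorphism of `F_∞(A)`, for an automorphism `θ` of `A`. -/
def centralSeqMap (θ : A ≃⋆ₐ[ℂ] A) : CentralSeqAlg A →⋆ₙₐ[ℂ] CentralSeqAlg A :=
  ClosedStarIdeal.mapQuo (annIdeal A) (annIdeal A) (relCommutantMap θ) fun x hx a => by
    have h1 := congrArg (seqAlgMap (θ : A →⋆ₙₐ[ℂ] A)) (hx (θ.symm a)).1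
    have h2 := congrArg (seqAlgMap (θ : A →⋆ₙₐ[ℂ] A)) (hx (θ.symm a)).2
    rw [map_mul, map_zero, seqAlgMap_toSeqAlg] at h1 h2
    rw [show (θ : A →⋆ₙₐ[ℂ] A) (θ.symm a) = a from θ.apply_symm_apply a] at h1 h2
    exact ⟨h1, h2⟩

end SequenceAlgebra

section Actions

variable {A G : Type*} [NonUnitalCStarAlgebra A] [Group G]

/-- The fixed point algebra `A^α`. -/
def fixedPoints (α : G →* (A ≃⋆ₐ[ℂ] A)) : NonUnitalStarSubalgebra ℂ A where
  carrier := {a | ∀ g, α g a = a}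
  add_mem' hx hy g := by rw [map_add, hx g, hy g]
  zero_mem' g := map_zero _
  mul_mem' hx hy g := by rw [map_mul, hx g, hy g]
  smul_mem' c x hx g := by rw [map_smul, hx g]
  star_mem' hx g := by rw [map_star, hx g]

instance (α : G →* (A ≃⋆ₐ[ℂ] A)) : IsClosed (fixedPoints α : Set A) := by
  have : (fixedPoints α : Set A) = ⋂ g, {a | α g a = a} := by
    ext x
    rw [Set.mem_iInter]
    exact Iff.rfl
  rw [this]
  exact isClosed_iInter fun g =>
    isClosed_eq (KTheory.continuous_starHom ((α g : A ≃⋆ₐ[ℂ] A) : A →⋆ₙₐ[ℂ] A)) continuous_id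

/-- The inclusion `A^α → A`. -/
def fixedIncl (α : G →* (A ≃⋆ₐ[ℂ] A)) : fixedPoints α →⋆ₙₐ[ℂ] A :=
  NonUnitalStarSubalgebraClass.subtype (fixedPoints α)

variable [TopologicalSpace G]

/-- The coaction `α_co : A → C(G, A) = C(G) ⊗ A`, `α_co(a)(g) = α_g(a)`, of a point-norm
continuous action. -/
def coaction (α : G →* (A ≃⋆ₐ[ℂ] A)) (hα : ∀ a, Continuous fun g => α g a) :
    A →⋆ₙₐ[ℂ] C(G, A) where
  toFun a := ⟨fun g => α g a, hα a⟩
  map_smul' c a := by ext g; exact map_smul (α g) c a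
  map_zero' := by ext g; exact map_zero (α g)
  map_add' a b := by ext g; exact map_add (α g) a b
  map_mul' a b := by ext g; exact map_mul (α g) a b
  map_star' a := by ext g; exact map_star (α g) a

variable (A G) in
/-- The second-factor embedding `1 ⊗ id_A : A → C(G, A) = C(G) ⊗ A`. -/
def constEmb : A →⋆ₙₐ[ℂ] C(G, A) where
  toFun a := ContinuousMap.const G a
  map_smul' _ _ := rfl
  map_zero' := rfl
  map_add' _ _ := rfl
  map_mul' _ _ := rfl
  map_star' _ := rfl

/-- The canonical shift `σ_g(f) = f(g⁻¹ · _)` on `C(G)`. -/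
def shift [IsTopologicalGroup G] (g : G) (f : C(G, ℂ)) : C(G, ℂ) :=
  f.comp ⟨fun h => g⁻¹ * h, continuous_const_mul g⁻¹⟩

/-- The underlying set of the continuous part `F_{∞,α}(A)` of the central sequence algebra. -/
def centralSeqContinuousPart (α : G →* (A ≃⋆ₐ[ℂ] A)) : Set (CentralSeqAlg A) :=
  {y | Continuous fun g => centralSeqMap (α g) y}

/-- The Rokhlin property: there is a unital equivariant `*`-homomorphism
`(C(G), σ) → (F_{∞,α}(A), α̃_∞)`. -/
def HasRokhlinProperty [IsTopologicalGroup G] (α : G →* (A ≃⋆ₐ[ℂ] A)) : Prop :=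
  ∃ φ : C(G, ℂ) →⋆ₙₐ[ℂ] CentralSeqAlg A,
    (∀ f, φ f ∈ centralSeqContinuousPart α) ∧
    (∀ y, φ 1 * y = y ∧ y * φ 1 = y) ∧
    ∀ g f, φ (shift g f) = centralSeqMap (α g) (φ f)

end Actions

section Tensor

universe w u v

/-- A pair of `*`-homomorphisms from `A` and `B` with commuting ranges into a common C*-algebra. -/
structure CommPair (A : Type u) (B : Type v) [NonUnitalCStarAlgebra A]
    [NonUnitalCStarAlgebra B] : Type (max u v (w + 1)) where
  D : Type w
  [inst : NonUnitalCStarAlgebra D]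
  left : A →⋆ₙₐ[ℂ] D
  right : B →⋆ₙₐ[ℂ] D
  comm : ∀ a b, left a * right b = right b * left a

attribute [instance] CommPair.inst

variable {A : Type u} {B : Type v} [NonUnitalCStarAlgebra A] [NonUnitalCStarAlgebra B]

/-- The elementary tensor `a ⊗ b`, as the family of its values in all commuting pairs. -/
def elemTensor (a : A) (b : B) : lp (fun i : CommPair.{w} A B => i.D) ∞ :=
  ⟨fun i => i.left a * i.right b, memℓp_infty ⟨‖a‖ * ‖b‖, by
    rintro _ ⟨i, rfl⟩
    refine (norm_mul_le _ _).trans ?_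
    gcongr
    · exact NonUnitalStarAlgHom.norm_apply_le i.left a
    · exact NonUnitalStarAlgHom.norm_apply_le i.right b⟩⟩

variable (A B) in
/-- The closed `*`-subalgebra generated by the elementary tensors. -/
def maxTensorSubalgebra : NonUnitalStarSubalgebra ℂ (lp (fun i : CommPair.{w} A B => i.D) ∞) :=
  (NonUnitalStarAlgebra.adjoin ℂ
    (Set.range fun x : A × B => elemTensor.{w} x.1 x.2)).topologicalClosure

instance : IsClosed
    (maxTensorSubalgebra.{w} A B : Set (lp (fun i : CommPair.{w} A B => i.D) ∞)) :=
  NonUnitalStarSubalgebra.isClosed_topologicalClosure _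

variable (A B) in
/-- The maximal tensor product `A ⊗_max B`: the completion of the span of the elementary tensors in
the norm given by the supremum over all commuting pairs of `*`-homomorphisms. The pairs
take values in C*-algebras in the universe `w`, which is to be at least as large as those of
`A` and `B`. -/
def MaxTensor : Type (max u v (w + 1)) := maxTensorSubalgebra.{w} A B

instance : NonUnitalCStarAlgebra (MaxTensor.{w} A B) :=
  inferInstanceAs (NonUnitalCStarAlgebra (maxTensorSubalgebra.{w} A B))

variable {A' : Type*} [NonUnitalCStarAlgebra A']

/-- Restriction of a commuting pair along a `*`-homomorphism. -/
def CommPair.restrict (φ : A →⋆ₙₐ[ℂ] A') (i : CommPair.{w} A' B) : CommPair.{w} A B where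
  D := i.D
  left := i.left.comp φ
  right := i.right
  comm a b := i.comm (φ a) b

/-- The map of products underlying `φ ⊗ id`. -/
def maxTensorMapAux (φ : A →⋆ₙₐ[ℂ] A') :
    lp (fun i : CommPair.{w} A B => i.D) ∞ →⋆ₙₐ[ℂ] lp (fun i : CommPair.{w} A' B => i.D) ∞ where
  toFun x := ⟨fun i => x (i.restrict φ), memℓp_infty ⟨‖x‖, by
    rintro _ ⟨i, rfl⟩
    exact lp.norm_apply_le_norm ENNReal.top_ne_zero x (i.restrict φ)⟩⟩
  map_smul' _ _ := rfl
  map_zero' := rfl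
  map_add' _ _ := rfl
  map_mul' _ _ := rfl
  map_star' _ := rfl

theorem maxTensorMapAux_mem (φ : A →⋆ₙₐ[ℂ] A') {x} (hx : x ∈ maxTensorSubalgebra.{w} A B) :
    maxTensorMapAux φ x ∈ maxTensorSubalgebra.{w} A' B := by
  have hc : IsClosed (maxTensorSubalgebra.{w} A' B :
      Set (lp (fun i : CommPair.{w} A' B => i.D) ∞)) := inferInstance
  have h1 : maxTensorSubalgebra.{w} A B
      ≤ (maxTensorSubalgebra.{w} A' B).comap (maxTensorMapAux φ) := by
    refine NonUnitalStarSubalgebra.topologicalClosure_minimal _ ?_ ?_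
    · refine NonUnitalStarAlgebra.adjoin_le ?_
      rintro _ ⟨⟨a, b⟩, rfl⟩
      refine NonUnitalStarSubalgebra.le_topologicalClosure _ ?_
      exact NonUnitalStarAlgebra.subset_adjoin ℂ _ ⟨(φ a, b), rfl⟩
    · exact hc.preimage (KTheory.continuous_starHom (maxTensorMapAux φ))
  exact h1 hx

/-- The `*`-homomorphism `φ ⊗ id_B : A ⊗_max B → A' ⊗_max B`. -/
def MaxTensor.map (φ : A →⋆ₙₐ[ℂ] A') : MaxTensor.{w} A B →⋆ₙₐ[ℂ] MaxTensor.{w} A' B :=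
  NonUnitalStarAlgHom.codRestrict
    ((maxTensorMapAux φ).comp
      (NonUnitalStarSubalgebraClass.subtype (maxTensorSubalgebra.{w} A B)))
    (maxTensorSubalgebra.{w} A' B) fun x => maxTensorMapAux_mem φ x.2

end Tensor

section Cuntz

/-- The Hilbert space `ℓ²(ℕ)`. -/
abbrev ell2 : Type := lp (fun _ : ℕ => ℂ) 2

theorem orthonormal_cuntz (m : ℕ) (i : Fin m) :
    Orthonormal ℂ (fun k : ℕ => (lp.single 2 (m * k + i) (1 : ℂ) : ell2)) := by
  rw [orthonormal_iff_ite]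
  intro k l
  have hm : 0 < m := i.pos
  rw [lp.inner_single_left, lp.single_apply]
  by_cases h : k = l
  · subst h; simp
  · simp [h, hm.ne']

/-- The isometries `s_0, …, s_{m-1}` on `ℓ²(ℕ)` given by `s_i e_k = e_{mk+i}`. They satisfy
`s_i^* s_i = 1` and `∑_i s_i s_i^* = 1`. -/
def cuntzIsometry (m : ℕ) (i : Fin m) : ell2 →L[ℂ] ell2 :=
  (orthonormal_cuntz m i).orthogonalFamily.linearIsometry.toContinuousLinearMap

/-- The closed unital `*`-subalgebra generated by `s_0, …, s_{m-1}`. -/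
def cuntzSubalgebra (m : ℕ) : StarSubalgebra ℂ (ell2 →L[ℂ] ell2) :=
  (StarAlgebra.adjoin ℂ (Set.range (cuntzIsometry m))).topologicalClosure

instance (m : ℕ) : IsClosed (cuntzSubalgebra m : Set (ell2 →L[ℂ] ell2)) :=
  StarSubalgebra.isClosed_topologicalClosure _

/-- The Cuntz algebra `O_m` (`m ≥ 2`): the C*-algebra generated by the isometries
`s_0, …, s_{m-1}`. -/
def CuntzAlgebra (m : ℕ) : Type := cuntzSubalgebra m

instance (m : ℕ) : CStarAlgebra (CuntzAlgebra m) :=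
  inferInstanceAs (CStarAlgebra (cuntzSubalgebra m))

end Cuntz

end Rokhlin

namespace KTheory

universe w u

/-- The C*-algebra `A ⊗ O_{n+1}`, whose K-theory is the K-theory of `A` with coefficients
in `ℤ/n`. -/
abbrev CoeffAlg (n : ℕ) (A : Type u) [NonUnitalCStarAlgebra A] : Type (max u (w + 1)) :=
  Rokhlin.MaxTensor.{w} A (Rokhlin.CuntzAlgebra (n + 1))

/-- `K₀(A; ℤ/n) = K₀(A ⊗ O_{n+1})`. -/
abbrev K0Mod (n : ℕ) (A : Type u) [NonUnitalCStarAlgebra A] : Type (max u (w + 1)) :=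
  K0 (CoeffAlg.{w} n A)

/-- `K₁(A; ℤ/n) = K₁(A ⊗ O_{n+1})`. -/
abbrev K1Mod (n : ℕ) (A : Type u) [NonUnitalCStarAlgebra A] : Type (max u (w + 1)) :=
  K1 (CoeffAlg.{w} n A)

variable {A B : Type*} [NonUnitalCStarAlgebra A] [NonUnitalCStarAlgebra B]

/-- The homomorphism `K₀(φ; ℤ/n)`. -/
def K0Mod.map (n : ℕ) (φ : A →⋆ₙₐ[ℂ] B) : K0Mod.{w} n A →+ K0Mod.{w} n B :=
  K0.map (Rokhlin.MaxTensor.map φ)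

/-- The homomorphism `K₁(φ; ℤ/n)`. -/
def K1Mod.map (n : ℕ) (φ : A →⋆ₙₐ[ℂ] B) : K1Mod.{w} n A →* K1Mod.{w} n B :=
  K1.map (Rokhlin.MaxTensor.map φ)

end KTheory

end

universe u v

/-!
A Rokhlin map `φ : C(G) → F_∞(A)` yields the `*`-homomorphism `ψ : C(G, A) → A_∞` with
`ψ (f ⊗ a) = φ(f) a`. It is the canonical embedding on constant functions and equivariant for the
diagonal action, so it sends `α_co(A)` to `G`-invariant elements; by averaging over Haar measure
these are represented by sequences in `A^α`. Hence `ψ ∘ α_co` factors through some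
`θ : A → (A^α)_∞` which is the canonical embedding on `A^α`: the diagram `A^α → A ⇉ C(G, A)` is a
split equalizer up to sequence algebras. This property survives tensoring with a coefficient
algebra and adjoining a unit. Projections and unitaries over a sequence algebra lift to sequences
of projections and unitaries that are unique up to eventual equivalence and homotopy, so after
applying `K_i` one can argue as for an honest split equalizer.
-/

noncomputable section

namespace Rokhlin

section SeqAlgNorm

variable {E F : Type*} [NonUnitalCStarAlgebra E] [NonUnitalCStarAlgebra F]

/-- A sequence bounded by `c`, as an element of `ℓ^∞(ℕ, E)`. -/
def BddSeq.ofBound (x : ℕ → E) (c : ℝ) (h : ∀ n, ‖x n‖ ≤ c) : BddSeq E :=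
  ⟨x, memℓp_infty ⟨c, Set.forall_mem_range.2 h⟩⟩

@[simp]
theorem BddSeq.ofBound_apply (x : ℕ → E) (c : ℝ) (h : ∀ n, ‖x n‖ ≤ c) (n : ℕ) :
    BddSeq.ofBound x c h n = x n := rfl

theorem BddSeq.norm_ofBound_le (x : ℕ → E) (c : ℝ) (h : ∀ n, ‖x n‖ ≤ c) :
    ‖BddSeq.ofBound x c h‖ ≤ c :=
  lp.norm_le_of_forall_le ((norm_nonneg _).trans (h 0)) h

theorem BddSeq.norm_apply_le (x : BddSeq E) (n : ℕ) : ‖x n‖ ≤ ‖x‖ :=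
  lp.norm_apply_le_norm ENNReal.top_ne_zero x n

theorem proj_surjective : Function.Surjective (nullSeq E).proj :=
  (nullSeq E).mkₗ_surjective

theorem proj_eq_proj_iff {x y : BddSeq E} :
    (nullSeq E).proj x = (nullSeq E).proj y ↔ Tendsto (fun n => x n - y n) atTop (𝓝 0) :=
  (nullSeq E).mkₗ_eq_iff.trans tendsto_zero_iff_norm_tendsto_zero.symm

theorem norm_proj_le (x : BddSeq E) : ‖(nullSeq E).proj x‖ ≤ ‖x‖ :=
  Submodule.Quotient.norm_mk_le (nullSeq E).toSubmodule x

theorem norm_proj_le_of_eventually {x : BddSeq E} {c : ℝ} (hc : 0 ≤ c)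
    (h : ∀ᶠ n in atTop, ‖x n‖ ≤ c) : ‖(nullSeq E).proj x‖ ≤ c := by
  obtain ⟨N, hN⟩ := eventually_atTop.1 h
  let tail : BddSeq E := BddSeq.ofBound (fun n => if N ≤ n then x n else 0) c fun n => by
    split_ifs with hn
    · exact hN n hn
    · simpa using hc
  have proj_tail : (nullSeq E).proj x = (nullSeq E).proj tail := by
    rw [proj_eq_proj_iff]
    refine tendsto_const_nhds.congr' ?_
    filter_upwards [eventually_ge_atTop N] with n hn
    simp [tail, hn]
  rw [proj_tail]
  exact (norm_proj_le tail).trans (BddSeq.norm_ofBound_le _ _ _)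

theorem eventually_norm_lt_of_norm_proj_lt {x : BddSeq E} {c : ℝ}
    (h : ‖(nullSeq E).proj x‖ < c) : ∀ᶠ n in atTop, ‖x n‖ < c := by
  obtain ⟨z, hz, hzc⟩ := Submodule.Quotient.norm_mk_lt (S := (nullSeq E).toSubmodule)
    ((nullSeq E).proj x) (sub_pos.2 h)
  have norm_z_lt : ‖z‖ < c := lt_of_lt_of_eq hzc (add_sub_cancel ‖(nullSeq E).proj x‖ c)
  have tendsto_sub : Tendsto (fun n => ‖x n - z n‖) atTop (𝓝 0) :=
    tendsto_zero_iff_norm_tendsto_zero.1 (proj_eq_proj_iff.1 hz.symm)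
  filter_upwards [tendsto_sub.eventually (gt_mem_nhds (sub_pos.2 norm_z_lt))] with n hn
  calc ‖x n‖ ≤ ‖x n - z n‖ + ‖z n‖ := norm_le_norm_sub_add _ _
    _ ≤ ‖x n - z n‖ + ‖z‖ := by gcongr; exact z.norm_apply_le n
    _ < c := by linarith

instance : CompleteSpace (SeqAlg E) :=
  inferInstanceAs (CompleteSpace (BddSeq E ⧸ (nullSeq E).toSubmodule))

instance : CStarRing (SeqAlg E) where
  norm_mul_self_le x := by
    obtain ⟨x, rfl⟩ := proj_surjective x
    rw [← map_star, ← map_mul]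
    refine le_of_forall_gt fun c hc => ?_
    obtain ⟨d, hd, hdc⟩ := exists_between hc
    have d_nonneg : 0 ≤ d := (norm_nonneg _).trans hd.le
    have norm_le_sqrt : ‖(nullSeq E).proj x‖ ≤ √d := by
      refine norm_proj_le_of_eventually (Real.sqrt_nonneg _) ?_
      filter_upwards [eventually_norm_lt_of_norm_proj_lt hd] with n hn
      refine Real.le_sqrt_of_sq_le ?_
      rw [sq, ← CStarRing.norm_star_mul_self]
      exact hn.le
    calc ‖(nullSeq E).proj x‖ * ‖(nullSeq E).proj x‖ ≤ √d * √d := by gcongr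
      _ = d := Real.mul_self_sqrt d_nonneg
      _ < c := hdc

instance : NonUnitalCStarAlgebra (SeqAlg E) where

theorem norm_toSeqAlg (a : E) : ‖toSeqAlg E a‖ = ‖a‖ := by
  refine le_antisymm (NonUnitalStarAlgHom.norm_apply_le _ _) (le_of_forall_gt fun c hc => ?_)
  exact (eventually_norm_lt_of_norm_proj_lt (x := constSeq E a) hc).exists.choose_spec

theorem seqAlgMap_proj (φ : E →⋆ₙₐ[ℂ] F) (x : BddSeq E) :
    seqAlgMap φ ((nullSeq E).proj x) = (nullSeq F).proj (bddSeqMap φ x) := rfl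

theorem seqAlgMap_injective {φ : E →⋆ₙₐ[ℂ] F} (hφ : Function.Injective φ) :
    Function.Injective (seqAlgMap φ) := by
  intro x y h
  obtain ⟨x, rfl⟩ := proj_surjective x
  obtain ⟨y, rfl⟩ := proj_surjective y
  rw [seqAlgMap_proj, seqAlgMap_proj, proj_eq_proj_iff, tendsto_zero_iff_norm_tendsto_zero] at h
  rw [proj_eq_proj_iff, tendsto_zero_iff_norm_tendsto_zero]
  refine h.congr fun n => ?_
  change ‖φ (x n) - φ (y n)‖ = _
  rw [← map_sub, NonUnitalStarAlgHom.norm_map φ hφ]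

end SeqAlgNorm

section Span

variable {R T E F : Type*} [CommSemiring R] [AddCommMonoid T] [Module R T]
  [NonUnitalNonAssocSemiring E] [Module R E] [SMulCommClass R E E] [IsScalarTower R E E]
  [NonUnitalNonAssocSemiring F] [Module R F] [SMulCommClass R F F] [IsScalarTower R F F]
  {e : T →ₗ[R] E} {f : T →ₗ[R] F} {S : Set T}

theorem map_mul_of_span_eq_top (Φ : E →ₗ[R] F) (hΦ : ∀ t, Φ (e t) = f t)
    (hS : Submodule.span R S = ⊤)
    (hmul : ∀ s ∈ S, ∀ t ∈ S, ∃ r, e r = e s * e t ∧ f r = f s * f t) (s t : T) :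
    Φ (e s * e t) = f s * f t := by
  have hs : s ∈ Submodule.span R S := hS ▸ Submodule.mem_top
  have ht : t ∈ Submodule.span R S := hS ▸ Submodule.mem_top
  induction hs, ht using Submodule.span_induction₂ with
  | mem_mem s t hs ht =>
    obtain ⟨r, her, hfr⟩ := hmul s hs t ht
    rw [← her, hΦ, hfr]
  | zero_left => simp
  | zero_right => simp
  | add_left s s' t _ _ _ h h' => simp only [map_add, add_mul, h, h']
  | add_right s s' t _ _ _ h h' => simp only [map_add, mul_add, h, h']
  | smul_left c s t _ _ h => simp only [map_smul, smul_mul_assoc, h]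
  | smul_right c s t _ _ h => simp only [map_smul, mul_smul_comm, h]

end Span

theorem map_star_of_span_eq_top {R T E F : Type*} [CommSemiring R] [StarRing R]
    [AddCommMonoid T] [Module R T] [AddCommMonoid E] [StarAddMonoid E] [Module R E] [StarModule R E]
    [AddCommMonoid F] [StarAddMonoid F] [Module R F] [StarModule R F] {e : T →ₗ[R] E}
    {f : T →ₗ[R] F} {S : Set T} (Φ : E →ₗ[R] F) (hΦ : ∀ t, Φ (e t) = f t)
    (hS : Submodule.span R S = ⊤)
    (hstar : ∀ s ∈ S, ∃ r, e r = star (e s) ∧ f r = star (f s)) (s : T) :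
    Φ (star (e s)) = star (f s) := by
  have hs : s ∈ Submodule.span R S := hS ▸ Submodule.mem_top
  induction hs using Submodule.span_induction with
  | mem s hs =>
    obtain ⟨r, her, hfr⟩ := hstar s hs
    rw [← her, hΦ, hfr]
  | zero => simp
  | add s t _ _ h h' => simp only [map_add, star_add, h, h']
  | smul c s _ h => simp only [map_smul, star_smul, h]

theorem exists_starHom_extension {T E F : Type*} [AddCommGroup T] [Module ℂ T]
    [NonUnitalCStarAlgebra E] [NonUnitalCStarAlgebra F] {e : T →ₗ[ℂ] E} {f : T →ₗ[ℂ] F} {S : Set T}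
    (hS : Submodule.span ℂ S = ⊤) (hd : DenseRange e) (hb : ∃ C, ∀ t, ‖f t‖ ≤ C * ‖e t‖)
    (hmul : ∀ s ∈ S, ∀ t ∈ S, ∃ r, e r = e s * e t ∧ f r = f s * f t)
    (hstar : ∀ s ∈ S, ∃ r, e r = star (e s) ∧ f r = star (f s)) :
    ∃ Φ : E →⋆ₙₐ[ℂ] F, ∀ t, Φ (e t) = f t := by
  let Φ : E →L[ℂ] F := f.extendOfNorm e
  have hΦ (t : T) : Φ (e t) = f t := LinearMap.extendOfNorm_eq hd hb t
  have hΦ_mul (x y : E) : Φ (x * y) = Φ x * Φ y := by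
    refine hd.induction_on₂ (p := fun x y => Φ (x * y) = Φ x * Φ y) ?_ (fun s t => ?_) x y
    · exact isClosed_eq (by fun_prop) (by fun_prop)
    · rw [hΦ, hΦ]
      exact map_mul_of_span_eq_top Φ.toLinearMap hΦ hS hmul s t
  have hΦ_star (x : E) : Φ (star x) = star (Φ x) := by
    refine hd.induction_on (p := fun x => Φ (star x) = star (Φ x)) x ?_ fun s => ?_
    · exact isClosed_eq (by fun_prop) (by fun_prop)
    · rw [hΦ]
      exact map_star_of_span_eq_top Φ.toLinearMap hΦ hS hstar s
  exact ⟨{ toFun := Φ, map_smul' := map_smul Φ, map_zero' := map_zero Φ, map_add' := map_add Φ,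
           map_mul' := hΦ_mul, map_star' := hΦ_star }, hΦ⟩

theorem exists_lift_of_mem_range {R A B C : Type*} [Monoid R]
    [NonUnitalNonAssocSemiring A] [DistribMulAction R A] [Star A]
    [NonUnitalNonAssocSemiring B] [DistribMulAction R B] [Star B]
    [NonUnitalNonAssocSemiring C] [DistribMulAction R C] [Star C] {ι : B →⋆ₙₐ[R] C}
    (hι : Function.Injective ι) (φ : A →⋆ₙₐ[R] C) (h : ∀ a, ∃ b, ι b = φ a) :
    ∃ θ : A →⋆ₙₐ[R] B, ι.comp θ = φ := by
  choose θ hθ using h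
  refine ⟨{ toFun := θ, map_smul' := fun c a => hι ?_, map_zero' := hι ?_,
            map_add' := fun a b => hι ?_, map_mul' := fun a b => hι ?_,
            map_star' := fun a => hι ?_ }, NonUnitalStarAlgHom.ext hθ⟩ <;>
    simp only [hθ, map_smul, map_zero, map_add, map_mul, map_star, MonoidHom.id_apply]

section Product

variable {κ E : Type*} {F : κ → Type*} [NonUnitalCStarAlgebra E]
  [∀ k, NonUnitalCStarAlgebra (F k)]

/-- The `*`-homomorphism into the `ℓ^∞`-product of the `F k` with prescribed components. -/
def prodHom (φ : ∀ k, E →⋆ₙₐ[ℂ] F k) : E →⋆ₙₐ[ℂ] lp F ∞ where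
  toFun x := ⟨fun k => φ k x, memℓp_infty ⟨‖x‖, Set.forall_mem_range.2 fun k =>
    NonUnitalStarAlgHom.norm_apply_le (φ k) x⟩⟩
  map_smul' c x := lp.ext (funext fun k => map_smul (φ k) c x)
  map_zero' := lp.ext (funext fun k => map_zero (φ k))
  map_add' x y := lp.ext (funext fun k => map_add (φ k) x y)
  map_mul' x y := lp.ext (funext fun k => map_mul (φ k) x y)
  map_star' x := lp.ext (funext fun k => map_star (φ k) x)

variable (F) in
/-- The evaluation of the `ℓ^∞`-product of the `F k` at one of its factors. -/
def prodEval (k : κ) : lp F ∞ →⋆ₙₐ[ℂ] F k where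
  toFun x := x k
  map_smul' _ _ := rfl
  map_zero' := rfl
  map_add' _ _ := rfl
  map_mul' _ _ := rfl
  map_star' _ := rfl

end Product

section MaxTensor

universe w

variable {A : Type u} {B : Type v} [NonUnitalCStarAlgebra A] [NonUnitalCStarAlgebra B]

/-- The elementary tensor `a ⊗ b` in `A ⊗_max B`. -/
def MaxTensor.tmul (a : A) (b : B) : MaxTensor.{w} A B :=
  ⟨elemTensor a b, NonUnitalStarSubalgebra.le_topologicalClosure _
    (NonUnitalStarAlgebra.subset_adjoin ℂ _ ⟨(a, b), rfl⟩)⟩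

/-- The `*`-homomorphism `A ⊗_max B → D` induced by a commuting pair with values in `D`. -/
def MaxTensor.eval (i : CommPair.{w} A B) : MaxTensor.{w} A B →⋆ₙₐ[ℂ] i.D :=
  (prodEval (fun i : CommPair.{w} A B => i.D) i).comp
    (NonUnitalStarSubalgebraClass.subtype (maxTensorSubalgebra.{w} A B))

theorem MaxTensor.norm_le {x : MaxTensor.{w} A B} {c : ℝ} (hc : 0 ≤ c)
    (h : ∀ i, ‖MaxTensor.eval i x‖ ≤ c) : ‖x‖ ≤ c :=
  lp.norm_le_of_forall_le hc h

theorem MaxTensor.norm_tmul_le (a : A) (b : B) :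
    ‖(MaxTensor.tmul a b : MaxTensor.{w} A B)‖ ≤ ‖a‖ * ‖b‖ := by
  refine MaxTensor.norm_le (by positivity) fun i => ?_
  calc ‖i.left a * i.right b‖ ≤ ‖i.left a‖ * ‖i.right b‖ := norm_mul_le _ _
    _ ≤ ‖a‖ * ‖b‖ := by
      gcongr
      · exact NonUnitalStarAlgHom.norm_apply_le i.left a
      · exact NonUnitalStarAlgHom.norm_apply_le i.right b

theorem MaxTensor.eq_top_of_tmul_mem {S : NonUnitalStarSubalgebra ℂ (MaxTensor.{w} A B)}
    (hS : IsClosed (S : Set (MaxTensor.{w} A B))) (h : ∀ a b, MaxTensor.tmul a b ∈ S) :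
    S = ⊤ := by
  let incl : MaxTensor.{w} A B →⋆ₙₐ[ℂ] lp (fun i : CommPair.{w} A B => i.D) ∞ :=
    NonUnitalStarSubalgebraClass.subtype (maxTensorSubalgebra.{w} A B)
  have isClosed_map : IsClosed (S.map incl : Set (lp (fun i : CommPair.{w} A B => i.D) ∞)) := by
    have : IsClosed (maxTensorSubalgebra.{w} A B :
        Set (lp (fun i : CommPair.{w} A B => i.D) ∞)) := inferInstance
    exact this.isClosedEmbedding_subtypeVal.isClosedMap _ hS
  have le_map : maxTensorSubalgebra.{w} A B ≤ S.map incl := by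
    refine NonUnitalStarSubalgebra.topologicalClosure_minimal _ ?_ isClosed_map
    refine NonUnitalStarAlgebra.adjoin_le ?_
    rintro _ ⟨⟨a, b⟩, rfl⟩
    exact ⟨MaxTensor.tmul a b, h a b, rfl⟩
  refine NonUnitalStarAlgebra.eq_top_iff.2 fun x => ?_
  obtain ⟨y, hy, hyx⟩ := le_map x.2
  rwa [← Subtype.ext hyx]

theorem MaxTensor.hom_ext {D : Type*} [NonUnitalCStarAlgebra D]
    {φ ψ : MaxTensor.{w} A B →⋆ₙₐ[ℂ] D}
    (h : ∀ a b, φ (MaxTensor.tmul a b) = ψ (MaxTensor.tmul a b)) : φ = ψ := by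
  have equalizer_eq_top : NonUnitalStarAlgHom.equalizer φ ψ = ⊤ :=
    MaxTensor.eq_top_of_tmul_mem
      (isClosed_eq (KTheory.continuous_starHom φ) (KTheory.continuous_starHom ψ)) h
  exact NonUnitalStarAlgHom.ext (NonUnitalStarAlgebra.eq_top_iff.1 equalizer_eq_top)

variable {A' : Type*} [NonUnitalCStarAlgebra A']

theorem MaxTensor.map_comp {A'' : Type*} [NonUnitalCStarAlgebra A''] (ψ : A' →⋆ₙₐ[ℂ] A'')
    (φ : A →⋆ₙₐ[ℂ] A') :
    (MaxTensor.map (ψ.comp φ) : MaxTensor.{w} A B →⋆ₙₐ[ℂ] _)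
      = (MaxTensor.map ψ).comp (MaxTensor.map φ) :=
  MaxTensor.hom_ext fun _ _ => rfl

/-- The product of a sequence of commuting pairs. -/
def CommPair.prod (i : ℕ → CommPair.{w} A B) : CommPair.{w} A B where
  D := lp (fun n => (i n).D) ∞
  left := prodHom fun n => (i n).left
  right := prodHom fun n => (i n).right
  comm a b := lp.ext (funext fun n => (i n).comm a b)

theorem CommPair.norm_eval_le_norm_eval_prod (i : ℕ → CommPair.{w} A B) (n : ℕ)
    (x : MaxTensor.{w} A B) :
    ‖MaxTensor.eval (i n) x‖ ≤ ‖MaxTensor.eval (CommPair.prod i) x‖ := by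
  have eval_eq : MaxTensor.eval (i n)
      = (prodEval (fun n => (i n).D) n).comp (MaxTensor.eval (CommPair.prod i)) :=
    MaxTensor.hom_ext fun _ _ => rfl
  rw [eval_eq]
  exact NonUnitalStarAlgHom.norm_apply_le (prodEval (fun n => (i n).D) n) _

instance : Nonempty (CommPair.{w} A B) :=
  ⟨{ D := lp (fun _ : PUnit.{w + 1} => ℂ) ∞
     left := 0
     right := 0
     comm := fun _ _ => rfl }⟩

theorem MaxTensor.exists_norm_lt_eval (x : MaxTensor.{w} A B) {ε : ℝ} (hε : 0 < ε) :
    ∃ i, ‖x‖ < ‖MaxTensor.eval i x‖ + ε := by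
  by_contra! h
  have norm_le : ‖x‖ ≤ max 0 (‖x‖ - ε) :=
    MaxTensor.norm_le (le_max_left _ _) fun i => le_max_of_le_right (by linarith [h i])
  obtain ⟨i⟩ := (inferInstance : Nonempty (CommPair.{w} A B))
  rcases le_max_iff.1 norm_le with h0 | h0
  · linarith [h i, norm_nonneg (MaxTensor.eval i x)]
  · linarith

end MaxTensor

section SeqTensor

universe w

variable {A : Type u} {B : Type v} {A' : Type*} [NonUnitalCStarAlgebra A]
  [NonUnitalCStarAlgebra B] [NonUnitalCStarAlgebra A']

variable (A B) in
/-- The *-homomorphism from `(A ⊗_max B)_∞` to the product of all `D_∞`, where `D` runs through the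
codomains of the commuting pairs. -/
def seqEval : SeqAlg (MaxTensor.{w} A B) →⋆ₙₐ[ℂ] lp (fun i : CommPair.{w} A B => SeqAlg i.D) ∞ :=
  prodHom fun i => seqAlgMap (MaxTensor.eval i)

variable (A B) in
theorem seqEval_injective :
    Function.Injective (seqEval A B : SeqAlg (MaxTensor.{w} A B) →⋆ₙₐ[ℂ] _) := by
  rw [injective_iff_map_eq_zero]
  intro x hx
  obtain ⟨x, rfl⟩ := proj_surjective x
  -- A single commuting pair suffices: the product of pairs nearly norming the terms `x n`.
  choose i hi using fun n : ℕ =>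
    MaxTensor.exists_norm_lt_eval (x n) (Nat.one_div_pos_of_nat (α := ℝ) (n := n))
  have tendsto_eval : Tendsto (fun n => ‖MaxTensor.eval (CommPair.prod i) (x n)‖) atTop (𝓝 0) := by
    have h : (nullSeq _).proj (bddSeqMap (MaxTensor.eval (CommPair.prod i)) x)
        = (nullSeq _).proj 0 :=
      (congrArg (prodEval (fun i : CommPair.{w} A B => SeqAlg i.D) (CommPair.prod i)) hx).trans
        (map_zero _).symm
    refine (tendsto_zero_iff_norm_tendsto_zero.1 (proj_eq_proj_iff.1 h)).congr fun n => ?_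
    exact congrArg norm (sub_zero _)
  have norm_le (n : ℕ) : ‖x n‖ ≤ ‖MaxTensor.eval (CommPair.prod i) (x n)‖ + 1 / ((n : ℝ) + 1) :=
    (hi n).le.trans (by gcongr; exact CommPair.norm_eval_le_norm_eval_prod i n (x n))
  rw [← map_zero (nullSeq _).proj, proj_eq_proj_iff]
  refine squeeze_zero_norm (fun n => ?_)
    ((tendsto_eval.add tendsto_one_div_add_atTop_nhds_zero_nat).trans_eq (by rw [add_zero]))
  exact (congrArg norm (sub_zero (x n))).trans_le (norm_le n)

/-- The pair `A → A'_∞ → D_∞`, `B → D → D_∞` obtained from a commuting pair `A' → D`, `B → D` and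
a `*`-homomorphism `Φ : A → A'_∞`. -/
def CommPair.seqRestrict (Φ : A →⋆ₙₐ[ℂ] SeqAlg A') (i : CommPair.{w} A' B) :
    CommPair.{w} A B where
  D := SeqAlg i.D
  left := (seqAlgMap i.left).comp Φ
  right := (toSeqAlg i.D).comp i.right
  comm a b := by
    obtain ⟨x, hx⟩ := proj_surjective (Φ a)
    change seqAlgMap i.left (Φ a) * _ = _ * seqAlgMap i.left (Φ a)
    rw [← hx]
    exact congrArg (nullSeq _).proj (lp.ext (funext fun n => i.comm (x n) b))

/-- The map which `Φ ⊗ id : A ⊗_max B → (A' ⊗_max B)_∞` is to have as its composition with the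
embedding `seqEval`. -/
def seqTensorEval (Φ : A →⋆ₙₐ[ℂ] SeqAlg A') :
    MaxTensor.{w} A B →⋆ₙₐ[ℂ] lp (fun i : CommPair.{w} A' B => SeqAlg i.D) ∞ :=
  prodHom fun i => MaxTensor.eval (i.seqRestrict Φ)

theorem exists_seqEval_eq_seqTensorEval_tmul (Φ : A →⋆ₙₐ[ℂ] SeqAlg A') (a : A) (b : B) :
    ∃ y, seqEval.{_, _, w} A' B y = seqTensorEval Φ (MaxTensor.tmul a b) := by
  obtain ⟨x, hx⟩ := proj_surjective (Φ a)
  let tensor : BddSeq (MaxTensor.{w} A' B) :=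
    BddSeq.ofBound (fun n => MaxTensor.tmul (x n) b) (‖x‖ * ‖b‖) fun n =>
      (MaxTensor.norm_tmul_le _ _).trans (by gcongr; exact x.norm_apply_le n)
  refine ⟨(nullSeq _).proj tensor, lp.ext (funext fun i => ?_)⟩
  calc seqAlgMap (MaxTensor.eval i) ((nullSeq _).proj tensor)
      = seqAlgMap i.left ((nullSeq _).proj x) * toSeqAlg i.D (i.right b) := rfl
    _ = seqAlgMap i.left (Φ a) * toSeqAlg i.D (i.right b) := by rw [hx]

theorem exists_seqTensor (Φ : A →⋆ₙₐ[ℂ] SeqAlg A') :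
    ∃ Ψ : MaxTensor.{w} A B →⋆ₙₐ[ℂ] SeqAlg (MaxTensor.{w} A' B),
      (seqEval.{_, _, w} A' B).comp Ψ = seqTensorEval Φ := by
  refine exists_lift_of_mem_range (seqEval_injective A' B) (seqTensorEval Φ) ?_
  let S : NonUnitalStarSubalgebra ℂ (MaxTensor.{w} A B) :=
    (NonUnitalStarAlgHom.range (seqEval.{_, _, w} A' B)).comap (seqTensorEval Φ)
  have isometry_seqEval : Isometry (seqEval.{_, _, w} A' B) :=
    NonUnitalStarAlgHom.isometry _ (seqEval_injective A' B)
  have isClosed_range : IsClosed (Set.range (seqEval.{_, _, w} A' B)) :=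
    isometry_seqEval.isClosedEmbedding.isClosed_range
  have isClosed_S : IsClosed (S : Set (MaxTensor.{w} A B)) :=
    isClosed_range.preimage (KTheory.continuous_starHom (seqTensorEval Φ))
  have S_eq_top : S = ⊤ :=
    MaxTensor.eq_top_of_tmul_mem isClosed_S (exists_seqEval_eq_seqTensorEval_tmul Φ)
  exact NonUnitalStarAlgebra.eq_top_iff.1 S_eq_top

/-- The `*`-homomorphism `Φ ⊗ id : A ⊗_max B → (A' ⊗_max B)_∞` induced by `Φ : A → A'_∞`. -/
def seqTensor (Φ : A →⋆ₙₐ[ℂ] SeqAlg A') :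
    MaxTensor.{w} A B →⋆ₙₐ[ℂ] SeqAlg (MaxTensor.{w} A' B) :=
  (exists_seqTensor Φ).choose

theorem seqAlgMap_eval_seqTensor (Φ : A →⋆ₙₐ[ℂ] SeqAlg A') (i : CommPair.{w} A' B)
    (x : MaxTensor.{w} A B) :
    seqAlgMap (MaxTensor.eval i) (seqTensor Φ x) = MaxTensor.eval (i.seqRestrict Φ) x :=
  congrArg (prodEval (fun i : CommPair.{w} A' B => SeqAlg i.D) i)
    (DFunLike.congr_fun (exists_seqTensor Φ).choose_spec x)

theorem seqHom_ext {Φ Ψ : MaxTensor.{w} A B →⋆ₙₐ[ℂ] SeqAlg (MaxTensor.{w} A' B)}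
    (h : ∀ a b i, seqAlgMap (MaxTensor.eval i) (Φ (MaxTensor.tmul a b))
      = seqAlgMap (MaxTensor.eval i) (Ψ (MaxTensor.tmul a b))) : Φ = Ψ :=
  MaxTensor.hom_ext fun a b => seqEval_injective.{_, _, w} A' B (lp.ext (funext fun i => h a b i))

theorem seqTensor_comp_map {j : A' →⋆ₙₐ[ℂ] A} {Φ : A →⋆ₙₐ[ℂ] SeqAlg A'}
    (h : Φ.comp j = toSeqAlg A') :
    (seqTensor Φ).comp (MaxTensor.map j) = toSeqAlg (MaxTensor.{w} A' B) := by
  refine seqHom_ext fun a b i => ?_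
  have hΦ : Φ (j a) = toSeqAlg A' a := DFunLike.congr_fun h a
  calc seqAlgMap (MaxTensor.eval i) (seqTensor Φ (MaxTensor.tmul (j a) b))
      = seqAlgMap i.left (Φ (j a)) * toSeqAlg i.D (i.right b) := seqAlgMap_eval_seqTensor Φ i _
    _ = toSeqAlg i.D (i.left a * i.right b) := by rw [hΦ, seqAlgMap_toSeqAlg, map_mul]
    _ = _ := (seqAlgMap_toSeqAlg (MaxTensor.eval i) (MaxTensor.tmul a b)).symm

theorem seqAlgMap_comp_apply {E F D : Type*} [NonUnitalCStarAlgebra E] [NonUnitalCStarAlgebra F]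
    [NonUnitalCStarAlgebra D] (ψ : F →⋆ₙₐ[ℂ] D) (φ : E →⋆ₙₐ[ℂ] F) (x : SeqAlg E) :
    seqAlgMap (ψ.comp φ) x = seqAlgMap ψ (seqAlgMap φ x) := by
  obtain ⟨x, rfl⟩ := proj_surjective x
  rfl

theorem seqTensor_comp_map_eq_seqAlgMap_map {C : Type*} [NonUnitalCStarAlgebra C]
    {j : A' →⋆ₙₐ[ℂ] A} {c : A →⋆ₙₐ[ℂ] C} {θ : A →⋆ₙₐ[ℂ] SeqAlg A'} {ψ : C →⋆ₙₐ[ℂ] SeqAlg A}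
    (h : ψ.comp c = (seqAlgMap j).comp θ) :
    (seqTensor ψ).comp (MaxTensor.map c)
      = (seqAlgMap (MaxTensor.map j)).comp
        (seqTensor θ : MaxTensor.{w} A B →⋆ₙₐ[ℂ] SeqAlg (MaxTensor.{w} A' B)) := by
  refine seqHom_ext fun a b i => ?_
  have hψ : ψ (c a) = seqAlgMap j (θ a) := DFunLike.congr_fun h a
  calc seqAlgMap (MaxTensor.eval i) (seqTensor ψ (MaxTensor.tmul (c a) b))
      = seqAlgMap i.left (ψ (c a)) * toSeqAlg i.D (i.right b) := seqAlgMap_eval_seqTensor ψ i _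
    _ = seqAlgMap (i.left.comp j) (θ a) * toSeqAlg i.D (i.right b) := by
      rw [hψ, seqAlgMap_comp_apply]
    _ = seqAlgMap ((MaxTensor.eval i).comp (MaxTensor.map j)) (seqTensor θ (MaxTensor.tmul a b)) :=
      (seqAlgMap_eval_seqTensor θ (i.restrict j) (MaxTensor.tmul a b)).symm
    _ = _ := seqAlgMap_comp_apply (MaxTensor.eval i) (MaxTensor.map j) _

end SeqTensor

section ApproximateUnit

/-- A C*-algebra is σ-unital if it has an approximate unit that is a sequence, which may then be
taken contractive. -/
def IsSigmaUnital (A : Type*) [NonUnitalCStarAlgebra A] : Prop :=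
  ∃ e : ℕ → A, (∀ n, ‖e n‖ ≤ 1) ∧ (map e atTop).IsApproximateUnit

variable {A : Type*} [NonUnitalCStarAlgebra A]

theorem tendsto_mul_of_tendsto_mul_denseSeq [TopologicalSpace.SeparableSpace A] {e : ℕ → A}
    (he : ∀ n, ‖e n‖ ≤ 1)
    (h : ∀ k, Tendsto (fun n => e n * TopologicalSpace.denseSeq A k) atTop
      (𝓝 (TopologicalSpace.denseSeq A k))) (a : A) :
    Tendsto (fun n => e n * a) atTop (𝓝 a) := by
  have lipschitz (n : ℕ) : LipschitzWith 1 (fun a => e n * a) :=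
    LipschitzWith.of_dist_le_mul fun a b => by
      rw [dist_eq_norm, dist_eq_norm, ← mul_sub, NNReal.coe_one]
      exact (norm_mul_le _ _).trans (mul_le_mul_of_nonneg_right (he n) (norm_nonneg _))
  have isClosed_limits : IsClosed {a | Tendsto (fun n => e n * a) atTop (𝓝 a)} :=
    (LipschitzWith.uniformEquicontinuous _ 1
      lipschitz).equicontinuous.isClosed_setOfPred_tendsto continuous_id
  exact isClosed_limits.closure_subset_iff.2 (Set.range_subset_iff.2 h)
    (TopologicalSpace.denseRange_denseSeq A a)

theorem isSigmaUnital_of_separableSpace [TopologicalSpace.SeparableSpace A] :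
    IsSigmaUnital A := by
  let _ := CStarAlgebra.spectralOrder A
  let _ := CStarAlgebra.spectralOrderedRing A
  let d := TopologicalSpace.denseSeq A
  have hl := CStarAlgebra.increasingApproximateUnit A
  have exists_near (n : ℕ) : ∃ x : A, ‖x‖ ≤ 1 ∧ IsSelfAdjoint x ∧
      ∀ k ∈ Finset.range (n + 1), dist (x * d k) (d k) < 1 / ((n : ℝ) + 1) := by
    refine (hl.eventually_norm.and (hl.eventually_isSelfAdjoint.and
      ((Finset.eventually_all _).2 fun k _ => ?_))).exists
    exact (hl.tendsto_mul_right (d k)).eventually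
      (Metric.ball_mem_nhds _ Nat.one_div_pos_of_nat)
  choose e norm_e_le star_e he using exists_near
  have tendsto_mul (a : A) : Tendsto (fun n => e n * a) atTop (𝓝 a) := by
    refine tendsto_mul_of_tendsto_mul_denseSeq norm_e_le (fun k => ?_) a
    rw [tendsto_iff_dist_tendsto_zero]
    refine squeeze_zero' (.of_forall fun n => dist_nonneg) ?_
      tendsto_one_div_add_atTop_nhds_zero_nat
    filter_upwards [eventually_ge_atTop k] with n hn
    exact (he n k (Finset.mem_range.2 (Nat.lt_succ_of_le hn))).le
  have tendsto_mul' (a : A) : Tendsto (fun n => a * e n) atTop (𝓝 a) := by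
    simpa only [star_mul, star_star, (star_e _).star_eq] using (tendsto_mul (star a)).star
  exact ⟨e, norm_e_le, ⟨fun a => tendsto_map'_iff.2 (tendsto_mul' a),
    fun a => tendsto_map'_iff.2 (tendsto_mul a)⟩⟩

theorem tendsto_mul_mul_star {e : ℕ → A} (he : ∀ n, ‖e n‖ ≤ 1)
    (hu : (map e atTop).IsApproximateUnit) (a : A) :
    Tendsto (fun n => e n * a * star (e n)) atTop (𝓝 a) := by
  have tendsto_mul (a : A) : Tendsto (fun n => e n * a) atTop (𝓝 a) :=
    tendsto_map'_iff.1 (hu.tendsto_mul_right a)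
  have tendsto_mul_star : Tendsto (fun n => a * star (e n)) atTop (𝓝 a) := by
    simpa only [star_mul, star_star] using (tendsto_mul (star a)).star
  have tendsto_sub : Tendsto (fun n => (e n * a - a) * star (e n)) atTop (𝓝 0) := by
    refine squeeze_zero_norm (fun n => ?_)
      (tendsto_zero_iff_norm_tendsto_zero.1 (tendsto_sub_nhds_zero_iff.2 (tendsto_mul a)))
    refine (norm_mul_le _ _).trans (mul_le_of_le_one_right (norm_nonneg _) ?_)
    rw [norm_star]
    exact he n
  refine (zero_add a ▸ tendsto_sub.add tendsto_mul_star).congr fun n => ?_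
  rw [sub_mul, sub_add_cancel]

end ApproximateUnit

section ConjugateSum

theorem norm_sum_mul_mul_star_le {E ι : Type*} [NonUnitalCStarAlgebra E] [Fintype ι]
    (z a : ι → E) {M : ℝ} (hM : 0 ≤ M) (ha : ∀ i, ‖a i‖ ≤ M) :
    ‖∑ i, z i * a i * star (z i)‖ ≤ M * ‖∑ i, z i * star (z i)‖ := by
  let _ := CStarAlgebra.spectralOrder E
  let _ := CStarAlgebra.spectralOrderedRing E
  -- Cauchy–Schwarz in the Hilbert module `E^ι`, for `∑ zᵢ aᵢ zᵢ* = ⟨v, w⟩`.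
  let v : WithCStarModule E (ι → E) := (WithCStarModule.equiv E (ι → E)).symm z
  let w : WithCStarModule E (ι → E) := (WithCStarModule.equiv E (ι → E)).symm fun i => z i * a i
  have inner_eq : inner E v w = ∑ i, z i * a i * star (z i) := rfl
  have norm_sq_v : ‖v‖ ^ 2 = ‖∑ i, z i * star (z i)‖ := CStarModule.norm_sq_eq E (x := v)
  have norm_sq_w : ‖w‖ ^ 2 = ‖∑ i, z i * a i * star (z i * a i)‖ :=
    CStarModule.norm_sq_eq E (x := w)
  have conj_le (i : ι) : z i * a i * star (z i * a i) ≤ M ^ 2 • (z i * star (z i)) :=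
    calc z i * a i * star (z i * a i) = z i * (a i * star (a i)) * star (z i) := by
          simp only [star_mul, mul_assoc]
      _ ≤ ‖a i * star (a i)‖ • (z i * star (z i)) :=
          CStarAlgebra.star_right_conjugate_le_norm_smul (IsSelfAdjoint.mul_star_self (a i))
      _ ≤ M ^ 2 • (z i * star (z i)) := by
          refine smul_le_smul_of_nonneg_right ?_ (mul_star_self_nonneg _)
          rw [CStarRing.norm_self_mul_star, ← sq]
          exact pow_le_pow_left₀ (norm_nonneg _) (ha i) 2
  have sum_conj_le : ∑ i, z i * a i * star (z i * a i) ≤ M ^ 2 • ∑ i, z i * star (z i) := by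
    rw [Finset.smul_sum]
    exact Finset.sum_le_sum fun i _ => conj_le i
  have norm_w_le : ‖w‖ ≤ M * ‖v‖ := by
    refine abs_le_of_sq_le_sq' ?_ (by positivity) |>.2
    calc ‖w‖ ^ 2 = ‖∑ i, z i * a i * star (z i * a i)‖ := norm_sq_w
      _ ≤ ‖M ^ 2 • ∑ i, z i * star (z i)‖ := CStarAlgebra.norm_le_norm_of_nonneg_of_le
          (Finset.sum_nonneg fun i _ => mul_star_self_nonneg _) sum_conj_le
      _ = (M * ‖v‖) ^ 2 := by
          rw [norm_smul, Real.norm_of_nonneg (by positivity), mul_pow, norm_sq_v]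
  rw [← inner_eq, ← norm_sq_v]
  calc ‖inner E v w‖ ≤ ‖v‖ * ‖w‖ := CStarModule.norm_inner_le _
    _ ≤ ‖v‖ * (M * ‖v‖) := by gcongr
    _ = M * ‖v‖ ^ 2 := by ring

end ConjugateSum

section CentralAction

variable {A : Type*} [NonUnitalCStarAlgebra A]

/-- The product `F_∞(A) × A → A_∞`. -/
def centralAct : CentralSeqAlg A →ₗ[ℂ] A →ₗ[ℂ] SeqAlg A :=
  (annIdeal A).toSubmodule.liftQ
    ((LinearMap.mul ℂ (SeqAlg A)).compl₁₂
      (NonUnitalStarSubalgebraClass.subtype (relCommutant A) : relCommutant A →ₗ[ℂ] SeqAlg A)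
      (toSeqAlg A : A →ₗ[ℂ] SeqAlg A))
    fun _ hx => LinearMap.ext fun a => (hx a).1

theorem annIdeal_proj_surjective : Function.Surjective (annIdeal A).proj :=
  (annIdeal A).mkₗ_surjective

theorem centralAct_proj (x : relCommutant A) (a : A) :
    centralAct ((annIdeal A).proj x) a = x.1 * toSeqAlg A a := rfl

theorem continuous_centralAct (y : CentralSeqAlg A) : Continuous (centralAct y) := by
  obtain ⟨x, rfl⟩ := annIdeal_proj_surjective y
  exact continuous_const.mul (KTheory.continuous_starHom (toSeqAlg A))

theorem centralAct_mul_toSeqAlg (y : CentralSeqAlg A) (a b : A) :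
    centralAct y a * toSeqAlg A b = centralAct y (a * b) := by
  obtain ⟨x, rfl⟩ := annIdeal_proj_surjective y
  rw [centralAct_proj, centralAct_proj, map_mul, mul_assoc]

theorem centralAct_mul (y y' : CentralSeqAlg A) (a a' : A) :
    centralAct (y * y') (a * a') = centralAct y a * centralAct y' a' := by
  obtain ⟨x, rfl⟩ := annIdeal_proj_surjective y
  obtain ⟨x', rfl⟩ := annIdeal_proj_surjective y'
  have comm : x'.1 * toSeqAlg A a = toSeqAlg A a * x'.1 := x'.2 a
  calc x.1 * x'.1 * toSeqAlg A (a * a') = x.1 * (x'.1 * toSeqAlg A a) * toSeqAlg A a' := by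
        simp only [map_mul, mul_assoc]
    _ = x.1 * toSeqAlg A a * (x'.1 * toSeqAlg A a') := by simp only [comm, mul_assoc]

theorem centralAct_star (y : CentralSeqAlg A) (a : A) :
    centralAct (star y) (star a) = star (centralAct y a) := by
  obtain ⟨x, rfl⟩ := annIdeal_proj_surjective y
  rw [← map_star, centralAct_proj, centralAct_proj, star_mul, ← map_star]
  exact (star x).2 (star a)

theorem centralAct_mul_star_conj (y : CentralSeqAlg A) (c a : A) :
    centralAct (y * star y) (c * a * star c)
      = centralAct y c * toSeqAlg A a * star (centralAct y c) := by
  rw [centralAct_mul, centralAct_star, centralAct_mul_toSeqAlg]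

theorem centralAct_mul_star (y : CentralSeqAlg A) (c : A) :
    centralAct (y * star y) (c * star c) = centralAct y c * star (centralAct y c) := by
  rw [centralAct_mul, centralAct_star]

theorem seqAlgMap_centralAct (θ : A ≃⋆ₐ[ℂ] A) (y : CentralSeqAlg A) (a : A) :
    seqAlgMap (θ : A →⋆ₙₐ[ℂ] A) (centralAct y a) = centralAct (centralSeqMap θ y) (θ a) := by
  obtain ⟨x, rfl⟩ := annIdeal_proj_surjective y
  exact map_mul (seqAlgMap (θ : A →⋆ₙₐ[ℂ] A)) x.1 (toSeqAlg A a)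

theorem centralAct_unit (hA : IsSigmaUnital A) {u : CentralSeqAlg A} (hu : ∀ y, u * y = y)
    (a : A) : centralAct u a = toSeqAlg A a := by
  obtain ⟨e, he, h_unit⟩ := hA
  let E : SeqAlg A := (nullSeq A).proj (BddSeq.ofBound e 1 he)
  have E_mul (a : A) : E * toSeqAlg A a = toSeqAlg A a :=
    proj_eq_proj_iff.2 (tendsto_sub_nhds_zero_iff.2
      (tendsto_map'_iff.1 (h_unit.tendsto_mul_right a)))
  have mul_E (a : A) : toSeqAlg A a * E = toSeqAlg A a :=
    proj_eq_proj_iff.2 (tendsto_sub_nhds_zero_iff.2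
      (tendsto_map'_iff.1 (h_unit.tendsto_mul_left a)))
  let E' : relCommutant A := ⟨E, fun a => (E_mul a).trans (mul_E a).symm⟩
  obtain ⟨x, rfl⟩ := annIdeal_proj_surjective u
  calc x.1 * toSeqAlg A a = (x * E').1 * toSeqAlg A a := by
        change _ = x.1 * E * _
        rw [mul_assoc, E_mul]
    _ = E * toSeqAlg A a := congrArg (centralAct · a) (hu ((annIdeal A).proj E'))
    _ = toSeqAlg A a := E_mul a

theorem norm_sum_centralAct_mul_star_le (hA : IsSigmaUnital A) {ι : Type*} [Fintype ι]
    {y : ι → CentralSeqAlg A} {r : ℂ}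
    (hy : ∀ b, ∑ k, centralAct (y k * star (y k)) b = r • toSeqAlg A b) {a : ι → A} {M : ℝ}
    (hM : 0 ≤ M) (ha : ∀ k, ‖a k‖ ≤ M) :
    ‖∑ k, centralAct (y k * star (y k)) (a k)‖ ≤ M * ‖r‖ := by
  obtain ⟨e, he, h_unit⟩ := hA
  have norm_conj_le (n : ℕ) :
      ‖∑ k, centralAct (y k * star (y k)) (e n * a k * star (e n))‖ ≤ M * ‖r‖ := by
    simp only [centralAct_mul_star_conj]
    refine (norm_sum_mul_mul_star_le _ (fun k => toSeqAlg A (a k)) hM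
      fun k => (norm_toSeqAlg _).trans_le (ha k)).trans ?_
    simp only [← centralAct_mul_star, hy]
    rw [norm_smul, norm_toSeqAlg, CStarRing.norm_self_mul_star]
    exact mul_le_mul_of_nonneg_left (mul_le_of_le_one_right (norm_nonneg _)
      (mul_le_one₀ (he n) (norm_nonneg _) (he n))) hM
  have tendsto_sum :
      Tendsto (fun n => ∑ k, centralAct (y k * star (y k)) (e n * a k * star (e n))) atTop
        (𝓝 (∑ k, centralAct (y k * star (y k)) (a k))) :=
    tendsto_finsetSum _ fun k _ =>
      ((continuous_centralAct _).tendsto _).comp (tendsto_mul_mul_star he h_unit (a k))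
  exact le_of_tendsto' tendsto_sum.norm norm_conj_le

end CentralAction

section PartitionOfUnity

variable {X : Type*} [TopologicalSpace X] [CompactSpace X] [NormalSpace X]

theorem exists_sum_mul_star_eq_one_of_nhds {U : X → Set X} (hU : ∀ x, U x ∈ 𝓝 x) :
    ∃ (N : Finset X) (s : N → C(X, ℂ)), ∑ k, s k * star (s k) = 1 ∧
      ∀ k x, s k x ≠ 0 → x ∈ U k := by
  obtain ⟨N, hN⟩ := CompactSpace.elim_nhds_subcover (fun x => interior (U x))
    fun x => interior_mem_nhds.2 (hU x)
  obtain ⟨f, hf⟩ := PartitionOfUnity.exists_isSubordinate (s := Set.univ) isClosed_univ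
    (fun k : N => interior (U k)) (fun _ => isOpen_interior) fun x _ => by
      simpa only [Set.mem_iUnion, Subtype.exists, exists_prop] using hN.ge (Set.mem_univ x)
  refine ⟨N, fun k => ⟨fun x => (√(f k x) : ℂ), by fun_prop⟩, ?_, fun k x hx => ?_⟩
  · ext x
    have sum_eq_one : ∑ k, f k x = 1 := by
      rw [← finsum_eq_sum_of_fintype]
      exact f.sum_eq_one (Set.mem_univ x)
    simp only [ContinuousMap.sum_apply, ContinuousMap.mul_apply, ContinuousMap.star_apply,
      ContinuousMap.coe_mk, Complex.star_def, Complex.conj_ofReal, ContinuousMap.one_apply]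
    simp only [← Complex.ofReal_mul, Real.mul_self_sqrt (f.nonneg _ x), ← Complex.ofReal_sum,
      sum_eq_one, Complex.ofReal_one]
  · refine interior_subset (hf k (subset_tsupport _ fun hfx => hx ?_))
    simp only [ContinuousMap.coe_mk, hfx, Real.sqrt_zero, Complex.ofReal_zero]

theorem exists_sum_mul_star_eq_one_norm_sum_smul_sub_le {V : Type*} [NormedAddCommGroup V]
    [NormedSpace ℂ V] (F : C(X, V)) {ε : ℝ} (hε : 0 < ε) :
    ∃ (N : Finset X) (s : N → C(X, ℂ)), ∑ k, s k * star (s k) = 1 ∧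
      ∀ x, ‖∑ k, (s k * star (s k)) x • F k - F x‖ ≤ ε := by
  obtain ⟨N, s, hs, h_near⟩ := exists_sum_mul_star_eq_one_of_nhds fun x =>
    F.continuous.continuousAt.preimage_mem_nhds (Metric.ball_mem_nhds (F x) hε)
  refine ⟨N, s, hs, fun x => ?_⟩
  have mul_star_apply (k : N) : (s k * star (s k)) x = ((‖s k x‖ ^ 2 : ℝ) : ℂ) := by
    rw [ContinuousMap.mul_apply, ContinuousMap.star_apply, Complex.star_def, Complex.mul_conj,
      Complex.normSq_eq_norm_sq]
  have sum_apply : ∑ k, (s k * star (s k)) x = 1 := by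
    rw [← ContinuousMap.sum_apply, hs, ContinuousMap.one_apply]
  have sum_norm_sq : ∑ k, ‖s k x‖ ^ 2 = 1 := by
    simp only [mul_star_apply, ← Complex.ofReal_sum] at sum_apply
    exact_mod_cast sum_apply
  have term_le (k : N) : ‖(s k * star (s k)) x • (F k - F x)‖ ≤ ‖s k x‖ ^ 2 * ε := by
    rw [norm_smul, mul_star_apply, Complex.norm_real, Real.norm_of_nonneg (by positivity)]
    by_cases hk : s k x = 0
    · simp only [hk, norm_zero, zero_pow two_ne_zero, zero_mul, le_refl]
    · gcongr
      rw [← dist_eq_norm, dist_comm]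
      exact (h_near k x hk).le
  calc ‖∑ k, (s k * star (s k)) x • F k - F x‖
      = ‖∑ k, (s k * star (s k)) x • (F k - F x)‖ := by
        simp only [smul_sub, Finset.sum_sub_distrib, ← Finset.sum_smul, sum_apply, one_smul]
    _ ≤ ∑ k, ‖s k x‖ ^ 2 * ε := norm_sum_le_of_le _ fun k _ => term_le k
    _ = ε := by rw [← Finset.sum_mul, sum_norm_sq, one_mul]

end PartitionOfUnity

section Evaluation

open scoped TensorProduct

variable {A X : Type*} [NonUnitalCStarAlgebra A] [TopologicalSpace X]

variable (A X) in
/-- The canonical map `C(X) ⊙ A → C(X, A)` on the algebraic tensor product. -/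
def funTensor : C(X, ℂ) ⊗[ℂ] A →ₗ[ℂ] C(X, A) :=
  TensorProduct.lift <| LinearMap.mk₂ ℂ (fun f a => f • ContinuousMap.const X a)
    (fun _ _ _ => add_smul _ _ _)
    (fun _ _ _ => by ext; exact mul_smul _ _ _)
    (fun _ _ _ => by ext; exact smul_add _ _ _)
    (fun _ _ _ => by ext; exact smul_comm _ _ _)

theorem funTensor_tmul_apply (f : C(X, ℂ)) (a : A) (x : X) :
    funTensor A X (f ⊗ₜ a) x = f x • a := rfl

theorem funTensor_tmul_mul (f f' : C(X, ℂ)) (a a' : A) :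
    funTensor A X (f ⊗ₜ a) * funTensor A X (f' ⊗ₜ a') = funTensor A X ((f * f') ⊗ₜ (a * a')) := by
  ext x
  exact smul_mul_smul_comm _ _ _ _

theorem star_funTensor_tmul (f : C(X, ℂ)) (a : A) :
    star (funTensor A X (f ⊗ₜ a)) = funTensor A X (star f ⊗ₜ star a) := by
  ext x
  exact star_smul _ _

theorem denseRange_funTensor [CompactSpace X] [NormalSpace X] : DenseRange (funTensor A X) := by
  intro F
  rw [Metric.mem_closure_iff]
  intro ε hε
  obtain ⟨N, s, -, h_near⟩ := exists_sum_mul_star_eq_one_norm_sum_smul_sub_le F (half_pos hε)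
  refine ⟨_, ⟨∑ k, (s k * star (s k)) ⊗ₜ F k, rfl⟩, ?_⟩
  rw [dist_comm, dist_eq_norm]
  refine ((ContinuousMap.norm_le _ (half_pos hε).le).2 fun x => ?_).trans_lt (half_lt_self hε)
  simpa only [map_sum, ContinuousMap.sub_apply, ContinuousMap.sum_apply, funTensor_tmul_apply]
    using h_near x

variable (hA : IsSigmaUnital A) {φ : C(X, ℂ) →⋆ₙₐ[ℂ] CentralSeqAlg A}
  (hφ : ∀ y, φ 1 * y = y)

include hA hφ

theorem norm_sum_centralAct_hom_le {ι : Type*} [Fintype ι] {s : ι → C(X, ℂ)} {r : ℂ}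
    (hs : ∑ k, s k * star (s k) = r • 1) {a : ι → A} {M : ℝ} (hM : 0 ≤ M)
    (ha : ∀ k, ‖a k‖ ≤ M) :
    ‖∑ k, centralAct (φ (s k * star (s k))) (a k)‖ ≤ M * ‖r‖ := by
  simp only [map_mul, map_star]
  refine norm_sum_centralAct_mul_star_le hA (fun b => ?_) hM ha
  simp only [← map_star, ← map_mul]
  rw [← LinearMap.sum_apply, ← map_sum, ← map_sum, hs, map_smul, map_smul, LinearMap.smul_apply,
    centralAct_unit hA hφ]

theorem norm_centralAct_hom_le [CompactSpace X] (f : C(X, ℂ)) (a : A) :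
    ‖centralAct (φ f) a‖ ≤ ‖f‖ * ‖a‖ := by
  let d : C(X, ℂ) := ⟨fun x => (√(‖f‖ ^ 2 - ‖f x‖ ^ 2) : ℂ), by fun_prop⟩
  have mul_star_add : f * star f + d * star d = ((‖f‖ ^ 2 : ℝ) : ℂ) • (1 : C(X, ℂ)) := by
    ext x
    have sub_nonneg : 0 ≤ ‖f‖ ^ 2 - ‖f x‖ ^ 2 :=
      _root_.sub_nonneg.2 (pow_le_pow_left₀ (norm_nonneg _) (f.norm_coe_le_norm x) 2)
    have d_apply : d x = (√(‖f‖ ^ 2 - ‖f x‖ ^ 2) : ℂ) := rfl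
    simp only [ContinuousMap.add_apply, ContinuousMap.mul_apply, ContinuousMap.star_apply,
      ContinuousMap.smul_apply, ContinuousMap.one_apply, d_apply, Complex.star_def,
      Complex.mul_conj, Complex.normSq_eq_norm_sq, Complex.norm_real, Real.norm_eq_abs, sq_abs,
      Real.sq_sqrt sub_nonneg, smul_eq_mul, mul_one]
    rw [← Complex.ofReal_add, add_sub_cancel]
  have norm_le := norm_sum_centralAct_hom_le hA hφ (s := ![f, d]) (a := ![a * star a, 0])
    ((Fin.sum_univ_two _).trans mul_star_add) (norm_nonneg (a * star a))
    (Fin.forall_fin_two.2 ⟨le_rfl, norm_zero.trans_le (norm_nonneg _)⟩)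
  simp only [Fin.sum_univ_two, Matrix.cons_val_zero, Matrix.cons_val_one, map_zero, add_zero,
    Complex.norm_real, norm_pow, norm_norm] at norm_le
  rw [map_mul φ, map_star φ, centralAct_mul_star, CStarRing.norm_self_mul_star,
    CStarRing.norm_self_mul_star] at norm_le
  refine abs_le_of_sq_le_sq' ?_ (by positivity) |>.2
  linarith

theorem exists_norm_lift_centralAct_sub_sum_le [CompactSpace X] [NormalSpace X]
    (t : C(X, ℂ) ⊗[ℂ] A) {ε : ℝ} (hε : 0 < ε) :
    ∃ (N : Finset X) (s : N → C(X, ℂ)), ∑ k, s k * star (s k) = 1 ∧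
      ‖TensorProduct.lift (centralAct ∘ₗ (φ : C(X, ℂ) →ₗ[ℂ] CentralSeqAlg A)) t
        - ∑ k, centralAct (φ (s k * star (s k))) (funTensor A X t k)‖ ≤ ε := by
  obtain ⟨S, ht⟩ := TensorProduct.exists_finset t
  let C : ℝ := ∑ i ∈ S, ‖i.2‖ + 1
  have C_pos : 0 < C := by positivity
  -- One partition of unity for all of the finitely many functions in `t`.
  obtain ⟨N, s, hs, h_near⟩ := exists_sum_mul_star_eq_one_norm_sum_smul_sub_le
    (⟨fun x i => i.1.1 x, by fun_prop⟩ : C(X, S → ℂ)) (div_pos hε C_pos)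
  refine ⟨N, s, hs, ?_⟩
  set L := TensorProduct.lift (centralAct ∘ₗ (φ : C(X, ℂ) →ₗ[ℂ] CentralSeqAlg A))
  have L_sum : ∑ k, centralAct (φ (s k * star (s k))) (funTensor A X t k)
      = L (∑ k, (s k * star (s k)) ⊗ₜ funTensor A X t k) := by
    rw [map_sum]
    rfl
  have sub_eq : t - ∑ k, (s k * star (s k)) ⊗ₜ funTensor A X t k
      = ∑ i ∈ S, (i.1 - ∑ k : N, i.1 k • (s k * star (s k))) ⊗ₜ i.2 := by
    simp only [TensorProduct.sub_tmul, Finset.sum_sub_distrib, ← ht, TensorProduct.sum_tmul,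
      TensorProduct.smul_tmul]
    rw [Finset.sum_comm]
    simp only [← TensorProduct.tmul_sum]
    simp only [← funTensor_tmul_apply, ← ContinuousMap.sum_apply, ← map_sum, ← ht]
  have norm_sub_le (i) (hi : i ∈ S) : ‖i.1 - ∑ k : N, i.1 k • (s k * star (s k))‖ ≤ ε / C := by
    refine (ContinuousMap.norm_le _ (div_pos hε C_pos).le).2 fun x => ?_
    rw [← norm_neg, ← ContinuousMap.neg_apply, neg_sub]
    simpa [mul_comm] using (norm_le_pi_norm _ ⟨i, hi⟩).trans (h_near x)
  rw [L_sum, ← map_sub, sub_eq, map_sum]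
  calc ‖∑ i ∈ S, L ((i.1 - ∑ k : N, i.1 k • (s k * star (s k))) ⊗ₜ i.2)‖
      ≤ ∑ i ∈ S, ε / C * ‖i.2‖ := norm_sum_le_of_le _ fun i hi =>
        (norm_centralAct_hom_le hA hφ _ _).trans
          (mul_le_mul_of_nonneg_right (norm_sub_le i hi) (norm_nonneg _))
    _ = ε / C * ∑ i ∈ S, ‖i.2‖ := (Finset.mul_sum _ _ _).symm
    _ ≤ ε / C * C := by
        gcongr
        exact (lt_add_one _).le
    _ = ε := div_mul_cancel₀ _ C_pos.ne'

theorem norm_lift_centralAct_le [CompactSpace X] [NormalSpace X] (t : C(X, ℂ) ⊗[ℂ] A) :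
    ‖TensorProduct.lift (centralAct ∘ₗ (φ : C(X, ℂ) →ₗ[ℂ] CentralSeqAlg A)) t‖
      ≤ ‖funTensor A X t‖ := by
  refine le_of_forall_pos_le_add fun ε hε => ?_
  obtain ⟨N, s, hs, h_near⟩ := exists_norm_lift_centralAct_sub_sum_le hA hφ t hε
  have norm_sum_le : ‖∑ k, centralAct (φ (s k * star (s k))) (funTensor A X t k)‖
      ≤ ‖funTensor A X t‖ := by
    simpa only [norm_one, mul_one] using norm_sum_centralAct_hom_le hA hφ
      (hs.trans (one_smul ℂ 1).symm) (norm_nonneg (funTensor A X t)) fun k =>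
        (funTensor A X t).norm_coe_le_norm k
  exact (norm_le_norm_add_norm_sub' _ _).trans (add_le_add norm_sum_le h_near)

theorem exists_evaluation_hom [CompactSpace X] [NormalSpace X] :
    ∃ ψ : C(X, A) →⋆ₙₐ[ℂ] SeqAlg A, ∀ f a, ψ (funTensor A X (f ⊗ₜ a)) = centralAct (φ f) a := by
  obtain ⟨ψ, hψ⟩ := exists_starHom_extension (TensorProduct.span_tmul_eq_top ℂ C(X, ℂ) A)
    denseRange_funTensor ⟨1, fun t => (norm_lift_centralAct_le hA hφ t).trans_eq (one_mul _).symm⟩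
    (by
      rintro _ ⟨f, a, rfl⟩ _ ⟨f', a', rfl⟩
      exact ⟨(f * f') ⊗ₜ (a * a'), (funTensor_tmul_mul _ _ _ _).symm,
        (congrArg (centralAct · _) (map_mul φ f f')).trans (centralAct_mul _ _ _ _)⟩)
    (by
      rintro _ ⟨f, a, rfl⟩
      exact ⟨star f ⊗ₜ star a, (star_funTensor_tmul f a).symm,
        (congrArg (centralAct · _) (map_star φ f)).trans (centralAct_star _ _)⟩)
  exact ⟨ψ, fun f a => hψ (f ⊗ₜ a)⟩

end Evaluation

section FixedPoints

open MeasureTheory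

variable {A G : Type*} [NonUnitalCStarAlgebra A] [Group G]

theorem norm_act_le (α : G →* (A ≃⋆ₐ[ℂ] A)) (g : G) (a : A) : ‖α g a‖ ≤ ‖a‖ :=
  NonUnitalStarAlgHom.norm_apply_le ((α g : A ≃⋆ₐ[ℂ] A) : A →⋆ₙₐ[ℂ] A) a

variable [MeasurableSpace G] {α : G →* (A ≃⋆ₐ[ℂ] A)}

theorem norm_integral_act_le (μ : Measure G) [IsProbabilityMeasure μ] (a : A) :
    ‖∫ g, α g a ∂μ‖ ≤ ‖a‖ := by
  simpa using norm_integral_le_of_norm_le_const (μ := μ) (.of_forall fun g => norm_act_le α g a)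

variable [TopologicalSpace G] [BorelSpace G] [CompactSpace G]

theorem integrable_act (hα : ∀ a, Continuous fun g => α g a) (μ : Measure G)
    [IsFiniteMeasureOnCompacts μ] (a : A) : Integrable (fun g => α g a) μ :=
  (hα a).integrable_of_hasCompactSupport (HasCompactSupport.of_compactSpace _)

theorem integral_act_mem_fixedPoints [IsTopologicalGroup G]
    (hα : ∀ a, Continuous fun g => α g a) (μ : Measure G) [IsFiniteMeasureOnCompacts μ]
    [μ.IsMulLeftInvariant] (a : A) : ∫ g, α g a ∂μ ∈ fixedPoints α := fun h => by
  let α_h : A →L[ℂ] A := ⟨(α h : A →⋆ₙₐ[ℂ] A), KTheory.continuous_starHom _⟩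
  calc α h (∫ g, α g a ∂μ) = ∫ g, α h (α g a) ∂μ :=
        (α_h.integral_comp_comm (integrable_act hα μ a)).symm
    _ = ∫ g, α (h * g) a ∂μ := by simp only [map_mul, StarAlgEquiv.mul_apply]
    _ = ∫ g, α g a ∂μ := integral_mul_left_eq_self (fun g => α g a) h

theorem tendsto_integral_act_sub (hα : ∀ a, Continuous fun g => α g a) (μ : Measure G)
    [IsProbabilityMeasure μ] {x : ℕ → A} {C : ℝ} (hC : ∀ n, ‖x n‖ ≤ C)
    (hx : ∀ g, Tendsto (fun n => α g (x n) - x n) atTop (𝓝 0)) :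
    Tendsto (fun n => ∫ g, α g (x n) ∂μ - x n) atTop (𝓝 0) := by
  have integrable_sub (n : ℕ) : Integrable (fun g => α g (x n) - x n) μ :=
    (integrable_act hα μ (x n)).sub (integrable_const _)
  have tendsto_integral :
      Tendsto (fun n => ∫ g, (α g (x n) - x n) ∂μ) atTop (𝓝 (∫ _, (0 : A) ∂μ)) :=
    tendsto_integral_of_dominated_convergence (fun _ => C + C)
      (fun n => (integrable_sub n).aestronglyMeasurable) (integrable_const _)
      (fun n => .of_forall fun g => norm_sub_le_of_le ((norm_act_le α g _).trans (hC n)) (hC n))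
      (.of_forall hx)
  rw [integral_zero] at tendsto_integral
  refine tendsto_integral.congr fun n => ?_
  rw [integral_sub (integrable_act hα μ _) (integrable_const _), integral_const, probReal_univ,
    one_smul]

end FixedPoints

section Splitting

/-- The `*`-homomorphisms `θ : A → B_∞` and `ψ : C → A_∞` split the equalizer diagram
`B → A ⇉ C` of `j`, `c₀` and `c₁` up to sequence algebras: `θ` and `ψ` restrict to the canonical
embeddings along `j` and `c₁`, and `ψ ∘ c₀` factors through `θ`. -/
structure IsSeqSplitEqualizer {A B C : Type*} [NonUnitalCStarAlgebra A] [NonUnitalCStarAlgebra B]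
    [NonUnitalCStarAlgebra C] (j : B →⋆ₙₐ[ℂ] A) (c₀ c₁ : A →⋆ₙₐ[ℂ] C)
    (θ : A →⋆ₙₐ[ℂ] SeqAlg B) (ψ : C →⋆ₙₐ[ℂ] SeqAlg A) : Prop where
  comp_eq : c₀.comp j = c₁.comp j
  left_split : θ.comp j = toSeqAlg B
  right_split : ψ.comp c₁ = toSeqAlg A
  compat : ψ.comp c₀ = (seqAlgMap j).comp θ

variable {A G : Type*} [NonUnitalCStarAlgebra A] [Group G] [TopologicalSpace G]
  {α : G →* (A ≃⋆ₐ[ℂ] A)}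

theorem coaction_comp_fixedIncl (hα : ∀ a, Continuous fun g => α g a) :
    (coaction α hα).comp (fixedIncl α) = (constEmb A G).comp (fixedIncl α) := by
  ext a g
  exact a.2 g

variable [IsTopologicalGroup G]

/-- The diagonal action `σ ⊗ α` of `G` on `C(G, A) = C(G) ⊗ A`. -/
def diagAction (α : G →* (A ≃⋆ₐ[ℂ] A)) (g : G) : C(G, A) →⋆ₙₐ[ℂ] C(G, A) where
  toFun F := ⟨fun h => α g (F (g⁻¹ * h)), (KTheory.continuous_starHom (α g : A →⋆ₙₐ[ℂ] A)).comp
    (F.continuous.comp (continuous_const_mul g⁻¹))⟩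
  map_smul' c F := by ext h; exact map_smul (α g) c _
  map_zero' := by ext h; exact map_zero (α g)
  map_add' F F' := by ext h; exact map_add (α g) _ _
  map_mul' F F' := by ext h; exact map_mul (α g) _ _
  map_star' F := by ext h; exact map_star (α g) _

theorem diagAction_funTensor (g : G) (f : C(G, ℂ)) (a : A) :
    diagAction α g (funTensor A G (f ⊗ₜ a)) = funTensor A G (shift g f ⊗ₜ α g a) := by
  ext h
  exact map_smul (α g) _ _

theorem diagAction_coaction (hα : ∀ a, Continuous fun g => α g a) (g : G) (a : A) :
    diagAction α g (coaction α hα a) = coaction α hα a := by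
  ext h
  calc α g (α (g⁻¹ * h) a) = α (g * (g⁻¹ * h)) a := by rw [map_mul α g, StarAlgEquiv.mul_apply]
    _ = α h a := by rw [mul_inv_cancel_left]

variable [CompactSpace G]

theorem seqAlgMap_evaluation_hom {φ : C(G, ℂ) →⋆ₙₐ[ℂ] CentralSeqAlg A}
    (hφ : ∀ g f, φ (shift g f) = centralSeqMap (α g) (φ f)) {ψ : C(G, A) →⋆ₙₐ[ℂ] SeqAlg A}
    (hψ : ∀ f a, ψ (funTensor A G (f ⊗ₜ a)) = centralAct (φ f) a) (g : G) (F : C(G, A)) :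
    seqAlgMap (α g : A →⋆ₙₐ[ℂ] A) (ψ F) = ψ (diagAction α g F) := by
  let α_ψ : C(G, A) →ₗ[ℂ] SeqAlg A := (seqAlgMap (α g : A →⋆ₙₐ[ℂ] A)).comp ψ
  let ψ_α : C(G, A) →ₗ[ℂ] SeqAlg A := ψ.comp (diagAction α g)
  have eq_on_tensors : α_ψ ∘ₗ funTensor A G = ψ_α ∘ₗ funTensor A G := by
    refine TensorProduct.ext' fun f a => ?_
    calc seqAlgMap (α g : A →⋆ₙₐ[ℂ] A) (ψ (funTensor A G (f ⊗ₜ a)))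
        = centralAct (φ (shift g f)) (α g a) := by rw [hψ, seqAlgMap_centralAct, hφ]
      _ = ψ (diagAction α g (funTensor A G (f ⊗ₜ a))) := by rw [diagAction_funTensor, hψ]
  exact congrFun (denseRange_funTensor.equalizer
    (KTheory.continuous_starHom ((seqAlgMap (α g : A →⋆ₙₐ[ℂ] A)).comp ψ))
    (KTheory.continuous_starHom (ψ.comp (diagAction α g)))
    (congrArg DFunLike.coe eq_on_tensors)) F

theorem exists_seqAlgMap_fixedIncl_eq (hα : ∀ a, Continuous fun g => α g a) (x : SeqAlg A)
    (hx : ∀ g, seqAlgMap (α g : A →⋆ₙₐ[ℂ] A) x = x) :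
    ∃ y : SeqAlg (fixedPoints α), seqAlgMap (fixedIncl α) y = x := by
  obtain ⟨x, rfl⟩ := proj_surjective x
  let _ : MeasurableSpace G := borel G
  have _ : BorelSpace G := ⟨rfl⟩
  let μ : MeasureTheory.Measure G := .haarMeasure ⊤
  have _ : MeasureTheory.IsProbabilityMeasure μ := ⟨MeasureTheory.Measure.haarMeasure_self⟩
  let y : BddSeq (fixedPoints α) :=
    .ofBound (fun n => ⟨∫ g, α g (x n) ∂μ, integral_act_mem_fixedPoints hα μ (x n)⟩) ‖x‖
      fun n => (norm_integral_act_le μ (x n)).trans (x.norm_apply_le n)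
  refine ⟨(nullSeq _).proj y, ?_⟩
  rw [seqAlgMap_proj, proj_eq_proj_iff]
  exact tendsto_integral_act_sub hα μ x.norm_apply_le fun g => proj_eq_proj_iff.1 (hx g)

theorem HasRokhlinProperty.exists_isSeqSplitEqualizer (hR : HasRokhlinProperty α)
    (hA : IsSigmaUnital A) (hα : ∀ a, Continuous fun g => α g a) :
    ∃ θ ψ, IsSeqSplitEqualizer (fixedIncl α) (coaction α hα) (constEmb A G) θ ψ := by
  obtain ⟨φ, -, hφ_unit, hφ_equiv⟩ := hR
  obtain ⟨ψ, hψ⟩ := exists_evaluation_hom hA fun y => (hφ_unit y).1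
  have right_split : ψ.comp (constEmb A G) = toSeqAlg A := by
    ext a
    have constEmb_eq : constEmb A G a = funTensor A G (1 ⊗ₜ a) := by
      ext g
      exact (one_smul ℂ a).symm
    rw [NonUnitalStarAlgHom.comp_apply, constEmb_eq, hψ,
      centralAct_unit hA fun y => (hφ_unit y).1]
  have j_injective : Function.Injective (seqAlgMap (fixedIncl α)) :=
    seqAlgMap_injective Subtype.val_injective
  obtain ⟨θ, hθ⟩ := exists_lift_of_mem_range j_injective (ψ.comp (coaction α hα)) fun a =>
    exists_seqAlgMap_fixedIncl_eq hα _ fun g =>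
      (seqAlgMap_evaluation_hom hφ_equiv hψ g _).trans
        (congrArg ψ (diagAction_coaction hα g a))
  have left_split : θ.comp (fixedIncl α) = toSeqAlg (fixedPoints α) := by
    ext a
    refine j_injective ?_
    calc seqAlgMap (fixedIncl α) (θ (fixedIncl α a)) = ψ (coaction α hα (fixedIncl α a)) :=
          DFunLike.congr_fun hθ (fixedIncl α a)
      _ = ψ (constEmb A G (fixedIncl α a)) :=
          congrArg ψ (DFunLike.congr_fun (coaction_comp_fixedIncl hα) a)
      _ = toSeqAlg A (fixedIncl α a) := DFunLike.congr_fun right_split _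
      _ = seqAlgMap (fixedIncl α) (toSeqAlg (fixedPoints α) a) := (seqAlgMap_toSeqAlg _ _).symm
  exact ⟨θ, ψ, coaction_comp_fixedIncl hα, left_split, right_split, hθ.symm⟩

end Splitting

end Rokhlin

namespace KTheory

section Perturbation

theorem abs_ite_half_lt_sub_le (t : ℝ) :
    |(if 1 / 2 < t then 1 else 0) - t| ≤ 2 * |t * t - t| := by
  rw [show t * t - t = t * (t - 1) by ring, abs_mul]
  split_ifs with ht
  · rw [abs_sub_comm, abs_of_pos (by linarith : 0 < t)]
    nlinarith [abs_nonneg (t - 1)]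
  · rw [zero_sub, abs_neg, abs_of_neg (by linarith : t - 1 < 0)]
    nlinarith [abs_nonneg t]

theorem exists_isStarProjection_near {M : Type*} [NonUnitalCStarAlgebra M] {y : M}
    (hy : IsSelfAdjoint y) (h : ‖y * y - y‖ < 1 / 4) :
    ∃ q : M, IsStarProjection q ∧ ‖q - y‖ ≤ 2 * ‖y * y - y‖ := by
  let χ : ℝ → ℝ := fun t => if 1 / 2 < t then 1 else 0
  have hχ0 : χ 0 = 0 := by norm_num [χ]
  have hspec : ∀ t ∈ quasispectrum ℝ y, |t * t - t| ≤ ‖y * y - y‖ := fun t ht => by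
    have hcfc : cfcₙ (fun t : ℝ => t * t - t) y = y * y - y := by
      rw [cfcₙ_sub (fun t : ℝ => t * t) (fun t => t) y, cfcₙ_mul (fun t : ℝ => t) (fun t => t) y,
        cfcₙ_id' ℝ y]
    simpa only [hcfc, Real.norm_eq_abs] using
      norm_apply_le_norm_cfcₙ (fun t : ℝ => t * t - t) y ht
  have half_notMem : (1 / 2 : ℝ) ∉ quasispectrum ℝ y := fun ht => by
    have := (hspec _ ht).trans_lt h
    norm_num [abs_of_neg] at this
  have hχ : ContinuousOn χ (quasispectrum ℝ y) := by
    refine ContinuousOn.if ?_ continuousOn_const continuousOn_const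
    rintro t ⟨ht, hfr⟩
    rw [show {t : ℝ | 1 / 2 < t} = Set.Ioi (1 / 2) from rfl, frontier_Ioi] at hfr
    exact absurd ht (hfr ▸ half_notMem)
  refine ⟨cfcₙ χ y, ⟨?_, cfcₙ_predicate χ y⟩, ?_⟩
  · rw [IsIdempotentElem, ← cfcₙ_mul χ χ y]
    exact congrArg (cfcₙ · y) (funext fun t => by simp [χ])
  · nth_rewrite 2 [← cfcₙ_id' ℝ y]
    rw [← cfcₙ_sub χ (fun t => t) y]
    exact norm_cfcₙ_le fun t ht => (abs_ite_half_lt_sub_le t).trans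
      (mul_le_mul_of_nonneg_left (hspec t ht) zero_le_two)

variable {M : Type*} [CStarAlgebra M]

theorem abs_sub_one_le_of_mem_spectrum {h : M} (hs : IsSelfAdjoint h) {t : ℝ}
    (ht : t ∈ spectrum ℝ h) : |t - 1| ≤ ‖h - 1‖ := by
  have hcfc : cfc (fun t : ℝ => t - 1) h = h - 1 := by
    rw [cfc_sub (fun t : ℝ => t) (fun _ => 1) h, cfc_id' ℝ h, cfc_const_one ℝ h]
  simpa only [hcfc, Real.norm_eq_abs] using norm_apply_le_norm_cfc (fun t : ℝ => t - 1) h ht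

theorem abs_inv_sqrt_sub_one_le {t : ℝ} (ht : 1 / 2 ≤ t) : |(√t)⁻¹ - 1| ≤ 2 * |t - 1| := by
  have hsq : √t * √t = t := Real.mul_self_sqrt (by linarith)
  have hhalf : 1 / 2 ≤ √t := Real.le_sqrt_of_sq_le (by linarith)
  have hpos : 0 < √t := by linarith
  have hdiff : (√t)⁻¹ - 1 = -(t - 1) / (√t * (1 + √t)) := by
    field_simp
    linear_combination (-1 : ℝ) * hsq
  rw [hdiff, abs_div, abs_neg, abs_of_pos (by positivity : 0 < √t * (1 + √t)),
    div_le_iff₀ (by positivity)]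
  nlinarith [abs_nonneg (t - 1), mul_nonneg (abs_nonneg (t - 1)) (sub_nonneg.2 hhalf)]

theorem exists_inv_sqrt {h : M} (hs : IsSelfAdjoint h) (hlt : ‖h - 1‖ < 1) :
    ∃ r : M, IsSelfAdjoint r ∧ r * r * h = 1 ∧ (∀ b, Commute h b → Commute r b) ∧
      (‖h - 1‖ ≤ 1 / 2 → ‖r - 1‖ ≤ 2 * ‖h - 1‖) := by
  have hpos : ∀ t ∈ spectrum ℝ h, 0 < t := fun t ht => by
    linarith [neg_le_of_abs_le (abs_sub_one_le_of_mem_spectrum hs ht)]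
  let f : ℝ → ℝ := fun t => (√t)⁻¹
  have hf : ContinuousOn f (spectrum ℝ h) :=
    ContinuousOn.inv₀ (by fun_prop) fun t ht => (Real.sqrt_pos.2 (hpos t ht)).ne'
  refine ⟨cfc f h, cfc_predicate f h, ?_, fun b hb => hb.cfc_real f, fun hle => ?_⟩
  · nth_rewrite 3 [← cfc_id' ℝ h]
    rw [← cfc_mul f f h, ← cfc_mul (fun t => f t * f t) (fun t => t) h (hf.mul hf),
      ← cfc_const_one ℝ h]
    refine cfc_congr fun t ht => ?_
    change (√t)⁻¹ * (√t)⁻¹ * t = 1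
    rw [← mul_inv, Real.mul_self_sqrt (hpos t ht).le, inv_mul_cancel₀ (hpos t ht).ne']
  · have hsub : cfc (fun t => f t - 1) h = cfc f h - 1 := by
      rw [cfc_sub f (fun _ => 1) h hf, cfc_const_one ℝ h]
    rw [← hsub]
    refine norm_cfc_le (by positivity) fun t ht => ?_
    have htle := abs_sub_one_le_of_mem_spectrum hs ht
    exact (abs_inv_sqrt_sub_one_le (by linarith [neg_le_of_abs_le htle])).trans
      (mul_le_mul_of_nonneg_left htle zero_le_two)

theorem norm_le_two_of_norm_star_mul_self_sub_one_le {x : M} (h : ‖star x * x - 1‖ ≤ 1 / 2) :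
    ‖x‖ ≤ 2 := by
  have hone : ‖(1 : M)‖ ≤ 1 := by
    rcases subsingleton_or_nontrivial M with _ | _
    · simp [Subsingleton.elim (1 : M) 0]
    · exact CStarRing.norm_one.le
  have hle : ‖star x * x‖ ≤ 1 / 2 + 1 :=
    calc ‖star x * x‖ ≤ ‖star x * x - 1‖ + ‖(1 : M)‖ := by
          simpa using norm_add_le (star x * x - 1) 1
      _ ≤ 1 / 2 + 1 := add_le_add h hone
  rw [CStarRing.norm_star_mul_self] at hle
  nlinarith [norm_nonneg x]

theorem exists_unitary_near {x : M} (hleft : ‖star x * x - 1‖ ≤ 1 / 2)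
    (hright : ‖x * star x - 1‖ < 1) :
    ∃ u ∈ unitary M, ‖u - x‖ ≤ 4 * ‖star x * x - 1‖ := by
  obtain ⟨r, hr, hrh, hc, hn⟩ := exists_inv_sqrt (IsSelfAdjoint.star_mul_self x)
    (hleft.trans_lt (by norm_num))
  obtain ⟨s, -, hsk, -, -⟩ := exists_inv_sqrt (IsSelfAdjoint.mul_star_self x) hright
  have hrc : Commute r (star x * x) := hc _ (Commute.refl _)
  have hhr : star x * x * (r * r) = 1 := by rw [← (hrc.mul_left hrc).eq, hrh]
  have hx : s * s * x = x * (r * r) :=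
    calc s * s * x = s * s * x * (star x * x * (r * r)) := by rw [hhr, mul_one]
      _ = s * s * (x * star x) * (x * (r * r)) := by simp only [mul_assoc]
      _ = x * (r * r) := by rw [hsk, one_mul]
  refine ⟨x * r, Unitary.mem_iff.2 ⟨?_, ?_⟩, ?_⟩
  · calc star (x * r) * (x * r) = r * (star x * x * r) := by
          simp only [star_mul, hr.star_eq, mul_assoc]
      _ = 1 := by rw [← hrc.eq, ← mul_assoc, hrh]
  · calc x * r * star (x * r) = x * (r * r) * star x := by
          simp only [star_mul, hr.star_eq, mul_assoc]
      _ = 1 := by rw [← hx, mul_assoc, hsk]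
  · calc ‖x * r - x‖ = ‖x * (r - 1)‖ := by rw [mul_sub, mul_one]
      _ ≤ ‖x‖ * ‖r - 1‖ := norm_mul_le _ _
      _ ≤ 2 * (2 * ‖star x * x - 1‖) :=
        mul_le_mul (norm_le_two_of_norm_star_mul_self_sub_one_le hleft) (hn hleft)
          (norm_nonneg _) zero_le_two
      _ = 4 * ‖star x * x - 1‖ := by ring

theorem exists_corner_inv_sqrt {p a : M} (hp : IsStarProjection p) (ha : IsSelfAdjoint a)
    (hap : a * p = a) (hlt : ‖a - p‖ < 1) :
    ∃ r : M, IsSelfAdjoint r ∧ r * r * a = p ∧ Commute r a := by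
  have hpp : p * p = p := hp.isIdempotentElem
  have hpa : p * a = a := by
    simpa only [star_mul, ha.star_eq, hp.isSelfAdjoint.star_eq] using congrArg star hap
  have hph : p * (a + 1 - p) = a := by
    rw [mul_sub, mul_add, hpa, hpp, mul_one, add_sub_cancel_right]
  have hhp : (a + 1 - p) * p = a := by
    rw [sub_mul, add_mul, hap, hpp, one_mul, add_sub_cancel_right]
  obtain ⟨r, hr, hrh, hc, -⟩ := exists_inv_sqrt (h := a + 1 - p)
    ((ha.add (.one M)).sub hp.isSelfAdjoint) (by rwa [add_sub_right_comm, add_sub_cancel_right])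
  have hrp : Commute r p := hc p (hhp.trans hph.symm)
  have hra : Commute r a := hph ▸ hrp.mul_right (hc _ (Commute.refl _))
  refine ⟨r, hr, ?_, hra⟩
  calc r * r * a = p * (r * r * (a + 1 - p)) := by
        rw [← mul_assoc, ← (hrp.mul_left hrp).eq, mul_assoc (r * r), hph]
    _ = p := by rw [hrh, mul_one]

end Perturbation

section MatrixPerturbation

attribute [local instance] CStarAlgebra.spectralOrder CStarAlgebra.spectralOrderedRing

variable {E : Type*} [CStarAlgebra E] {ι κ : Type*} [Fintype ι] [Fintype κ]

theorem MvN.of_near {p : Matrix ι ι E} {q : Matrix κ κ E} (hp : IsStarProjection p)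
    (hq : IsStarProjection q) {w : Matrix κ ι E} (hwp : w * p = w) (hqw : q * w = w)
    (hleft : ‖CStarMatrix.ofMatrix (wᴴ * w - p)‖ < 1)
    (hright : ‖CStarMatrix.ofMatrix (w * wᴴ - q)‖ < 1) : MvN p q := by
  classical
  have hwq : wᴴ * q = wᴴ := by
    have hq' : qᴴ = q := hq.isSelfAdjoint
    simpa only [Matrix.conjTranspose_mul, hq'] using congrArg Matrix.conjTranspose hqw
  obtain ⟨r, hr, hrp, hrc⟩ : ∃ r : Matrix ι ι E,
      rᴴ = r ∧ r * r * (wᴴ * w) = p ∧ r * (wᴴ * w) = wᴴ * w * r :=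
    exists_corner_inv_sqrt (M := CStarMatrix ι ι E) (p := CStarMatrix.ofMatrix p)
      ⟨hp.isIdempotentElem, hp.isSelfAdjoint⟩ (Matrix.isHermitian_conjTranspose_mul_self w)
      ((Matrix.mul_assoc _ _ _).trans (congrArg (wᴴ * ·) hwp)) hleft
  obtain ⟨s, -, hsq, -⟩ : ∃ s : Matrix κ κ E,
      sᴴ = s ∧ s * s * (w * wᴴ) = q ∧ s * (w * wᴴ) = w * wᴴ * s :=
    exists_corner_inv_sqrt (M := CStarMatrix κ κ E) (p := CStarMatrix.ofMatrix q)
      ⟨hq.isIdempotentElem, hq.isSelfAdjoint⟩ (Matrix.isHermitian_mul_conjTranspose_self w)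
      ((Matrix.mul_assoc _ _ _).trans (congrArg (w * ·) hwq)) hright
  have hrp' : wᴴ * w * (r * r) = p := by
    rw [← hrp, ← Matrix.mul_assoc, ← hrc, Matrix.mul_assoc, ← hrc, ← Matrix.mul_assoc]
  have hsw : s * s * w = w * (r * r) :=
    calc s * s * w = s * s * (w * (wᴴ * w * (r * r))) := by rw [hrp', hwp]
      _ = s * s * (w * wᴴ) * w * (r * r) := by simp only [Matrix.mul_assoc]
      _ = w * (r * r) := by rw [hsq, hqw]
  refine ⟨w * r, ?_, ?_⟩
  · calc (w * r)ᴴ * (w * r) = r * (wᴴ * w * r) := by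
          simp only [Matrix.conjTranspose_mul, hr, Matrix.mul_assoc]
      _ = p := by rw [← hrc, ← Matrix.mul_assoc, hrp]
  · calc w * r * (w * r)ᴴ = w * (r * r) * wᴴ := by
          simp only [Matrix.conjTranspose_mul, hr, Matrix.mul_assoc]
      _ = q := by rw [← hsw, Matrix.mul_assoc, hsq]

end MatrixPerturbation

section Lift

open Rokhlin

variable {E : Type*} [NonUnitalCStarAlgebra E] {ι κ ν : Type*}

/-- The sequence `x` of matrices over `E` is, entry by entry, bounded with class in `E_∞` the
corresponding entry of `P`. -/
def IsLift (P : Matrix ι κ (SeqAlg E)) (x : ℕ → Matrix ι κ E) : Prop :=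
  ∀ i j, ∃ y : BddSeq E, (nullSeq E).proj y = P i j ∧ ∀ n, y n = x n i j

theorem exists_isLift (P : Matrix ι κ (SeqAlg E)) : ∃ x, IsLift P x := by
  choose y hy using fun i j => proj_surjective (P i j)
  exact ⟨fun n => Matrix.of fun i j => y i j n, fun i j => ⟨y i j, hy i j, fun n => rfl⟩⟩

namespace IsLift

variable {P Q : Matrix ι κ (SeqAlg E)} {x y : ℕ → Matrix ι κ E}

theorem tendsto (hx : IsLift P x) (hy : IsLift P y) (i : ι) (j : κ) :
    Tendsto (fun n => (x n - y n) i j) atTop (𝓝 0) := by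
  obtain ⟨x', hxP, hx'⟩ := hx i j
  obtain ⟨y', hyP, hy'⟩ := hy i j
  refine (proj_eq_proj_iff.1 (hxP.trans hyP.symm)).congr fun n => ?_
  rw [hx', hy', Matrix.sub_apply]

theorem congr (hx : IsLift P x) (h : ∀ i j, Tendsto (fun n => (y n - x n) i j) atTop (𝓝 0)) :
    IsLift P y := fun i j => by
  obtain ⟨x', hxP, hx'⟩ := hx i j
  obtain ⟨c, hc⟩ := (h i j).norm.bddAbove_range
  have hy : ∀ n, ‖y n i j‖ ≤ c + ‖x'‖ := fun n =>
    calc ‖y n i j‖ = ‖(y n - x n) i j + x' n‖ := by rw [hx', Matrix.sub_apply, sub_add_cancel]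
      _ ≤ ‖(y n - x n) i j‖ + ‖x' n‖ := norm_add_le _ _
      _ ≤ c + ‖x'‖ := add_le_add (hc ⟨n, rfl⟩) (x'.norm_apply_le n)
  refine ⟨BddSeq.ofBound (fun n => y n i j) _ hy, ?_, fun n => rfl⟩
  rw [← hxP, proj_eq_proj_iff]
  refine (h i j).congr fun n => ?_
  rw [BddSeq.ofBound_apply, hx', Matrix.sub_apply]

theorem add (hx : IsLift P x) (hy : IsLift Q y) : IsLift (P + Q) fun n => x n + y n :=
  fun i j => by
    obtain ⟨x', hxP, hx'⟩ := hx i j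
    obtain ⟨y', hyQ, hy'⟩ := hy i j
    exact ⟨x' + y', by rw [map_add, hxP, hyQ, Matrix.add_apply],
      fun n => congrArg₂ (· + ·) (hx' n) (hy' n)⟩

theorem smul (hx : IsLift P x) (c : ℂ) : IsLift (c • P) fun n => c • x n := fun i j => by
  obtain ⟨x', hxP, hx'⟩ := hx i j
  exact ⟨c • x', by rw [map_smul, hxP, Matrix.smul_apply], fun n => congrArg (c • ·) (hx' n)⟩

theorem conjTranspose (hx : IsLift P x) : IsLift Pᴴ fun n => (x n)ᴴ := fun i j => by
  obtain ⟨x', hxP, hx'⟩ := hx j i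
  exact ⟨star x', by rw [map_star, hxP, Matrix.conjTranspose_apply],
    fun n => congrArg star (hx' n)⟩

theorem mul [Fintype κ] {R : Matrix κ ν (SeqAlg E)} {z : ℕ → Matrix κ ν E} (hx : IsLift P x)
    (hz : IsLift R z) : IsLift (P * R) fun n => x n * z n := fun i j => by
  choose x' hxP hx' using fun k => hx i k
  choose z' hzR hz' using fun k => hz k j
  refine ⟨∑ k, x' k * z' k, ?_, fun n => ?_⟩
  · rw [map_sum, Matrix.mul_apply]
    exact Finset.sum_congr rfl fun k _ => by rw [map_mul, hxP, hzR]
  · rw [lp.coeFn_sum, Finset.sum_apply]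
    exact Finset.sum_congr rfl fun k _ => congrArg₂ (· * ·) (hx' k n) (hz' k n)

theorem const (p : Matrix ι κ E) : IsLift (p.map (toSeqAlg E)) fun _ => p :=
  fun i j => ⟨constSeq E (p i j), rfl, fun _ => rfl⟩

theorem map {F : Type*} [NonUnitalCStarAlgebra F] (φ : E →⋆ₙₐ[ℂ] F) (hx : IsLift P x) :
    IsLift (P.map (seqAlgMap φ)) fun n => (x n).map φ := fun i j => by
  obtain ⟨x', hxP, hx'⟩ := hx i j
  exact ⟨bddSeqMap φ x', by rw [Matrix.map_apply, ← hxP, seqAlgMap_proj],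
    fun n => congrArg φ (hx' n)⟩

theorem fromBlocks {ι' κ' : Type*} {R : Matrix ι' κ' (SeqAlg E)} {z : ℕ → Matrix ι' κ' E}
    (hx : IsLift P x) (hz : IsLift R z) :
    IsLift (Matrix.fromBlocks P 0 0 R) fun n => Matrix.fromBlocks (x n) 0 0 (z n) := by
  rintro (i | i) (j | j)
  · exact hx i j
  · exact ⟨0, map_zero _, fun _ => rfl⟩
  · exact ⟨0, map_zero _, fun _ => rfl⟩
  · exact hz i j

theorem submatrix {ι' κ' : Type*} (hx : IsLift P x) (e : ι' → ι) (f : κ' → κ) :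
    IsLift (P.submatrix e f) fun n => (x n).submatrix e f :=
  fun i j => hx (e i) (f j)

section Norm

attribute [local instance] CStarAlgebra.spectralOrder CStarAlgebra.spectralOrderedRing

variable [Fintype ι] [Fintype κ]

theorem tendsto_norm (hx : IsLift P x) (hy : IsLift P y) :
    Tendsto (fun n => ‖CStarMatrix.ofMatrix (x n - y n)‖) atTop (𝓝 0) := by
  have hxy : Tendsto (fun n => x n - y n) atTop (𝓝 0) :=
    tendsto_pi_nhds.2 fun i => tendsto_pi_nhds.2 (hx.tendsto hy i)
  have hlim := (CStarMatrix.ofMatrixL (m := ι) (n := κ) (A := E)).continuous.tendsto 0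
  rw [map_zero] at hlim
  exact tendsto_zero_iff_norm_tendsto_zero.1 (hlim.comp hxy)

theorem congr_norm (hx : IsLift P x) {b : ℕ → ℝ} (hb : Tendsto b atTop (𝓝 0))
    (h : ∀ᶠ n in atTop, ‖CStarMatrix.ofMatrix (y n - x n)‖ ≤ b n) : IsLift P y :=
  hx.congr fun _ _ => squeeze_zero_norm' (h.mono fun n hn =>
    (CStarMatrix.norm_entry_le_norm (M := CStarMatrix.ofMatrix (y n - x n))).trans hn) hb

end Norm

end IsLift

end Lift

section LiftProjection

attribute [local instance] CStarAlgebra.spectralOrder CStarAlgebra.spectralOrderedRing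

open Rokhlin

variable {E : Type*} {ι κ : Type*}

theorem exists_isLift_isSelfAdjoint [NonUnitalCStarAlgebra E] {P : Matrix ι ι (SeqAlg E)}
    (hP : Pᴴ = P) : ∃ y, IsLift P y ∧ ∀ n, (y n)ᴴ = y n := by
  obtain ⟨x, hx⟩ := exists_isLift P
  refine ⟨fun n => (1 / 2 : ℂ) • (x n + (x n)ᴴ), ?_, fun n => ?_⟩
  · have hhalf : (1 / 2 : ℂ) • (P + Pᴴ) = P := by
      rw [hP, ← two_smul ℂ P, smul_smul, one_div_mul_cancel two_ne_zero, one_smul]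
    exact hhalf ▸ (hx.add hx.conjTranspose).smul (1 / 2 : ℂ)
  · simp [Matrix.conjTranspose_smul, add_comm]

variable [Fintype ι]

theorem exists_isLift_isStarProjection [NonUnitalCStarAlgebra E] {P : Matrix ι ι (SeqAlg E)}
    (hP : IsStarProjection P) : ∃ q, IsLift P q ∧ ∀ n, IsStarProjection (q n) := by
  obtain ⟨y, hy, hys⟩ := exists_isLift_isSelfAdjoint hP.isSelfAdjoint
  have hyy : IsLift P fun n => y n * y n := hP.isIdempotentElem ▸ hy.mul hy
  have hlim := hyy.tendsto_norm hy
  have hnear : ∀ᶠ n in atTop, ∃ q : {q : Matrix ι ι E // IsStarProjection q},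
      ‖CStarMatrix.ofMatrix (q.1 - y n)‖ ≤ 2 * ‖CStarMatrix.ofMatrix (y n * y n - y n)‖ := by
    filter_upwards [hlim.eventually (gt_mem_nhds (by norm_num : (0 : ℝ) < 1 / 4))] with n hn
    obtain ⟨q, hq, hqy⟩ := exists_isStarProjection_near (M := CStarMatrix ι ι E)
      (y := CStarMatrix.ofMatrix (y n)) (hys n) hn
    exact ⟨⟨q, hq.isIdempotentElem, hq.isSelfAdjoint⟩, hqy⟩
  have : Nonempty {q : Matrix ι ι E // IsStarProjection q} := ⟨⟨0, .zero _⟩⟩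
  obtain ⟨q, hq⟩ := hnear.choice
  exact ⟨fun n => (q n).1, hy.congr_norm (by simpa using hlim.const_mul 2) hq, fun n => (q n).2⟩

variable [CStarAlgebra E]

theorem eventually_mvn_of_isLift [Fintype κ] {p : ℕ → Matrix ι ι E} {q : ℕ → Matrix κ κ E}
    (hp : ∀ n, IsStarProjection (p n)) (hq : ∀ n, IsStarProjection (q n))
    {V : Matrix κ ι (SeqAlg E)} (hlp : IsLift (Vᴴ * V) p) (hlq : IsLift (V * Vᴴ) q)
    (hV : V * Vᴴ * V = V) : ∀ᶠ n in atTop, MvN (p n) (q n) := by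
  obtain ⟨v, hv⟩ := exists_isLift V
  have hw : IsLift V fun n => q n * v n * p n := by
    simpa only [hV, ← Matrix.mul_assoc] using (hlq.mul hv).mul hlp
  filter_upwards [
    ((hw.conjTranspose.mul hw).tendsto_norm hlp).eventually (gt_mem_nhds one_pos),
    ((hw.mul hw.conjTranspose).tendsto_norm hlq).eventually (gt_mem_nhds one_pos)]
    with n hleft hright
  refine MvN.of_near (hp n) (hq n) (w := q n * v n * p n) ?_ ?_ hleft hright
  · rw [Matrix.mul_assoc, (hp n).isIdempotentElem.eq]
  · rw [← Matrix.mul_assoc, ← Matrix.mul_assoc, (hq n).isIdempotentElem.eq]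

theorem exists_isLift_unitary [DecidableEq ι] {U : Matrix ι ι (SeqAlg E)}
    (hleft : Uᴴ * U = (1 : Matrix ι ι E).map (toSeqAlg E))
    (hright : U * Uᴴ = (1 : Matrix ι ι E).map (toSeqAlg E)) :
    ∃ u : ℕ → unitary (Matrix ι ι E), IsLift U fun n => (u n).1 := by
  obtain ⟨x, hx⟩ := exists_isLift U
  have hlim_left := (hleft ▸ hx.conjTranspose.mul hx).tendsto_norm (IsLift.const 1)
  have hlim_right := (hright ▸ hx.mul hx.conjTranspose).tendsto_norm (IsLift.const 1)
  have hnear : ∀ᶠ n in atTop, ∃ u : unitary (Matrix ι ι E),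
      ‖CStarMatrix.ofMatrix (u.1 - x n)‖ ≤ 4 * ‖CStarMatrix.ofMatrix ((x n)ᴴ * x n - 1)‖ := by
    filter_upwards [hlim_left.eventually (gt_mem_nhds (by norm_num : (0 : ℝ) < 1 / 2)),
      hlim_right.eventually (gt_mem_nhds one_pos)] with n hn_left hn_right
    obtain ⟨u, hu, hux⟩ := exists_unitary_near (M := CStarMatrix ι ι E)
      (x := CStarMatrix.ofMatrix (x n)) hn_left.le hn_right
    exact ⟨⟨u, Unitary.mem_iff.2 (Unitary.mem_iff.1 hu)⟩, hux⟩
  obtain ⟨u, hu⟩ := hnear.choice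
  exact ⟨u, hx.congr_norm (by simpa using hlim_left.const_mul 4) hu⟩

end LiftProjection

section Projection

open Rokhlin

theorem conjTranspose_map_starHom {A B ι κ : Type*} [NonUnitalCStarAlgebra A]
    [NonUnitalCStarAlgebra B] (φ : A →⋆ₙₐ[ℂ] B) (M : Matrix ι κ A) :
    (M.map φ)ᴴ = Mᴴ.map φ :=
  (Matrix.conjTranspose_map φ (map_star φ)).symm

theorem isStarProjection_map_starHom {A B ι : Type*} [NonUnitalCStarAlgebra A]
    [NonUnitalCStarAlgebra B] [Fintype ι] (φ : A →⋆ₙₐ[ℂ] B) {p : Matrix ι ι A}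
    (hp : IsStarProjection p) : IsStarProjection (p.map φ) :=
  ⟨Matrix.map_mul.symm.trans (congrArg (Matrix.map · φ) hp.isIdempotentElem),
    (conjTranspose_map_starHom φ p).trans (congrArg (Matrix.map · φ) hp.isSelfAdjoint)⟩

theorem MvN.exists_partial_isometry {R ι κ : Type*} [Ring R] [StarRing R] [Fintype ι] [Fintype κ]
    {p : Matrix ι ι R} {q : Matrix κ κ R} (hp : IsStarProjection p) (hq : IsStarProjection q)
    (h : MvN p q) : ∃ w : Matrix κ ι R, wᴴ * w = p ∧ w * wᴴ = q ∧ w * wᴴ * w = w := by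
  obtain ⟨v, hv, hv'⟩ := h
  have hp_star : pᴴ = p := hp.isSelfAdjoint
  have hq_star : qᴴ = q := hq.isSelfAdjoint
  have hpp : p * p = p := hp.isIdempotentElem
  have hqq : q * q = q := hq.isIdempotentElem
  have hfinal : q * v * p * (q * v * p)ᴴ = q := by
    calc q * v * p * (q * v * p)ᴴ = q * v * (p * pᴴ) * vᴴ * qᴴ := by
          simp only [Matrix.conjTranspose_mul, Matrix.mul_assoc]
      _ = q * (v * vᴴ) * (v * vᴴ) * q := by
          rw [hp_star, hq_star, hpp, ← hv]
          simp only [Matrix.mul_assoc]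
      _ = q := by rw [hv', hqq, hqq, hqq]
  refine ⟨q * v * p, ?_, hfinal, by rw [hfinal, ← Matrix.mul_assoc, ← Matrix.mul_assoc, hqq]⟩
  calc (q * v * p)ᴴ * (q * v * p) = pᴴ * vᴴ * (qᴴ * q) * v * p := by
        simp only [Matrix.conjTranspose_mul, Matrix.mul_assoc]
    _ = p * (vᴴ * v) * (vᴴ * v) * p := by
        rw [hp_star, hq_star, hqq, ← hv']
        simp only [Matrix.mul_assoc]
    _ = p := by rw [hv, hpp, hpp, hpp]

variable {E F : Type*} [CStarAlgebra E] [CStarAlgebra F]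

/-- The sequence `s` in `V(E)` represents the image of `a ∈ V(F)` under `Θ : F → E_∞`. -/
def VMonoid.IsLift (Θ : F →⋆ₙₐ[ℂ] SeqAlg E) (a : VMonoid F) (s : ℕ → VMonoid E) : Prop :=
  ∃ (p : MatProj F) (x : ℕ → {x : Matrix (Fin p.1) (Fin p.1) E // IsStarProjection x}),
    VMonoid.mk p = a ∧ (∀ n, VMonoid.mk ⟨p.1, x n⟩ = s n) ∧
      KTheory.IsLift (p.2.1.map Θ) fun n => (x n).1

namespace VMonoid

variable {Θ : F →⋆ₙₐ[ℂ] SeqAlg E} {a b : VMonoid F} {s t : ℕ → VMonoid E}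

theorem exists_isLift (Θ : F →⋆ₙₐ[ℂ] SeqAlg E) (a : VMonoid F) : ∃ s, IsLift Θ a s := by
  obtain ⟨p⟩ := a
  obtain ⟨x, hx, hxp⟩ := exists_isLift_isStarProjection (isStarProjection_map_starHom Θ p.2.2)
  exact ⟨_, p, fun n => ⟨x n, hxp n⟩, rfl, fun n => rfl, hx⟩

theorem IsLift.add (ha : IsLift Θ a s) (hb : IsLift Θ b t) :
    IsLift Θ (a + b) fun n => s n + t n := by
  obtain ⟨p, x, rfl, hs, hx⟩ := ha
  obtain ⟨q, y, rfl, ht, hy⟩ := hb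
  refine ⟨p.dsum q, fun n => (MatProj.dsum ⟨p.1, x n⟩ ⟨q.1, y n⟩).2, rfl,
    fun n => congrArg₂ (· + ·) (hs n) (ht n), ?_⟩
  have hmap : (Matrix.fromBlocks p.2.1 0 0 q.2.1).map Θ =
      Matrix.fromBlocks (p.2.1.map Θ) 0 0 (q.2.1.map Θ) := by
    rw [Matrix.fromBlocks_map, Matrix.map_zero _ (map_zero Θ), Matrix.map_zero _ (map_zero Θ)]
  have hblocks := hmap ▸ hx.fromBlocks hy
  exact hblocks.submatrix finSumFinEquiv.symm finSumFinEquiv.symm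

theorem IsLift.eventually_eq (hs : IsLift Θ a s) (ht : IsLift Θ a t) :
    ∀ᶠ n in atTop, s n = t n := by
  obtain ⟨p, x, rfl, hxs, hx⟩ := hs
  obtain ⟨q, y, hqp, hyt, hy⟩ := ht
  obtain ⟨w, hwp, hwq, hw⟩ :=
    MvN.exists_partial_isometry p.2.2 q.2.2 (Quotient.exact hqp.symm : MvN p.2.1 q.2.1)
  have hmvn := eventually_mvn_of_isLift (fun n => (x n).2) (fun n => (y n).2) (V := w.map Θ)
    (by rwa [conjTranspose_map_starHom, ← Matrix.map_mul, hwp])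
    (by rwa [conjTranspose_map_starHom, ← Matrix.map_mul, hwq])
    (by rw [conjTranspose_map_starHom, ← Matrix.map_mul, ← Matrix.map_mul, hw])
  filter_upwards [hmvn] with n hn
  rw [← hxs, ← hyt]
  exact Quotient.sound hn

theorem isLift_map_const {j : E →⋆ₐ[ℂ] F} (h : Θ.comp j.toNonUnitalStarAlgHom = toSeqAlg E)
    (a : VMonoid E) : IsLift Θ (VMonoid.map j a) fun _ => a := by
  obtain ⟨p⟩ := a
  refine ⟨p.map j, fun _ => p.2, rfl, fun _ => rfl, ?_⟩
  have hmap : (p.map j).2.1.map Θ = p.2.1.map (toSeqAlg E) := by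
    rw [← h]
    rfl
  exact hmap ▸ IsLift.const p.2.1

theorem IsLift.map_map {H : Type*} [CStarAlgebra H] {j : E →⋆ₐ[ℂ] F} {c : F →⋆ₐ[ℂ] H}
    {Ψ : H →⋆ₙₐ[ℂ] SeqAlg F}
    (hc : Ψ.comp c.toNonUnitalStarAlgHom = (seqAlgMap j.toNonUnitalStarAlgHom).comp Θ)
    (ha : IsLift Θ a s) : IsLift Ψ (VMonoid.map c a) fun n => VMonoid.map j (s n) := by
  obtain ⟨p, x, rfl, hs, hx⟩ := ha
  refine ⟨p.map c, fun n => (MatProj.map j ⟨p.1, x n⟩).2, rfl,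
    fun n => congrArg (VMonoid.map j) (hs n), ?_⟩
  have hmap : (p.map c).2.1.map Ψ = (p.2.1.map Θ).map (seqAlgMap j.toNonUnitalStarAlgHom) := by
    ext i k
    exact DFunLike.congr_fun hc (p.2.1 i k)
  exact hmap ▸ hx.map j.toNonUnitalStarAlgHom

end VMonoid

end Projection

section GrothendieckGroup

open Algebra.GrothendieckAddGroup (of)

variable {M : Type*} [AddCommMonoid M]

theorem exists_eq_of_sub_of (x : Algebra.GrothendieckAddGroup M) : ∃ a b : M, x = of a - of b := by
  obtain ⟨⟨a, b⟩, hab⟩ := (AddLocalization.addMonoidOf (⊤ : AddSubmonoid M)).surj x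
  exact ⟨a, b, eq_sub_of_add_eq hab⟩

theorem of_eq_of_iff {a b : M} : of a = of b ↔ ∃ c, c + a = c + b :=
  (AddLocalization.addMonoidOf (⊤ : AddSubmonoid M)).eq_iff_exists.trans
    ⟨fun ⟨c, hc⟩ => ⟨c, hc⟩, fun ⟨c, hc⟩ => ⟨⟨c, trivial⟩, hc⟩⟩

theorem K00.map_map_eq {R S T : Type*} [Ring R] [StarRing R] [Algebra ℂ R] [Ring S] [StarRing S]
    [Algebra ℂ S] [Ring T] [StarRing T] [Algebra ℂ T] {j : R →⋆ₐ[ℂ] S} {c₀ c₁ : S →⋆ₐ[ℂ] T}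
    (h : c₀.comp j = c₁.comp j) (x : K00 R) :
    K00.map c₀ (K00.map j x) = K00.map c₁ (K00.map j x) := by
  have vMonoid_map_eq (a : VMonoid R) :
      VMonoid.map c₀ (VMonoid.map j a) = VMonoid.map c₁ (VMonoid.map j a) := by
    obtain ⟨p⟩ := a
    refine congrArg VMonoid.mk (Sigma.ext rfl (heq_of_eq (Subtype.ext ?_)))
    ext i k
    exact DFunLike.congr_fun h (p.2.1 i k)
  obtain ⟨a, b, rfl⟩ := exists_eq_of_sub_of x
  simp only [map_sub, K00.map_of, vMonoid_map_eq]

end GrothendieckGroup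

section UnitaryHomotopy

attribute [local instance] CStarAlgebra.spectralOrder CStarAlgebra.spectralOrderedRing

open Rokhlin

variable {E F : Type*} [CStarAlgebra E] [CStarAlgebra F] {ι κ : Type*}

theorem IsLift.eventually_norm_apply_lt {Θ : F →⋆ₙₐ[ℂ] SeqAlg E} {P Q : Matrix ι κ F}
    {x y : ℕ → Matrix ι κ E} (hx : IsLift (P.map Θ) x) (hy : IsLift (Q.map Θ) y) {i : ι} {j : κ}
    {δ : ℝ} (h : ‖Q i j - P i j‖ < δ) : ∀ᶠ n in atTop, ‖(y n - x n) i j‖ < δ := by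
  obtain ⟨x', hxP, hx'⟩ := hx i j
  obtain ⟨y', hyQ, hy'⟩ := hy i j
  have hproj : ‖(nullSeq E).proj (y' - x')‖ < δ := by
    rw [map_sub, hxP, hyQ, Matrix.map_apply, Matrix.map_apply, ← map_sub]
    exact (NonUnitalStarAlgHom.norm_apply_le Θ _).trans_lt h
  filter_upwards [eventually_norm_lt_of_norm_proj_lt hproj] with n hn
  rwa [Matrix.sub_apply, ← hx', ← hy']

variable [Fintype ι]

theorem exists_forall_norm_ofMatrix_lt (ι E : Type*) [Fintype ι] [CStarAlgebra E] {ε : ℝ}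
    (hε : 0 < ε) :
    ∃ δ > 0, ∀ x : Matrix ι ι E, (∀ i j, ‖x i j‖ < δ) → ‖CStarMatrix.ofMatrix x‖ < ε := by
  have hlim : Tendsto (fun x : ι → ι → E => ‖CStarMatrix.ofMatrixL (m := ι) (n := ι) (A := E) x‖)
      (𝓝 0) (𝓝 0) := by
    have hnorm := (CStarMatrix.ofMatrixL (m := ι) (n := ι) (A := E)).continuous.norm.tendsto 0
    rwa [map_zero, norm_zero] at hnorm
  obtain ⟨δ, δ_pos, hδ⟩ := Metric.mem_nhds_iff.1 (hlim.eventually (gt_mem_nhds hε))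
  refine ⟨δ, δ_pos, fun x hx => hδ (Metric.mem_ball.2 ?_)⟩
  refine (dist_pi_lt_iff δ_pos).2 fun i => (dist_pi_lt_iff δ_pos).2 fun j => ?_
  exact (dist_zero_right (x i j)).trans_lt (hx i j)

variable [DecidableEq ι]

theorem joined_of_norm_sub_lt_two (u v : unitary (Matrix ι ι E))
    (h : ‖CStarMatrix.ofMatrix (v.1 - u.1)‖ < 2) : Joined u v := by
  let toMatrix : unitary (CStarMatrix ι ι E) → unitary (Matrix ι ι E) := fun w => ⟨w.1, w.2⟩
  have continuous_toMatrix : Continuous toMatrix := continuous_induced_rng.2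
    ((CStarMatrix.ofMatrixL (m := ι) (n := ι) (A := E)).symm.continuous.comp
      continuous_subtype_val)
  exact (Unitary.joined (A := CStarMatrix ι ι E) ⟨CStarMatrix.ofMatrix u.1, u.2⟩
    ⟨CStarMatrix.ofMatrix v.1, v.2⟩ h).map continuous_toMatrix

theorem exists_isLift_unitary_map {Θ : F →⋆ₙₐ[ℂ] SeqAlg E} (hΘ : Θ 1 = toSeqAlg E 1)
    (w : unitary (Matrix ι ι F)) :
    ∃ u : ℕ → unitary (Matrix ι ι E), IsLift (w.1.map Θ) fun n => (u n).1 := by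
  have map_one_eq : (1 : Matrix ι ι F).map Θ = (1 : Matrix ι ι E).map (toSeqAlg E) := by
    ext i j
    rw [Matrix.map_apply, Matrix.map_apply, Matrix.one_apply, Matrix.one_apply]
    split_ifs
    · exact hΘ
    · rw [map_zero, map_zero]
  obtain ⟨hleft, hright⟩ := Unitary.mem_iff.1 w.2
  exact exists_isLift_unitary
    (by rw [conjTranspose_map_starHom, ← Matrix.map_mul, ← map_one_eq, ← hleft]; rfl)
    (by rw [conjTranspose_map_starHom, ← Matrix.map_mul, ← map_one_eq, ← hright]; rfl)

theorem eventually_forall_joined {T : Type*} [TopologicalSpace T]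
    {γ : T → unitary (Matrix ι ι F)} (hγ : Continuous γ) (Θ : F →⋆ₙₐ[ℂ] SeqAlg E) (t : T) :
    ∀ᶠ s in 𝓝 t, ∀ u v : ℕ → unitary (Matrix ι ι E), IsLift ((γ t).1.map Θ) (fun n => (u n).1) →
      IsLift ((γ s).1.map Θ) (fun n => (v n).1) → ∀ᶠ n in atTop, Joined (u n) (v n) := by
  obtain ⟨δ, δ_pos, hδ⟩ := exists_forall_norm_ofMatrix_lt ι E two_pos
  have entry_near (i j : ι) : ∀ᶠ s in 𝓝 t, ‖(γ s).1 i j - (γ t).1 i j‖ < δ := by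
    have hentry : Continuous fun s => (γ s).1 i j :=
      (continuous_subtype_val.comp hγ).matrix_elem i j
    exact (tendsto_iff_norm_sub_tendsto_zero.1 (hentry.tendsto t)).eventually (gt_mem_nhds δ_pos)
  filter_upwards [eventually_all.2 fun i => eventually_all.2 (entry_near i)] with s hs u v hu hv
  filter_upwards [eventually_all.2 fun i => eventually_all.2 fun j =>
    hu.eventually_norm_apply_lt hv (hs i j)] with n hn
  exact joined_of_norm_sub_lt_two _ _ (hδ _ hn)

theorem eventually_joined_of_isLift {Θ : F →⋆ₙₐ[ℂ] SeqAlg E} (hΘ : Θ 1 = toSeqAlg E 1)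
    {w w' : unitary (Matrix ι ι F)} (h : Joined w w') {u u' : ℕ → unitary (Matrix ι ι E)}
    (hu : IsLift (w.1.map Θ) fun n => (u n).1) (hu' : IsLift (w'.1.map Θ) fun n => (u' n).1) :
    ∀ᶠ n in atTop, Joined (u n) (u' n) := by
  obtain ⟨γ⟩ := h
  let LiftsJoined : unitInterval → unitInterval → Prop := fun t s =>
    ∀ u v : ℕ → unitary (Matrix ι ι E), IsLift ((γ t).1.map Θ) (fun n => (u n).1) →
      IsLift ((γ s).1.map Θ) (fun n => (v n).1) → ∀ᶠ n in atTop, Joined (u n) (v n)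
  have symm {t s : unitInterval} (hts : LiftsJoined t s) : LiftsJoined s t :=
    fun u v hu hv => (hts v u hv hu).mono fun n => Joined.symm
  have trans : IsTrans _ LiftsJoined := ⟨fun t s r hts hsr u v hu hv => by
    obtain ⟨z, hz⟩ := exists_isLift_unitary_map hΘ (γ s)
    filter_upwards [hts u z hu hz, hsr z v hz hv] with n huz hzv
    exact huz.trans hzv⟩
  have joined_zero_one : LiftsJoined 0 1 := PreconnectedSpace.induction₂' LiftsJoined
    (fun t => (eventually_forall_joined γ.continuous Θ t).mono fun s hts => ⟨hts, symm hts⟩)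
    trans 0 1
  exact joined_zero_one u u' (by rwa [γ.source]) (by rwa [γ.target])

end UnitaryHomotopy

open Rokhlin

theorem quotient_mk_eq_iff_joined {G : Type*} [TopologicalSpace G] [Group G]
    [IsTopologicalGroup G] {x y : G} :
    (x : G ⧸ Subgroup.pathComponentOne G) = y ↔ Joined x y := by
  rw [QuotientGroup.eq]
  refine ⟨fun h => ?_, fun h => ?_⟩
  · have h' : Joined 1 (x⁻¹ * y) := h
    simpa only [mul_one, mul_inv_cancel_left] using h'.map (continuous_const_mul x)
  · have h' : Joined (x⁻¹ * x) (x⁻¹ * y) := h.map (continuous_const_mul x⁻¹)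
    rwa [inv_mul_cancel] at h'

section UnitaryMap

variable {B C : Type*} [Ring B] [StarRing B] [Algebra ℂ B] [Ring C] [StarRing C] [Algebra ℂ C]

/-- Entrywise application of a unital `*`-homomorphism to unitary matrices, the map that induces
`UStable.map` on homotopy classes. -/
def unitaryMap (φ : B →⋆ₐ[ℂ] C) {n : ℕ} :
    unitary (Matrix (Fin n) (Fin n) B) →⋆* unitary (Matrix (Fin n) (Fin n) C) :=
  Unitary.map
    { toFun := fun u => u.map φ
      map_one' := Matrix.map_one _ (map_zero φ) (map_one φ)
      map_mul' := fun _ _ => Matrix.map_mul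
      map_star' := fun _ => Matrix.conjTranspose_map φ (map_star φ) }

theorem unitaryPad_unitaryMap (φ : B →⋆ₐ[ℂ] C) {n m : ℕ} (h : n ≤ m)
    (u : unitary (Matrix (Fin n) (Fin n) B)) :
    unitaryPad h (unitaryMap φ u) = unitaryMap φ (unitaryPad h u) := by
  refine Subtype.ext (Matrix.ext fun i j => ?_)
  change padOne h (u.1.map φ) i j = φ (padOne h u.1 i j)
  simp only [padOne_apply, Matrix.map_apply]
  split_ifs
  · rfl
  · exact (map_one φ).symm
  · exact (map_zero φ).symm

end UnitaryMap

namespace UStable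

variable {B : Type*} [Ring B] [StarRing B] [TopologicalSpace B] [IsTopologicalRing B]
  [ContinuousStar B]

/-- The class of a unitary matrix in the stable group of homotopy classes of unitaries. -/
def mk {n : ℕ} (u : unitary (Matrix (Fin n) (Fin n) B)) : UStable B :=
  ⟦⟨n, QuotientGroup.mk u⟩⟧

theorem exists_eq_mk (x : UStable B) :
    ∃ (n : ℕ) (u : unitary (Matrix (Fin n) (Fin n) B)), x = mk u := by
  obtain ⟨n, u, rfl⟩ := DirectLimit.exists_eq_mk _ x
  obtain ⟨u, rfl⟩ := QuotientGroup.mk_surjective u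
  exact ⟨n, u, rfl⟩

theorem exists_eq_mk₂ (x y : UStable B) :
    ∃ (n : ℕ) (u v : unitary (Matrix (Fin n) (Fin n) B)), x = mk u ∧ y = mk v := by
  obtain ⟨n, u, v, rfl, rfl⟩ := DirectLimit.exists_eq_mk₂ _ x y
  obtain ⟨u, rfl⟩ := QuotientGroup.mk_surjective u
  obtain ⟨v, rfl⟩ := QuotientGroup.mk_surjective v
  exact ⟨n, u, v, rfl, rfl⟩

theorem mk_unitaryPad {n m : ℕ} (h : n ≤ m) (u : unitary (Matrix (Fin n) (Fin n) B)) :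
    mk (unitaryPad h u) = mk u := by
  let x : UPi0 B n := QuotientGroup.mk u
  exact (DirectLimit.eq_of_le (f := UPi0.pad B) ⟨n, x⟩ m h).symm

theorem mk_eq_mk_of_joined {n : ℕ} {u v : unitary (Matrix (Fin n) (Fin n) B)} (h : Joined u v) :
    mk u = mk v :=
  congrArg (fun x : UPi0 B n => (⟦⟨n, x⟩⟧ : UStable B)) (quotient_mk_eq_iff_joined.2 h)

theorem mk_eq_mk_iff {n : ℕ} {u v : unitary (Matrix (Fin n) (Fin n) B)} :
    mk u = mk v ↔ ∃ (m : ℕ) (h : n ≤ m), Joined (unitaryPad h u) (unitaryPad h v) := by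
  refine ⟨fun h => ?_, fun ⟨m, h, hjoined⟩ => ?_⟩
  · obtain ⟨m, hm, _, heq⟩ := Quotient.exact h
    exact ⟨m, hm, quotient_mk_eq_iff_joined.1 heq⟩
  · rw [← mk_unitaryPad h u, ← mk_unitaryPad h v, mk_eq_mk_of_joined hjoined]

variable {C D : Type*} [Ring C] [StarRing C] [TopologicalSpace C] [IsTopologicalRing C]
  [ContinuousStar C] [Ring D] [StarRing D] [TopologicalSpace D] [IsTopologicalRing D]
  [ContinuousStar D] [Algebra ℂ B] [Algebra ℂ C] [Algebra ℂ D]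

theorem map_mk (φ : B →⋆ₐ[ℂ] C) (hφ : Continuous φ) {n : ℕ}
    (u : unitary (Matrix (Fin n) (Fin n) B)) :
    UStable.map φ hφ (mk u) = mk (unitaryMap φ u) := rfl

theorem map_map_eq {j : B →⋆ₐ[ℂ] C} {c₀ c₁ : C →⋆ₐ[ℂ] D} (h : c₀.comp j = c₁.comp j)
    (hj : Continuous j) (hc₀ : Continuous c₀) (hc₁ : Continuous c₁) (x : UStable B) :
    UStable.map c₀ hc₀ (UStable.map j hj x) = UStable.map c₁ hc₁ (UStable.map j hj x) := by
  obtain ⟨n, u, rfl⟩ := exists_eq_mk x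
  refine congrArg mk (Subtype.ext ?_)
  ext i k
  exact DFunLike.congr_fun h (u.1 i k)

end UStable

section UnitaryLift

variable {E F H : Type*} [CStarAlgebra E] [CStarAlgebra F] [CStarAlgebra H] {j : E →⋆ₐ[ℂ] F}
  {Θ : F →⋆ₙₐ[ℂ] SeqAlg E}

theorem isLift_unitaryMap_const (h : Θ.comp j.toNonUnitalStarAlgHom = toSeqAlg E) {n : ℕ}
    (u : unitary (Matrix (Fin n) (Fin n) E)) :
    IsLift ((unitaryMap j u).1.map Θ) fun _ => u.1 := by
  have hmap : (unitaryMap j u).1.map Θ = u.1.map (toSeqAlg E) := by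
    rw [← h]
    rfl
  exact hmap ▸ IsLift.const u.1

theorem IsLift.unitaryMap {c : F →⋆ₐ[ℂ] H} {Ψ : H →⋆ₙₐ[ℂ] SeqAlg F}
    (hc : Ψ.comp c.toNonUnitalStarAlgHom = (seqAlgMap j.toNonUnitalStarAlgHom).comp Θ) {n : ℕ}
    {w : unitary (Matrix (Fin n) (Fin n) F)} {v : ℕ → unitary (Matrix (Fin n) (Fin n) E)}
    (hv : IsLift (w.1.map Θ) fun k => (v k).1) :
    IsLift ((KTheory.unitaryMap c w).1.map Ψ) fun k => (KTheory.unitaryMap j (v k)).1 := by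
  have hmap : (KTheory.unitaryMap c w).1.map Ψ =
      (w.1.map Θ).map (seqAlgMap j.toNonUnitalStarAlgHom) := by
    ext i k
    exact DFunLike.congr_fun hc (w.1 i k)
  exact hmap ▸ hv.map j.toNonUnitalStarAlgHom

end UnitaryLift

end KTheory

namespace Rokhlin.IsSeqSplitEqualizer

open KTheory
open Algebra.GrothendieckAddGroup (of)

variable {E F H : Type*} [CStarAlgebra E] [CStarAlgebra F] [CStarAlgebra H] {j : E →⋆ₐ[ℂ] F}
  {c₀ c₁ : F →⋆ₐ[ℂ] H} {Θ : F →⋆ₙₐ[ℂ] SeqAlg E} {Ψ : H →⋆ₙₐ[ℂ] SeqAlg F}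
  (h : IsSeqSplitEqualizer j.toNonUnitalStarAlgHom c₀.toNonUnitalStarAlgHom
    c₁.toNonUnitalStarAlgHom Θ Ψ)

include h

theorem starAlgHom_comp_eq : c₀.comp j = c₁.comp j :=
  StarAlgHom.ext fun x => DFunLike.congr_fun h.comp_eq x

theorem map_one_left : Θ 1 = toSeqAlg E 1 :=
  (congrArg Θ (map_one j)).symm.trans (DFunLike.congr_fun h.left_split 1)

theorem map_one_right : Ψ 1 = toSeqAlg F 1 :=
  (congrArg Ψ (map_one c₁)).symm.trans (DFunLike.congr_fun h.right_split 1)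

theorem k00_map_injective : Function.Injective (K00.map j) := by
  rw [injective_iff_map_eq_zero]
  intro x hx
  obtain ⟨a, b, rfl⟩ := exists_eq_of_sub_of x
  rw [map_sub, sub_eq_zero, K00.map_of, K00.map_of, of_eq_of_iff] at hx
  obtain ⟨c, hc⟩ := hx
  obtain ⟨s, hs⟩ := VMonoid.exists_isLift Θ c
  have ha := hc ▸ hs.add (VMonoid.isLift_map_const h.left_split a)
  have hb := hs.add (VMonoid.isLift_map_const h.left_split b)
  obtain ⟨n, hn⟩ := (ha.eventually_eq hb).exists
  rw [sub_eq_zero, of_eq_of_iff]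
  exact ⟨s n, hn⟩

theorem exists_k00_map_eq {x : K00 F} (hx : K00.map c₀ x = K00.map c₁ x) :
    ∃ y, K00.map j y = x := by
  obtain ⟨a, b, rfl⟩ := exists_eq_of_sub_of x
  simp only [map_sub, K00.map_of, sub_eq_sub_iff_add_eq_add, ← map_add, of_eq_of_iff] at hx
  obtain ⟨c, hc⟩ := hx
  obtain ⟨s, hs⟩ := VMonoid.exists_isLift Ψ c
  obtain ⟨a', ha'⟩ := VMonoid.exists_isLift Θ a
  obtain ⟨b', hb'⟩ := VMonoid.exists_isLift Θ b
  have hleft := hc ▸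
    hs.add ((ha'.map_map h.compat).add (VMonoid.isLift_map_const h.right_split b))
  have hright := hs.add ((VMonoid.isLift_map_const h.right_split a).add (hb'.map_map h.compat))
  obtain ⟨n, hn⟩ := (hleft.eventually_eq hright).exists
  refine ⟨of (a' n) - of (b' n), ?_⟩
  simp only [map_sub, K00.map_of, sub_eq_sub_iff_add_eq_add, ← map_add, of_eq_of_iff]
  exact ⟨s n, hn⟩

theorem uStable_map_injective (hj : Continuous j) : Function.Injective (UStable.map j hj) := by
  intro x y hxy
  obtain ⟨n, u, v, rfl, rfl⟩ := UStable.exists_eq_mk₂ x y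
  rw [UStable.map_mk, UStable.map_mk, UStable.mk_eq_mk_iff] at hxy
  obtain ⟨m, hm, hjoined⟩ := hxy
  rw [unitaryPad_unitaryMap, unitaryPad_unitaryMap] at hjoined
  obtain ⟨-, joined_pad⟩ := (eventually_joined_of_isLift h.map_one_left hjoined
    (u := fun _ => unitaryPad hm u) (u' := fun _ => unitaryPad hm v)
    (isLift_unitaryMap_const h.left_split _) (isLift_unitaryMap_const h.left_split _)).exists
  exact UStable.mk_eq_mk_iff.2 ⟨m, hm, joined_pad⟩

theorem exists_uStable_map_eq (hj : Continuous j) (hc₀ : Continuous c₀) (hc₁ : Continuous c₁)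
    {x : UStable F} (hx : UStable.map c₀ hc₀ x = UStable.map c₁ hc₁ x) :
    ∃ y, UStable.map j hj y = x := by
  obtain ⟨n, u, rfl⟩ := UStable.exists_eq_mk x
  rw [UStable.map_mk, UStable.map_mk, UStable.mk_eq_mk_iff] at hx
  obtain ⟨m, hm, hjoined⟩ := hx
  rw [unitaryPad_unitaryMap, unitaryPad_unitaryMap] at hjoined
  obtain ⟨v, hv⟩ := exists_isLift_unitary_map h.map_one_left (unitaryPad hm u)
  obtain ⟨k, hk⟩ := (eventually_joined_of_isLift h.map_one_right hjoined
    (u' := fun _ => unitaryPad hm u) (hv.unitaryMap h.compat)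
    (isLift_unitaryMap_const h.right_split _)).exists
  exact ⟨UStable.mk (v k), (UStable.mk_eq_mk_of_joined hk).trans (UStable.mk_unitaryPad hm u)⟩

end Rokhlin.IsSeqSplitEqualizer

namespace Rokhlin

section Unitization

variable {A B C : Type*} [NonUnitalCStarAlgebra A] [NonUnitalCStarAlgebra B]
  [NonUnitalCStarAlgebra C]

theorem toSeqAlg_one_mul {E : Type*} [CStarAlgebra E] (z : SeqAlg E) :
    toSeqAlg E 1 * z = z := by
  obtain ⟨z, rfl⟩ := proj_surjective z
  exact (map_mul (nullSeq E).proj _ _).symm.trans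
    (congrArg _ (lp.ext (funext fun n => one_mul (z n))))

theorem mul_toSeqAlg_one {E : Type*} [CStarAlgebra E] (z : SeqAlg E) :
    z * toSeqAlg E 1 = z := by
  obtain ⟨z, rfl⟩ := proj_surjective z
  exact (map_mul (nullSeq E).proj _ _).symm.trans
    (congrArg _ (lp.ext (funext fun n => mul_one (z n))))

/-- The extension of a `*`-homomorphism `A → B_∞` to the unitizations, sending the unit to the
constant sequence with value `1`. -/
def unitizeSeq (Φ : A →⋆ₙₐ[ℂ] SeqAlg B) : Unitization ℂ A →⋆ₙₐ[ℂ] SeqAlg (Unitization ℂ B) where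
  toFun x := x.fst • toSeqAlg (Unitization ℂ B) 1
    + seqAlgMap (Unitization.inrNonUnitalStarAlgHom ℂ B) (Φ x.snd)
  map_smul' c x := by
    simp only [Unitization.fst_smul, Unitization.snd_smul, map_smul, smul_eq_mul, mul_smul,
      smul_add, MonoidHom.id_apply]
  map_zero' := by
    simp only [Unitization.fst_zero, Unitization.snd_zero, map_zero, zero_smul, add_zero]
  map_add' x y := by
    simp only [Unitization.fst_add, Unitization.snd_add, map_add, add_smul]
    abel
  map_mul' x y := by
    simp only [Unitization.fst_mul, Unitization.snd_mul, map_add, map_mul, map_smul, add_mul,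
      mul_add, smul_mul_assoc, mul_smul_comm, toSeqAlg_one_mul, mul_toSeqAlg_one]
    module
  map_star' x := by
    simp only [Unitization.fst_star, Unitization.snd_star, map_star, star_add, star_smul,
      ← map_star (toSeqAlg (Unitization ℂ B)), star_one]

theorem unitizeSeq_apply (Φ : A →⋆ₙₐ[ℂ] SeqAlg B) (x : Unitization ℂ A) :
    unitizeSeq Φ x = x.fst • toSeqAlg (Unitization ℂ B) 1
      + seqAlgMap (Unitization.inrNonUnitalStarAlgHom ℂ B) (Φ x.snd) := rfl

theorem fst_starMap (φ : A →⋆ₙₐ[ℂ] B) (x : Unitization ℂ A) :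
    (Unitization.starMap φ x).fst = x.fst := by
  induction x with
  | inl_add_inr r a => simp [Unitization.algebraMap_eq_inl]

theorem snd_starMap (φ : A →⋆ₙₐ[ℂ] B) (x : Unitization ℂ A) :
    (Unitization.starMap φ x).snd = φ x.snd := by
  induction x with
  | inl_add_inr r a => simp [Unitization.algebraMap_eq_inl]

theorem unitizeSeq_comp_starMap {Φ : A →⋆ₙₐ[ℂ] SeqAlg B} {j : B →⋆ₙₐ[ℂ] A}
    (h : Φ.comp j = toSeqAlg B) :
    (unitizeSeq Φ).comp (Unitization.starMap j).toNonUnitalStarAlgHom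
      = toSeqAlg (Unitization ℂ B) := by
  refine NonUnitalStarAlgHom.ext fun x => ?_
  have hΦ : Φ (j x.snd) = toSeqAlg B x.snd := DFunLike.congr_fun h x.snd
  calc unitizeSeq Φ (Unitization.starMap j x)
      = x.fst • toSeqAlg (Unitization ℂ B) 1 + toSeqAlg (Unitization ℂ B) x.snd := by
        rw [unitizeSeq_apply, fst_starMap, snd_starMap, hΦ, seqAlgMap_toSeqAlg]
        rfl
    _ = toSeqAlg (Unitization ℂ B) x := by
        rw [← map_smul, ← map_add, ← Algebra.algebraMap_eq_smul_one,
          Unitization.algebraMap_eq_inl, Unitization.inl_fst_add_inr_snd_eq]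

theorem starMap_comp_inr (φ : A →⋆ₙₐ[ℂ] B) :
    (Unitization.starMap φ).toNonUnitalStarAlgHom.comp (Unitization.inrNonUnitalStarAlgHom ℂ A)
      = (Unitization.inrNonUnitalStarAlgHom ℂ B).comp φ :=
  NonUnitalStarAlgHom.ext fun a => Unitization.starMap_inr φ a

theorem unitizeSeq_comp_starMap_eq_seqAlgMap_starMap {θ : A →⋆ₙₐ[ℂ] SeqAlg B}
    {ψ : C →⋆ₙₐ[ℂ] SeqAlg A} {j : B →⋆ₙₐ[ℂ] A} {c : A →⋆ₙₐ[ℂ] C}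
    (h : ψ.comp c = (seqAlgMap j).comp θ) :
    (unitizeSeq ψ).comp (Unitization.starMap c).toNonUnitalStarAlgHom
      = (seqAlgMap (Unitization.starMap j).toNonUnitalStarAlgHom).comp (unitizeSeq θ) := by
  refine NonUnitalStarAlgHom.ext fun x => ?_
  have hψ : ψ (c x.snd) = seqAlgMap j (θ x.snd) := DFunLike.congr_fun h x.snd
  have map_unit : seqAlgMap (Unitization.starMap j).toNonUnitalStarAlgHom (toSeqAlg _ 1)
      = toSeqAlg _ 1 := congrArg (toSeqAlg _) (map_one (Unitization.starMap j))
  change unitizeSeq ψ (Unitization.starMap c x) = seqAlgMap _ (unitizeSeq θ x)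
  rw [unitizeSeq_apply, unitizeSeq_apply, fst_starMap, snd_starMap, hψ, map_add, map_smul,
    map_unit, ← seqAlgMap_comp_apply, ← seqAlgMap_comp_apply, starMap_comp_inr]

end Unitization

namespace IsSeqSplitEqualizer

variable {A B C : Type*} [NonUnitalCStarAlgebra A] [NonUnitalCStarAlgebra B]
  [NonUnitalCStarAlgebra C] {j : B →⋆ₙₐ[ℂ] A} {c₀ c₁ : A →⋆ₙₐ[ℂ] C} {θ : A →⋆ₙₐ[ℂ] SeqAlg B}
  {ψ : C →⋆ₙₐ[ℂ] SeqAlg A}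

theorem unitization (h : IsSeqSplitEqualizer j c₀ c₁ θ ψ) :
    IsSeqSplitEqualizer (Unitization.starMap j).toNonUnitalStarAlgHom
      (Unitization.starMap c₀).toNonUnitalStarAlgHom
      (Unitization.starMap c₁).toNonUnitalStarAlgHom (unitizeSeq θ) (unitizeSeq ψ) where
  comp_eq := by
    have comp_eq : (Unitization.starMap c₀).comp (Unitization.starMap j)
        = (Unitization.starMap c₁).comp (Unitization.starMap j) := by
      rw [← Unitization.starMap_comp, h.comp_eq, Unitization.starMap_comp]
    exact congrArg StarAlgHom.toNonUnitalStarAlgHom comp_eq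
  left_split := unitizeSeq_comp_starMap h.left_split
  right_split := unitizeSeq_comp_starMap h.right_split
  compat := unitizeSeq_comp_starMap_eq_seqAlgMap_starMap h.compat

universe w

theorem maxTensor {D : Type*} [NonUnitalCStarAlgebra D] (h : IsSeqSplitEqualizer j c₀ c₁ θ ψ) :
    IsSeqSplitEqualizer (MaxTensor.map.{w} (B := D) j) (MaxTensor.map c₀) (MaxTensor.map c₁)
      (seqTensor θ) (seqTensor ψ) where
  comp_eq := by rw [← MaxTensor.map_comp, h.comp_eq, MaxTensor.map_comp]
  left_split := seqTensor_comp_map h.left_split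
  right_split := seqTensor_comp_map h.right_split
  compat := seqTensor_comp_map_eq_seqAlgMap_map h.compat

end IsSeqSplitEqualizer

end Rokhlin

/-- For `i = 0, 1` the map `K_i(j)` is injective and its image is the equalizer of `K_i(c₀)` and
`K_i(c₁)`. -/
def KTheory.IsKEqualizer {A B C : Type*} [NonUnitalCStarAlgebra A] [NonUnitalCStarAlgebra B]
    [NonUnitalCStarAlgebra C] (j : B →⋆ₙₐ[ℂ] A) (c₀ c₁ : A →⋆ₙₐ[ℂ] C) : Prop :=
  (Function.Injective (K0.map j) ∧ Set.range (K0.map j) = {x | K0.map c₀ x = K0.map c₁ x}) ∧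
  (Function.Injective (K1.map j) ∧ Set.range (K1.map j) = {x | K1.map c₀ x = K1.map c₁ x})

namespace Rokhlin.IsSeqSplitEqualizer

open KTheory

variable {A B C : Type*} [NonUnitalCStarAlgebra A] [NonUnitalCStarAlgebra B]
  [NonUnitalCStarAlgebra C] {j : B →⋆ₙₐ[ℂ] A} {c₀ c₁ : A →⋆ₙₐ[ℂ] C} {θ : A →⋆ₙₐ[ℂ] SeqAlg B}
  {ψ : C →⋆ₙₐ[ℂ] SeqAlg A}

theorem k0_map_injective (h : IsSeqSplitEqualizer j c₀ c₁ θ ψ) :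
    Function.Injective (K0.map j) := fun _ _ hxy =>
  Subtype.ext (h.unitization.k00_map_injective (congrArg Subtype.val hxy))

theorem range_k0_map (h : IsSeqSplitEqualizer j c₀ c₁ θ ψ) :
    Set.range (K0.map j) = {x | K0.map c₀ x = K0.map c₁ x} := by
  refine Set.Subset.antisymm ?_ fun x hx => ?_
  · rintro _ ⟨x, rfl⟩
    exact Subtype.ext (K00.map_map_eq h.unitization.starAlgHom_comp_eq x.1)
  · obtain ⟨y, hy⟩ := h.unitization.exists_k00_map_eq (congrArg Subtype.val hx)
    have y_mem_ker : K00.map (unitizationChar B) y = 0 := by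
      rw [← K00_char_map j, hy]
      exact x.2
    exact ⟨⟨y, y_mem_ker⟩, Subtype.ext hy⟩

theorem k1_map_injective (h : IsSeqSplitEqualizer j c₀ c₁ θ ψ) :
    Function.Injective (K1.map j) :=
  h.unitization.uStable_map_injective _

theorem range_k1_map (h : IsSeqSplitEqualizer j c₀ c₁ θ ψ) :
    Set.range (K1.map j) = {x | K1.map c₀ x = K1.map c₁ x} := by
  refine Set.Subset.antisymm ?_ fun x hx => h.unitization.exists_uStable_map_eq _ _ _ hx
  rintro _ ⟨x, rfl⟩
  exact UStable.map_map_eq h.unitization.starAlgHom_comp_eq _ _ _ x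

theorem isKEqualizer (h : IsSeqSplitEqualizer j c₀ c₁ θ ψ) : IsKEqualizer j c₀ c₁ :=
  ⟨⟨h.k0_map_injective, h.range_k0_map⟩, h.k1_map_injective, h.range_k1_map⟩

end Rokhlin.IsSeqSplitEqualizer

end

open Rokhlin in
theorem theorem4p11_general.{w} {A : Type u} {G : Type v} [NonUnitalCStarAlgebra A]
    (hA : IsSigmaUnital A) [Group G] [TopologicalSpace G] [IsTopologicalGroup G] [CompactSpace G]
    (α : G →* (A ≃⋆ₐ[ℂ] A)) (hα : ∀ a, Continuous fun g => α g a)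
    (hR : HasRokhlinProperty α) :
    KTheory.IsKEqualizer (fixedIncl α) (coaction α hα) (constEmb A G) ∧
    ∀ (D : Type w) [NonUnitalCStarAlgebra D],
      KTheory.IsKEqualizer (MaxTensor.map.{max u v w} (B := D) (fixedIncl α))
        (MaxTensor.map (coaction α hα)) (MaxTensor.map (constEmb A G)) := by
  obtain ⟨_, _, h⟩ := hR.exists_isSeqSplitEqualizer hA hα
  exact ⟨h.isKEqualizer, fun _ _ => h.maxTensor.isKEqualizer⟩

theorem theorem4p11 {A : Type u} {G : Type v} [NonUnitalCStarAlgebra A]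
    [TopologicalSpace.SeparableSpace A] [Group G] [TopologicalSpace G] [IsTopologicalGroup G]
    [CompactSpace G] [T2Space G] [SecondCountableTopology G]
    (α : G →* (A ≃⋆ₐ[ℂ] A)) (hα : ∀ a, Continuous fun g => α g a)
    (hR : Rokhlin.HasRokhlinProperty α) :
    (Function.Injective (KTheory.K0.map (Rokhlin.fixedIncl α)) ∧
      Set.range (KTheory.K0.map (Rokhlin.fixedIncl α)) =
        {x | KTheory.K0.map (Rokhlin.coaction α hα) x =
          KTheory.K0.map (Rokhlin.constEmb A G) x}) ∧
    (Function.Injective (KTheory.K1.map (Rokhlin.fixedIncl α)) ∧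
      Set.range (KTheory.K1.map (Rokhlin.fixedIncl α)) =
        {x | KTheory.K1.map (Rokhlin.coaction α hα) x =
          KTheory.K1.map (Rokhlin.constEmb A G) x}) ∧
    ∀ n : ℕ, 2 ≤ n →
      (Function.Injective (KTheory.K0Mod.map.{max u v} n (Rokhlin.fixedIncl α)) ∧
        Set.range (KTheory.K0Mod.map.{max u v} n (Rokhlin.fixedIncl α)) =
          {x | KTheory.K0Mod.map.{max u v} n (Rokhlin.coaction α hα) x =
            KTheory.K0Mod.map.{max u v} n (Rokhlin.constEmb A G) x}) ∧
      (Function.Injective (KTheory.K1Mod.map.{max u v} n (Rokhlin.fixedIncl α)) ∧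
        Set.range (KTheory.K1Mod.map.{max u v} n (Rokhlin.fixedIncl α)) =
          {x | KTheory.K1Mod.map.{max u v} n (Rokhlin.coaction α hα) x =
            KTheory.K1Mod.map.{max u v} n (Rokhlin.constEmb A G) x}) := by
  obtain ⟨h, hD⟩ := theorem4p11_general Rokhlin.isSigmaUnital_of_separableSpace α hα hR
  exact ⟨h.1, h.2, fun n _ => hD (Rokhlin.CuntzAlgebra (n + 1))⟩
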